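/- A *probability algebra* is a $\sigma$-complete Boolean algebra $X$ with a strictly positive, countably additive measure $\mu$ of total mass $1$. Let $\Gamma$ be an arbitrary (discrete) group. A *probability algebra dynamical $\Gamma$-system* is a probability algebra with an action of $\Gamma$ by measure-preserving Boolean automorphisms. A *factor map* $X\to Y$ is a $\Gamma$-equivariant measure-preserving Boolean homomorphism from the algebra $Y$ to the algebra $X$. It makes $L^2(X)$ an $L^\infty(Y)$-module. (The spaces $L^2(X)$ and $L^\infty(X)$ are formed on the canonical Stone model of $X$.) Let $X\to Y$ be a factor map. An element $\xi\in L^2(X)$ is *almost periodic relative to $Y$* if for every $\varepsilon>0$ there is a finite set $F\subset L^2(X)$ such that every $\gamma\cdot\xi$, $\gamma\in\Gamma$, has $L^2$-distance at most $\varepsilon$ from the zonotope $\{\sum_{f\in F} f\,x_f : x_f\in L^\infty(Y),\ \|x_f\|_\infty\le 1\}$. The *maximal compact extension of $Y$ below $X$* is the intermediate factor $X\to Z\to Y$, that is, the $\Gamma$-invariant $\sigma$-subalgebra $Z$ of $X$ containing $Y$, for which $L^\infty(Z)$ is the set of all elements of $L^\infty(X)$ that are almost periodic relative to $Y$. For factor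 maps $X_1\to Y$ and $X_2\to Y$, with $\nu$ the measure of $Y$, the *relatively independent product* $X_1\times_Y X_2$ is the measure algebra of the probability measure on the product of the canonical models of $X_1$ and $X_2$ that gives $a\times b$ the mass $\int_Y E(1_a\mid Y)\,E(1_b\mid Y)\,d\nu$ for $a\in X_1$, $b\in X_2$, with the diagonal action of $\Gamma$. It has canonical factor maps to $X_1$, $X_2$ and $Y$. **Theorem.** Let $X_1,X_2,Y$ be probability algebra dynamical $\Gamma$-systems with factor maps $X_1\to Y$ and $X_2\to Y$; no countability or separability is assumed of $\Gamma$ or of the algebras. Then the maximal compact extensions $Z_1$ of $Y$ below $X_1$, $Z_2$ of $Y$ below $X_2$, and $Z$ of $Y$ below $X_1\times_Y X_2$ exist, and $$Z\cong Z_1\times_Y Z_2$$ canonically: there is an isomorphism of probability algebra dynamical $\Gamma$-systems from the algebra $Z_1\times_Y Z_2$ onto $Z\subseteq X_1\times_Y X_2$ that sends the copy of each $a\in Z_1$ in $Z_1\times_Y Z_2$ to its copy in $X_1\times_Y X_2$ under $X_1\subseteq X_1\times_Y X_2$, and likewise each $b\in Z_2$ to its copy under $X_2\subseteq X_1\times_Y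 X_2$. -/

import Mathlib

open MeasureTheory Set Filter
open scoped ENNReal

universe u v w w'

/-! ## Probability algebras -/

/-- A probability algebra: a `σ`-complete Boolean algebra with a strictly positive, countably
additive measure of total mass one. -/
class ProbabilityAlgebra (A : Type u) extends BooleanAlgebra A where
  prob : A → ℝ≥0∞
  prob_eq_zero_iff : ∀ a : A, prob a = 0 ↔ a = ⊥
  prob_top : prob ⊤ = 1
  exists_isLUB_range : ∀ s : ℕ → A, ∃ b, IsLUB (range s) b
  prob_eq_tsum : ∀ (s : ℕ → A) (b : A), (Pairwise fun m n => Disjoint (s m) (s n)) →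
    IsLUB (range s) b → prob b = ∑' n, prob (s n)

namespace ProbabilityAlgebra

theorem prob_bot {A : Type u} [ProbabilityAlgebra A] : prob (⊥ : A) = 0 :=
  (prob_eq_zero_iff _).2 rfl

theorem prob_sup {A : Type u} [ProbabilityAlgebra A] {a b : A} (h : Disjoint a b) :
    prob (a ⊔ b) = prob a + prob b := by
  let s : ℕ → A := fun n => if n = 0 then a else if n = 1 then b else ⊥
  have h0 : s 0 = a := rfl
  have h1 : s 1 = b := rfl
  have h2 : ∀ n, 2 ≤ n → s n = ⊥ := by
    intro n hn
    simp only [s]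
    rw [if_neg (by omega), if_neg (by omega)]
  have hd : Pairwise fun m n => Disjoint (s m) (s n) := by
    intro m n hmn
    rcases Nat.lt_or_ge m 2 with hm | hm
    · rcases Nat.lt_or_ge n 2 with hn | hn
      · interval_cases m <;> interval_cases n
        · exact absurd rfl hmn
        · exact h
        · exact h.symm
        · exact absurd rfl hmn
      · rw [h2 n hn]; exact disjoint_bot_right
    · rw [h2 m hm]; exact disjoint_bot_left
  have hl : IsLUB (range s) (a ⊔ b) := by
    constructor
    · rintro _ ⟨n, rfl⟩
      rcases Nat.lt_or_ge n 2 with hn | hn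
      · interval_cases n
        · exact le_sup_left
        · exact le_sup_right
      · rw [h2 n hn]; exact bot_le
    · intro c hc
      exact sup_le (hc ⟨0, rfl⟩) (hc ⟨1, rfl⟩)
  rw [prob_eq_tsum s _ hd hl, tsum_eq_sum (s := Finset.range 2)]
  · simp [Finset.sum_range_succ, h0, h1]
  · intro n hn
    rw [h2 n (by simpa [Nat.succ_le_iff] using hn), prob_bot]

/-- Measure-preserving Boolean homomorphisms of probability algebras.
They are automatically injective and `σ`-continuous. -/
structure Hom (A : Type u) (B : Type v) [ProbabilityAlgebra A] [ProbabilityAlgebra B]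
    extends BoundedLatticeHom A B where
  prob_map : ∀ a, prob (toFun a) = prob a

/-! ### The canonical model -/

/-- The canonical (Stone) space of a probability algebra `A`: its points are the Boolean
homomorphisms from `A` to the two-element algebra. -/
@[ext]
structure Canon (A : Type u) [ProbabilityAlgebra A] where
  toFun : A → Bool
  map_inf' : ∀ a b, toFun (a ⊓ b) = (toFun a && toFun b)
  map_compl' : ∀ a, toFun aᶜ = !toFun a

/-- The set of points of the canonical space given by an element of the algebra. -/
def cyl {A : Type u} [ProbabilityAlgebra A] (a : A) : Set (Canon A) :=
  {ω | ω.toFun a = true}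

/-- The `σ`-algebra generated by the sets `cyl a`. -/
instance (A : Type u) [ProbabilityAlgebra A] : MeasurableSpace (Canon A) :=
  MeasurableSpace.generateFrom (range (cyl (A := A)))

/-- The topology of pointwise convergence, i.e. the Stone topology. -/
instance (A : Type u) [ProbabilityAlgebra A] : TopologicalSpace (Canon A) :=
  TopologicalSpace.induced Canon.toFun Pi.topologicalSpace

section Cyl

variable {A : Type u} [ProbabilityAlgebra A]

theorem cyl_inf (a b : A) : cyl (a ⊓ b) = cyl a ∩ cyl b := by
  ext ω
  change ω.toFun (a ⊓ b) = true ↔ ω.toFun a = true ∧ ω.toFun b = true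
  rw [ω.map_inf', Bool.and_eq_true]

theorem cyl_compl (a : A) : cyl aᶜ = (cyl a)ᶜ := by
  ext ω
  change ω.toFun aᶜ = true ↔ ¬ (ω.toFun a = true)
  rw [ω.map_compl']
  cases ω.toFun a <;> decide

theorem cyl_sup (a b : A) : cyl (a ⊔ b) = cyl a ∪ cyl b := by
  rw [← compl_inj_iff, ← cyl_compl, compl_sup, cyl_inf, cyl_compl, cyl_compl, compl_union]

theorem cyl_bot : cyl (⊥ : A) = ∅ := by
  rw [← inf_compl_self (⊥ : A), cyl_inf, cyl_compl, inter_compl_self]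

theorem cyl_top : cyl (⊤ : A) = univ := by
  rw [← compl_bot, cyl_compl, cyl_bot, compl_empty]

theorem cyl_sdiff (a b : A) : cyl (a \ b) = cyl a \ cyl b := by
  rw [_root_.sdiff_eq, cyl_inf, cyl_compl]; rfl

theorem measurableSet_cyl (a : A) : MeasurableSet (cyl a) :=
  MeasurableSpace.measurableSet_generateFrom ⟨a, rfl⟩

theorem isClopen_cyl (a : A) : IsClopen (cyl a) := by
  have hc : Continuous fun (ω : Canon A) => ω.toFun a :=
    (continuous_apply a).comp continuous_induced_dom
  exact (isClopen_discrete ({true} : Set Bool)).preimage hc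

instance : CompactSpace (Canon A) := by
  have hind : Topology.IsInducing (Canon.toFun (A := A)) := ⟨rfl⟩
  have hr : range (Canon.toFun (A := A)) =
      {x : A → Bool | ∀ a b, x (a ⊓ b) = (x a && x b)} ∩ {x : A → Bool | ∀ a, x aᶜ = !x a} := by
    ext x
    constructor
    · rintro ⟨ω, rfl⟩
      exact ⟨ω.map_inf', ω.map_compl'⟩
    · rintro ⟨h1, h2⟩
      exact ⟨⟨x, h1, h2⟩, rfl⟩
  have e1 : IsClosed {x : A → Bool | ∀ a b, x (a ⊓ b) = (x a && x b)} := by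
    simp only [ofPred_forall]
    refine isClosed_iInter fun a => isClosed_iInter fun b => ?_
    have hand : Continuous fun p : Bool × Bool => (p.1 && p.2) := continuous_of_discreteTopology
    have hab : Continuous fun x : A → Bool => (x a, x b) :=
      (continuous_apply a).prodMk (continuous_apply b)
    exact isClosed_eq (continuous_apply _) (hand.comp hab)
  have e2 : IsClosed {x : A → Bool | ∀ a, x aᶜ = !x a} := by
    simp only [ofPred_forall]
    refine isClosed_iInter fun a => ?_
    have hnot : Continuous fun p : Bool => !p := continuous_of_discreteTopology
    exact isClosed_eq (continuous_apply _) (hnot.comp (continuous_apply a))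
  refine ⟨hind.isCompact_iff.2 ?_⟩
  rw [image_univ, hr]
  exact (e1.inter e2).isCompact

/-- Nonzero elements are seen by some point (the Boolean prime ideal theorem). -/
theorem cyl_nonempty {a : A} (ha : a ≠ ⊥) : (cyl a).Nonempty := by
  classical
  have hdis : Disjoint ((Order.PFilter.principal a : Order.PFilter A) : Set A)
      ((Order.Ideal.principal (⊥ : A) : Order.Ideal A) : Set A) := by
    rw [Set.disjoint_left]
    intro x hx hx'
    have h1 : a ≤ x := hx
    have h2 : x ≤ ⊥ := hx'
    exact ha (le_bot_iff.1 (h1.trans h2))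
  obtain ⟨J, hJ, -, hFJ⟩ := DistribLattice.prime_ideal_of_disjoint_filter_ideal hdis
  have haJ : a ∉ J := fun h => Set.disjoint_left.1 hFJ (show a ∈ _ from le_refl a) h
  have htop : (⊤ : A) ∉ J := fun h => haJ (J.lower le_top h)
  refine ⟨⟨fun x => decide (x ∉ J), ?_, ?_⟩, ?_⟩
  · intro x y
    have : x ⊓ y ∈ J ↔ x ∈ J ∨ y ∈ J :=
      ⟨hJ.mem_or_mem, fun h => h.elim (J.lower inf_le_left) (J.lower inf_le_right)⟩
    by_cases hx : x ∈ J <;> by_cases hy : y ∈ J <;> simp [this, hx, hy]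
  · intro x
    have h1 : x ∈ J ∨ xᶜ ∈ J := hJ.mem_or_compl_mem
    have h2 : x ∈ J → xᶜ ∈ J → False := fun h h' =>
      htop (by rw [← sup_compl_eq_top (x := x)]; exact Order.Ideal.sup_mem h h')
    by_cases hx : x ∈ J
    · have : xᶜ ∉ J := h2 hx
      simp [this, hx]
    · have : xᶜ ∈ J := h1.resolve_left hx
      simp [this, hx]
  · exact decide_eq_true haJ

theorem cyl_injective : Function.Injective (cyl (A := A)) := by
  have key : ∀ a b : A, cyl a = cyl b → a ≤ b := by
    intro a b h
    by_contra hab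
    have : a \ b ≠ ⊥ := fun h0 => hab (sdiff_eq_bot_iff.1 h0)
    obtain ⟨ω, hω⟩ := cyl_nonempty this
    rw [cyl_sdiff, h] at hω
    exact hω.2 hω.1
  exact fun a b h => le_antisymm (key a b h) (key b a h.symm)

theorem isSetRing_cyl : IsSetRing (range (cyl (A := A))) where
  empty_mem := ⟨⊥, cyl_bot⟩
  union_mem := by rintro _ _ ⟨a, rfl⟩ ⟨b, rfl⟩; exact ⟨a ⊔ b, cyl_sup a b⟩
  sdiff_mem := by rintro _ _ ⟨a, rfl⟩ ⟨b, rfl⟩; exact ⟨a \ b, cyl_sdiff a b⟩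

end Cyl

/-- Finitely additive contents on a semiring of compact open sets are `σ`-subadditive. -/
theorem isSigmaSubadditive_of_compact_open {T : Type u} [TopologicalSpace T] {C : Set (Set T)}
    (hC : IsSetSemiring C) (hcomp : ∀ s ∈ C, IsCompact s) (hopen : ∀ s ∈ C, IsOpen s)
    (m : AddContent ℝ≥0∞ C) : m.IsSigmaSubadditive := by
  classical
  intro f hf hU
  obtain ⟨t, ht⟩ := (hcomp _ hU).elim_finite_subcover f (fun i => hopen _ (hf i)) subset_rfl
  calc m (⋃ i, f i) ≤ ∑ u ∈ t.image f, m u := by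
        refine addContent_le_sum_of_subset_sUnion hC ?_ hU ?_
        · intro u hu
          obtain ⟨i, -, rfl⟩ := Finset.mem_image.1 (Finset.mem_coe.1 hu)
          exact hf i
        · intro x hx
          obtain ⟨i, hi, hxi⟩ := mem_iUnion₂.1 (ht hx)
          exact ⟨f i, by simpa using ⟨i, hi, rfl⟩, hxi⟩
    _ ≤ ∑ i ∈ t, m (f i) := Finset.sum_image_le_of_nonneg (fun _ _ => zero_le)
    _ ≤ ∑' i, m (f i) := ENNReal.sum_le_tsum t

section CanonMeasure

variable (A : Type u) [ProbabilityAlgebra A]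

open Classical in
/-- The value `prob a` on `cyl a`. -/
noncomputable def canonContentFun (s : Set (Canon A)) : ℝ≥0∞ :=
  if h : ∃ a : A, cyl a = s then prob h.choose else 0

variable {A} in
theorem canonContentFun_cyl (a : A) : canonContentFun A (cyl a) = prob a := by
  have h : ∃ b : A, cyl b = cyl a := ⟨a, rfl⟩
  rw [canonContentFun, dif_pos h, cyl_injective h.choose_spec]

/-- The content `cyl a ↦ prob a`. -/
noncomputable def canonContent : AddContent ℝ≥0∞ (range (cyl (A := A))) :=
  isSetRing_cyl.addContent_of_union (canonContentFun A)
    (by rw [← cyl_bot, canonContentFun_cyl, prob_bot])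
    (by
      rintro _ _ ⟨a, rfl⟩ ⟨b, rfl⟩ hd
      rw [← cyl_sup, canonContentFun_cyl, canonContentFun_cyl, canonContentFun_cyl]
      refine prob_sup (disjoint_iff.2 (cyl_injective ?_))
      rw [cyl_inf, cyl_bot]
      exact hd.inter_eq)

/-- The canonical probability measure on the canonical space: the measure with
`cyl a ↦ prob a`. -/
noncomputable def canonMeasure : Measure (Canon A) :=
  (canonContent A).measure isSetRing_cyl.isSetSemiring le_rfl
    (isSigmaSubadditive_of_compact_open isSetRing_cyl.isSetSemiring
      (by rintro _ ⟨a, rfl⟩; exact (isClopen_cyl a).isClosed.isCompact)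
      (by rintro _ ⟨a, rfl⟩; exact (isClopen_cyl a).isOpen) _)

variable {A} in
theorem canonMeasure_cyl (a : A) : canonMeasure A (cyl a) = prob a :=
  (AddContent.measure_eq (canonContent A) isSetRing_cyl.isSetSemiring rfl _
    (mem_range_self a)).trans (canonContentFun_cyl a)

instance : IsProbabilityMeasure (canonMeasure A) :=
  ⟨by rw [← cyl_top, canonMeasure_cyl, prob_top]⟩

end CanonMeasure

section Dual

variable {A : Type u} {B : Type v} [ProbabilityAlgebra A] [ProbabilityAlgebra B]

/-- The point map between the canonical spaces that is dual to a homomorphism. -/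
def Hom.dual (φ : Hom A B) (ω : Canon B) : Canon A where
  toFun a := ω.toFun (φ.toFun a)
  map_inf' a b := by
    rw [← ω.map_inf']; exact congrArg ω.toFun (φ.map_inf' a b)
  map_compl' a := by
    rw [← ω.map_compl']; exact congrArg ω.toFun (map_compl' φ.toBoundedLatticeHom a)

theorem Hom.dual_preimage_cyl (φ : Hom A B) (a : A) : φ.dual ⁻¹' cyl a = cyl (φ.toFun a) := rfl

theorem Hom.measurable_dual (φ : Hom A B) : Measurable φ.dual := by
  refine measurable_generateFrom ?_
  rintro _ ⟨a, rfl⟩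
  rw [φ.dual_preimage_cyl]
  exact measurableSet_cyl _

theorem Hom.measurePreserving_dual (φ : Hom A B) :
    MeasurePreserving φ.dual (canonMeasure B) (canonMeasure A) := by
  refine ⟨φ.measurable_dual, ?_⟩
  have : IsProbabilityMeasure ((canonMeasure B).map φ.dual) :=
    Measure.isProbabilityMeasure_map φ.measurable_dual.aemeasurable
  refine ext_of_generate_finite (range (cyl (A := A))) rfl ?_ ?_ ?_
  · rintro _ ⟨a, rfl⟩ _ ⟨b, rfl⟩ -
    exact ⟨a ⊓ b, cyl_inf a b⟩
  · rintro _ ⟨a, rfl⟩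
    rw [Measure.map_apply φ.measurable_dual (measurableSet_cyl a), φ.dual_preimage_cyl,
      canonMeasure_cyl, canonMeasure_cyl, φ.prob_map]
  · simp

end Dual

/-! ### The measure algebra of a probability space -/

section MeasureAlgebra

variable {Ω : Type u} [MeasurableSpace Ω]

/-- Measurable sets up to null sets. -/
def aeSetoid (μ : Measure Ω) : Setoid {s : Set Ω // MeasurableSet s} where
  r s t := (s : Set Ω) =ᵐ[μ] (t : Set Ω)
  iseqv := ⟨fun _ => ae_eq_refl _, fun h => h.symm, fun h h' => h.trans h'⟩

/-- The measure algebra of a measure: the measurable sets modulo the null sets. -/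
def MeasureAlgebra (μ : Measure Ω) : Type u := Quotient (aeSetoid μ)

namespace MeasureAlgebra

variable {μ : Measure Ω}

/-- The class of a measurable set. -/
def mk (μ : Measure Ω) (s : Set Ω) (hs : MeasurableSet s) : MeasureAlgebra μ :=
  Quotient.mk (aeSetoid μ) ⟨s, hs⟩

theorem mk_eq_iff {s t : Set Ω} {hs : MeasurableSet s} {ht : MeasurableSet t} :
    mk μ s hs = mk μ t ht ↔ s =ᵐ[μ] t :=
  ⟨fun h => Quotient.exact (s := aeSetoid μ) h, fun h => Quotient.sound (s := aeSetoid μ) h⟩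

theorem ind {p : MeasureAlgebra μ → Prop} (h : ∀ s hs, p (mk μ s hs)) (a : MeasureAlgebra μ) :
    p a :=
  Quotient.ind (s := aeSetoid μ) (fun s => h s.1 s.2) a

instance : LE (MeasureAlgebra μ) where
  le := Quotient.lift₂ (s₁ := aeSetoid μ) (s₂ := aeSetoid μ)
    (fun s t => (s : Set Ω) ≤ᵐ[μ] (t : Set Ω))
    (fun _ _ _ _ h h' => propext
      ⟨fun k => (h.symm.le.trans k).trans h'.le, fun k => (h.le.trans k).trans h'.symm.le⟩)

theorem mk_le_iff {s t : Set Ω} {hs : MeasurableSet s} {ht : MeasurableSet t} :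
    mk μ s hs ≤ mk μ t ht ↔ s ≤ᵐ[μ] t := Iff.rfl

instance : Max (MeasureAlgebra μ) where
  max := Quotient.map₂ (sa := aeSetoid μ) (sb := aeSetoid μ) (sc := aeSetoid μ)
    (fun s t => ⟨s.1 ∪ t.1, s.2.union t.2⟩) (fun _ _ h _ _ h' => ae_eq_set_union h h')

instance : Min (MeasureAlgebra μ) where
  min := Quotient.map₂ (sa := aeSetoid μ) (sb := aeSetoid μ) (sc := aeSetoid μ)
    (fun s t => ⟨s.1 ∩ t.1, s.2.inter t.2⟩) (fun _ _ h _ _ h' => ae_eq_set_inter h h')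

instance : Compl (MeasureAlgebra μ) where
  compl := Quotient.map (sa := aeSetoid μ) (sb := aeSetoid μ)
    (fun s => ⟨s.1ᶜ, s.2.compl⟩) (fun _ _ h => ae_eq_set_compl_compl.2 h)

theorem mk_sup {s t : Set Ω} (hs : MeasurableSet s) (ht : MeasurableSet t) :
    mk μ s hs ⊔ mk μ t ht = mk μ (s ∪ t) (hs.union ht) := rfl

theorem mk_inf {s t : Set Ω} (hs : MeasurableSet s) (ht : MeasurableSet t) :
    mk μ s hs ⊓ mk μ t ht = mk μ (s ∩ t) (hs.inter ht) := rfl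

theorem mk_compl {s : Set Ω} (hs : MeasurableSet s) :
    (mk μ s hs)ᶜ = mk μ sᶜ hs.compl := rfl

instance : BooleanAlgebra (MeasureAlgebra μ) where
  sup := max
  inf := min
  le_refl := ind fun s hs => mk_le_iff.2 (EventuallyLE.refl _ _)
  le_trans := ind fun s hs => ind fun t ht => ind fun r hr => fun h h' =>
    mk_le_iff.2 ((mk_le_iff.1 h).trans (mk_le_iff.1 h'))
  le_antisymm := ind fun s hs => ind fun t ht => fun h h' =>
    mk_eq_iff.2 ((mk_le_iff.1 h).antisymm (mk_le_iff.1 h'))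
  le_sup_left := ind fun s hs => ind fun t ht =>
    mk_le_iff.2 (LE.le.eventuallyLE subset_union_left)
  le_sup_right := ind fun s hs => ind fun t ht =>
    mk_le_iff.2 (LE.le.eventuallyLE subset_union_right)
  sup_le := ind fun s hs => ind fun t ht => ind fun r hr => fun h h' => by
    rw [mk_le_iff] at h h'
    refine mk_le_iff.2 ?_
    filter_upwards [h, h'] with x hx hx'
    exact fun k => k.elim hx hx'
  inf_le_left := ind fun s hs => ind fun t ht =>
    mk_le_iff.2 (LE.le.eventuallyLE inter_subset_left)
  inf_le_right := ind fun s hs => ind fun t ht =>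
    mk_le_iff.2 (LE.le.eventuallyLE inter_subset_right)
  le_inf := ind fun s hs => ind fun t ht => ind fun r hr => fun h h' => by
    rw [mk_le_iff] at h h'
    refine mk_le_iff.2 ?_
    filter_upwards [h, h'] with x hx hx'
    exact fun k => ⟨hx k, hx' k⟩
  le_sup_inf := ind fun s hs => ind fun t ht => ind fun r hr =>
    mk_le_iff.2 (LE.le.eventuallyLE (union_inter_distrib_left s t r).symm.subset)
  top := mk μ univ .univ
  bot := mk μ ∅ .empty
  le_top := ind fun s hs => mk_le_iff.2 (LE.le.eventuallyLE (subset_univ s))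
  bot_le := ind fun s hs => mk_le_iff.2 (LE.le.eventuallyLE (empty_subset s))
  inf_compl_le_bot := ind fun s hs =>
    mk_le_iff.2 (LE.le.eventuallyLE (inter_compl_self s).subset)
  top_le_sup_compl := ind fun s hs =>
    mk_le_iff.2 (LE.le.eventuallyLE (union_compl_self s).symm.subset)

theorem isLUB_mk (s : ℕ → Set Ω) (hs : ∀ n, MeasurableSet (s n)) :
    IsLUB (range fun n => mk μ (s n) (hs n)) (mk μ (⋃ n, s n) (.iUnion hs)) := by
  constructor
  · rintro _ ⟨n, rfl⟩
    exact mk_le_iff.2 (LE.le.eventuallyLE (subset_iUnion s n))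
  · refine fun b => ind (p := fun b => b ∈ upperBounds _ → _ ≤ b) (fun t ht h => ?_) b
    have h' : ∀ n, s n ≤ᵐ[μ] t := fun n => mk_le_iff.1 (h ⟨n, rfl⟩)
    refine mk_le_iff.2 ?_
    filter_upwards [ae_all_iff.2 h'] with x hx hx'
    obtain ⟨n, hn⟩ := mem_iUnion.1 hx'
    exact hx n hn

theorem exists_rep (a : ℕ → MeasureAlgebra μ) :
    ∃ (s : ℕ → Set Ω) (hs : ∀ n, MeasurableSet (s n)), a = fun n => mk μ (s n) (hs n) := by
  have : ∀ n, ∃ s : {s : Set Ω // MeasurableSet s}, a n = mk μ s.1 s.2 := fun n =>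
    ind (p := fun b => ∃ s : {s : Set Ω // MeasurableSet s}, b = mk μ s.1 s.2)
      (fun s hs => ⟨⟨s, hs⟩, rfl⟩) (a n)
  choose s hs using this
  exact ⟨fun n => (s n).1, fun n => (s n).2, funext hs⟩

/-- The measure algebra of a probability space is a probability algebra. -/
instance [IsProbabilityMeasure μ] : ProbabilityAlgebra (MeasureAlgebra μ) where
  prob := Quotient.lift (s := aeSetoid μ) (fun s => μ s.1) (fun _ _ h => measure_congr h)
  prob_eq_zero_iff := ind fun s hs => by
    change μ s = 0 ↔ mk μ s hs = mk μ ∅ .empty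
    rw [mk_eq_iff, ae_eq_empty]
  prob_top := measure_univ (μ := μ)
  exists_isLUB_range a := by
    obtain ⟨s, hs, rfl⟩ := exists_rep a
    exact ⟨_, isLUB_mk s hs⟩
  prob_eq_tsum a b hd hb := by
    obtain ⟨s, hs, rfl⟩ := exists_rep a
    rw [hb.unique (isLUB_mk s hs)]
    refine measure_iUnion₀ (fun m n hmn => ?_) (fun n => (hs n).nullMeasurableSet)
    have := disjoint_iff.1 (hd hmn)
    exact ae_eq_empty.1 (mk_eq_iff.1 this)

theorem prob_mk [IsProbabilityMeasure μ] {s : Set Ω} (hs : MeasurableSet s) :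
    prob (mk μ s hs) = μ s := rfl

/-- Preimages under a measure-preserving map. -/
def preimage {T : Ω → Ω} (hT : MeasurePreserving T μ μ) :
    MeasureAlgebra μ → MeasureAlgebra μ :=
  Quotient.map (sa := aeSetoid μ) (sb := aeSetoid μ)
    (fun s => ⟨T ⁻¹' s.1, hT.measurable s.2⟩)
    (fun _ _ h => hT.quasiMeasurePreserving.preimage_ae_eq h)

theorem preimage_mk {T : Ω → Ω} (hT : MeasurePreserving T μ μ) {s : Set Ω}
    (hs : MeasurableSet s) :
    preimage hT (mk μ s hs) = mk μ (T ⁻¹' s) (hT.measurable hs) := rfl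

end MeasureAlgebra

end MeasureAlgebra

/-! ### Function spaces -/

/-- The Hilbert space `L²(A)`. -/
noncomputable abbrev L2 (A : Type u) [ProbabilityAlgebra A] := Lp ℂ 2 (canonMeasure A)

/-- The (commutative von Neumann) algebra `L^∞(A)`. -/
noncomputable abbrev LInf (A : Type u) [ProbabilityAlgebra A] := Lp ℂ ∞ (canonMeasure A)

/-- The inclusion `L^∞(A) ⊆ L²(A)`. -/
noncomputable def LInf.toL2 {A : Type u} [ProbabilityAlgebra A] (x : LInf A) : L2 A :=
  ((Lp.memLp x).mono_exponent le_top).toLp x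

/-- The map `L²(A) → L²(B)` induced by a homomorphism `A → B`. -/
noncomputable def Hom.mapL2 {A : Type u} {B : Type v} [ProbabilityAlgebra A]
    [ProbabilityAlgebra B] (φ : Hom A B) (ξ : L2 A) : L2 B :=
  Lp.compMeasurePreserving φ.dual φ.measurePreserving_dual ξ

/-- The map `L^∞(A) → L^∞(B)` induced by a homomorphism `A → B`. -/
noncomputable def Hom.mapLInf {A : Type u} {B : Type v} [ProbabilityAlgebra A]
    [ProbabilityAlgebra B] (φ : Hom A B) (x : LInf A) : LInf B :=
  Lp.compMeasurePreserving φ.dual φ.measurePreserving_dual x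

/-- `L²(B)` as an `L^∞(A)`-module, for a homomorphism `A → B`. -/
noncomputable def Hom.act {A : Type u} {B : Type v} [ProbabilityAlgebra A]
    [ProbabilityAlgebra B] (φ : Hom A B) (ξ : L2 B) (x : LInf A) : L2 B :=
  (φ.mapLInf x • ξ : Lp ℂ 2 (canonMeasure B))

/-! ### Dynamical systems and factor maps -/

/-- An action of a group on a probability algebra by measure-preserving Boolean automorphisms. -/
class System (Γ : Type w) [Group Γ] (A : Type u) [ProbabilityAlgebra A]
    extends MulAction Γ A where
  smul_inf : ∀ (γ : Γ) (a b : A), γ • (a ⊓ b) = γ • a ⊓ γ • b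
  smul_compl : ∀ (γ : Γ) (a : A), γ • aᶜ = (γ • a)ᶜ
  prob_smul : ∀ (γ : Γ) (a : A), prob (γ • a) = prob a

section Systems

variable {Γ : Type w} [Group Γ]

theorem System.smul_sup {A : Type u} [ProbabilityAlgebra A] [System Γ A] (γ : Γ) (a b : A) :
    γ • (a ⊔ b) = γ • a ⊔ γ • b := by
  rw [← compl_inj_iff, ← System.smul_compl, compl_sup, compl_sup, System.smul_inf,
    System.smul_compl, System.smul_compl]

theorem System.smul_bot {A : Type u} [ProbabilityAlgebra A] [System Γ A] (γ : Γ) :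
    γ • (⊥ : A) = ⊥ := by
  rw [← inf_compl_self (⊥ : A), System.smul_inf, System.smul_compl, inf_compl_self,
    inf_compl_self]

theorem System.smul_top {A : Type u} [ProbabilityAlgebra A] [System Γ A] (γ : Γ) :
    γ • (⊤ : A) = ⊤ := by
  rw [← compl_bot, System.smul_compl, System.smul_bot]

/-- The automorphism given by a group element. -/
def System.toHom (A : Type u) [ProbabilityAlgebra A] [System Γ A] (γ : Γ) : Hom A A where
  toFun a := γ • a
  map_sup' := System.smul_sup γ
  map_inf' := System.smul_inf γ
  map_top' := System.smul_top γ
  map_bot' := System.smul_bot γ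
  prob_map := System.prob_smul γ

/-- A factor map `X → Y` of probability algebra dynamical systems is an equivariant
measure-preserving Boolean homomorphism from the algebra `Y` to the algebra `X`. -/
structure FactorMap (Γ : Type w) [Group Γ] (X : Type u) (Y : Type v) [ProbabilityAlgebra X]
    [ProbabilityAlgebra Y] [System Γ X] [System Γ Y] extends Hom Y X where
  map_smul : ∀ (γ : Γ) (y : Y), toFun (γ • y) = γ • toFun y

/-! ### Relatively almost periodic elements -/

section AlmostPeriodic

variable {X : Type u} {Y : Type v} [ProbabilityAlgebra X] [ProbabilityAlgebra Y]

/-- The module zonotope generated by a finite set `F ⊆ L²(X)`. -/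
def zonotope (φ : Hom Y X) (F : Finset (L2 X)) : Set (L2 X) :=
  {ζ | ∃ x : L2 X → LInf Y, (∀ f ∈ F, ‖x f‖ ≤ 1) ∧ ζ = ∑ f ∈ F, φ.act f (x f)}

/-- Conditional precompactness of a subset of `L²(X)` relative to `Y`. -/
def CondPrecompact (φ : Hom Y X) (K : Set (L2 X)) : Prop :=
  ∀ ε : ℝ, 0 < ε → ∃ F : Finset (L2 X), ∀ k ∈ K, Metric.infDist k (zonotope φ F) ≤ ε

/-- `ξ ∈ L²(X)` is almost periodic relative to `Y`: its orbit is conditionally precompact. -/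
def AlmostPeriodic [System Γ X] [System Γ Y] (f : FactorMap Γ X Y) (ξ : L2 X) : Prop :=
  CondPrecompact f.toHom (range fun γ : Γ => (System.toHom X γ).mapL2 ξ)

end AlmostPeriodic

/-! ### Intermediate factors and maximal compact extensions -/

section Intermediate

variable {X : Type u} {Y : Type v} [ProbabilityAlgebra X] [ProbabilityAlgebra Y]
  [System Γ X] [System Γ Y]

/-- An intermediate factor `X → Z → Y`: an invariant `σ`-subalgebra of `X` that contains `Y`. -/
structure IntermediateFactor (f : FactorMap Γ X Y) extends BooleanSubalgebra X where
  isLUB_mem : ∀ (s : ℕ → X) (b : X), (∀ n, s n ∈ carrier) → IsLUB (range s) b → b ∈ carrier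
  smul_mem : ∀ (γ : Γ) (a : X), a ∈ carrier → γ • a ∈ carrier
  map_mem : ∀ y : Y, f.toFun y ∈ carrier

namespace IntermediateFactor

variable {f : FactorMap Γ X Y} (Z : IntermediateFactor f)

/-- The elements of an intermediate factor, as a type. -/
def Elem : Type u := Z.toBooleanSubalgebra

/-- An element of `Z`, seen in `X`. -/
def Elem.val {Z : IntermediateFactor f} (a : Z.Elem) : X := Subtype.val a

instance : BooleanAlgebra Z.Elem :=
  inferInstanceAs (BooleanAlgebra Z.toBooleanSubalgebra)

theorem isLUB_val (s : ℕ → Z.Elem) (b : Z.Elem) :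
    IsLUB (range s) b ↔ IsLUB (range fun n => (s n).val) b.val := by
  constructor
  · intro h
    obtain ⟨c, hc⟩ := ProbabilityAlgebra.exists_isLUB_range fun n => (s n).val
    have hcZ : c ∈ Z.carrier := Z.isLUB_mem _ c (fun n => Subtype.property (s n)) hc
    have h1 : b.val ≤ c := by
      refine (isLUB_le_iff (b := (show Z.Elem from ⟨c, hcZ⟩)) h).2 ?_
      rintro _ ⟨n, rfl⟩
      exact hc.1 ⟨n, rfl⟩
    have h2 : c ≤ b.val := by
      refine (isLUB_le_iff hc).2 ?_
      rintro _ ⟨n, rfl⟩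
      exact h.1 ⟨n, rfl⟩
    rwa [le_antisymm h1 h2]
  · intro h
    constructor
    · rintro _ ⟨n, rfl⟩
      exact h.1 ⟨n, rfl⟩
    · intro c hc
      refine (isLUB_le_iff (b := c.val) h).2 ?_
      rintro _ ⟨n, rfl⟩
      exact hc ⟨n, rfl⟩

instance : ProbabilityAlgebra Z.Elem where
  prob a := prob a.val
  prob_eq_zero_iff a := by
    rw [prob_eq_zero_iff]
    exact ⟨fun h => Subtype.ext h, fun h => congrArg Elem.val h⟩
  prob_top := prob_top (A := X)
  exists_isLUB_range s := by
    obtain ⟨c, hc⟩ := ProbabilityAlgebra.exists_isLUB_range fun n => (s n).val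
    exact ⟨⟨c, Z.isLUB_mem _ c (fun n => Subtype.property (s n)) hc⟩, (Z.isLUB_val _ _).2 hc⟩
  prob_eq_tsum s b hd hb := by
    refine prob_eq_tsum (fun n => (s n).val) b.val (fun m n hmn => ?_) ((Z.isLUB_val s b).1 hb)
    exact disjoint_iff.2 (congrArg Elem.val (disjoint_iff.1 (hd hmn)))

instance : System Γ Z.Elem where
  smul γ a := ⟨γ • a.val, Z.smul_mem γ _ (Subtype.property a)⟩
  one_smul a := Subtype.ext (one_smul Γ a.val)
  mul_smul γ δ a := Subtype.ext (mul_smul γ δ a.val)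
  smul_inf γ a b := Subtype.ext (System.smul_inf γ a.val b.val)
  smul_compl γ a := Subtype.ext (System.smul_compl γ a.val)
  prob_smul γ a := System.prob_smul γ a.val

/-- The factor map `X → Z`. -/
def fromTop : FactorMap Γ X Z.Elem where
  toFun a := a.val
  map_sup' _ _ := rfl
  map_inf' _ _ := rfl
  map_top' := rfl
  map_bot' := rfl
  prob_map _ := rfl
  map_smul _ _ := rfl

/-- The factor map `Z → Y`. -/
def toBase : FactorMap Γ Z.Elem Y where
  toFun y := ⟨f.toFun y, Z.map_mem y⟩
  map_sup' a b := Subtype.ext (f.map_sup' a b)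
  map_inf' a b := Subtype.ext (f.map_inf' a b)
  map_top' := Subtype.ext f.map_top'
  map_bot' := Subtype.ext f.map_bot'
  prob_map y := f.prob_map y
  map_smul γ y := Subtype.ext (f.map_smul γ y)

/-- `Z` is the maximal compact extension of `Y` below `X`: `L^∞(Z)` is the set of all elements of
`L^∞(X)` that are almost periodic relative to `Y`. -/
def IsMaximalCompact : Prop :=
  range Z.fromTop.toHom.mapLInf = {x : LInf X | AlmostPeriodic f (LInf.toL2 x)}

end IntermediateFactor

end Intermediate

/-! ### The relatively independent product -/

section RelProd

variable {X₁ : Type u} {X₂ : Type v} {Y : Type w'} [ProbabilityAlgebra X₁]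
  [ProbabilityAlgebra X₂] [ProbabilityAlgebra Y]

/-- The conditional probability `E(1_A | Y)`, as a function on the canonical space of `Y`, of a
set `A` in the canonical space of an extension. -/
noncomputable def condProb (φ : Hom Y X₁) (A : Set (Canon X₁)) : Canon Y → ℝ≥0∞ :=
  (((canonMeasure X₁).restrict A).map φ.dual).rnDeriv (canonMeasure Y)

theorem condProb_ac (φ : Hom Y X₁) (A : Set (Canon X₁)) :
    ((canonMeasure X₁).restrict A).map φ.dual ≪ canonMeasure Y := by
  rw [← φ.measurePreserving_dual.map_eq]
  exact Measure.restrict_le_self.absolutelyContinuous.map φ.measurable_dual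

theorem measurable_condProb (φ : Hom Y X₁) (A : Set (Canon X₁)) : Measurable (condProb φ A) :=
  Measure.measurable_rnDeriv _ _

/-- The defining property of the conditional probability. -/
theorem lintegral_condProb_mul (φ : Hom Y X₁) (A : Set (Canon X₁)) {g : Canon Y → ℝ≥0∞}
    (hg : Measurable g) :
    ∫⁻ y, condProb φ A y * g y ∂canonMeasure Y = ∫⁻ x in A, g (φ.dual x) ∂canonMeasure X₁ := by
  rw [condProb, lintegral_rnDeriv_mul (condProb_ac φ A) hg.aemeasurable,
    lintegral_map hg φ.measurable_dual]

theorem condProb_biUnion (φ : Hom Y X₁) {ι : Type*} (J : Finset ι) (A : ι → Set (Canon X₁))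
    (hA : ∀ i ∈ J, MeasurableSet (A i)) (hd : (J : Set ι).PairwiseDisjoint A) :
    condProb φ (⋃ i ∈ J, A i) =ᵐ[canonMeasure Y] fun y => ∑ i ∈ J, condProb φ (A i) y := by
  refine ae_eq_of_forall_setLIntegral_eq_of_sigmaFinite (measurable_condProb φ _)
    (Finset.measurable_fun_sum _ fun i _ => measurable_condProb φ _) fun s hs _ => ?_
  have key : ∀ B, ∫⁻ y in s, condProb φ B y ∂canonMeasure Y =
      ∫⁻ x in B, s.indicator 1 (φ.dual x) ∂canonMeasure X₁ := by
    intro B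
    rw [← lintegral_condProb_mul φ B (measurable_one.indicator hs), ← lintegral_indicator hs]
    refine lintegral_congr fun y => ?_
    by_cases hy : y ∈ s <;> simp [hy]
  rw [key, lintegral_finsetSum _ fun i _ => measurable_condProb φ _]
  simp_rw [key]
  rw [lintegral_biUnion_finset hd hA]

/-- The value `∫_Y E(1_A | Y) E(1_B | Y)` on the rectangle `A × B`. -/
noncomputable def relForm (φ₁ : Hom Y X₁) (φ₂ : Hom Y X₂) (A : Set (Canon X₁))
    (B : Set (Canon X₂)) : ℝ≥0∞ :=
  ∫⁻ y, condProb φ₁ A y * condProb φ₂ B y ∂canonMeasure Y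

theorem relForm_eq (φ₁ : Hom Y X₁) (φ₂ : Hom Y X₂) (A : Set (Canon X₁))
    {B : Set (Canon X₂)} (hB : MeasurableSet B) :
    relForm φ₁ φ₂ A B =
      ∫⁻ z, B.indicator (fun z => condProb φ₁ A (φ₂.dual z)) z ∂canonMeasure X₂ := by
  rw [relForm, lintegral_indicator hB, ← lintegral_condProb_mul φ₂ B (measurable_condProb φ₁ A)]
  simp_rw [mul_comm]

variable (X₁ X₂) in
/-- The rectangles `cyl a × cyl b`. -/
def rectangles : Set (Set (Canon X₁ × Canon X₂)) :=
  image2 (fun A B => A ×ˢ B) (range (cyl (A := X₁))) (range (cyl (A := X₂)))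

theorem isSetSemiring_rectangles : IsSetSemiring (rectangles X₁ X₂) where
  empty_mem := ⟨_, ⟨⊥, rfl⟩, _, ⟨⊥, rfl⟩, by simp [cyl_bot]⟩
  inter_mem := by
    rintro _ ⟨_, ⟨a, rfl⟩, _, ⟨b, rfl⟩, rfl⟩ _ ⟨_, ⟨c, rfl⟩, _, ⟨d, rfl⟩, rfl⟩
    exact ⟨_, ⟨a ⊓ c, rfl⟩, _, ⟨b ⊓ d, rfl⟩, by rw [cyl_inf, cyl_inf, prod_inter_prod]⟩
  sdiff_eq_sUnion' := by
    classical
    rintro _ ⟨_, ⟨a, rfl⟩, _, ⟨b, rfl⟩, rfl⟩ _ ⟨_, ⟨c, rfl⟩, _, ⟨d, rfl⟩, rfl⟩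
    refine ⟨{cyl (a \ c) ×ˢ cyl b, cyl (a ⊓ c) ×ˢ cyl (b \ d)}, ?_, ?_, ?_⟩
    · intro s hs
      simp only [Finset.coe_insert, Finset.coe_singleton, mem_insert_iff,
        mem_singleton_iff] at hs
      rcases hs with rfl | rfl
      · exact ⟨_, ⟨_, rfl⟩, _, ⟨_, rfl⟩, rfl⟩
      · exact ⟨_, ⟨_, rfl⟩, _, ⟨_, rfl⟩, rfl⟩
    · have hd : Disjoint (cyl (a \ c) ×ˢ cyl b) (cyl (a ⊓ c) ×ˢ cyl (b \ d)) := by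
        rw [Set.disjoint_left]
        rintro ⟨x, y⟩ ⟨h1, -⟩ ⟨h2, -⟩
        simp only [cyl_sdiff, cyl_inf] at h1 h2
        exact h1.2 h2.2
      intro s hs t ht hst
      simp only [Finset.coe_insert, Finset.coe_singleton, mem_insert_iff,
        mem_singleton_iff] at hs ht
      rcases hs with rfl | rfl <;> rcases ht with rfl | rfl
      · exact absurd rfl hst
      · exact hd
      · exact hd.symm
      · exact absurd rfl hst
    · ext ⟨x, y⟩
      simp only [Finset.coe_insert, Finset.coe_singleton, sUnion_insert, sUnion_singleton,
        cyl_sdiff, cyl_inf, Set.mem_sdiff, mem_prod, mem_union, mem_inter_iff]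
      tauto

/-- The content `cyl a × cyl b ↦ ∫_Y E(1_a | Y) E(1_b | Y)`. -/
noncomputable def relContent (φ₁ : Hom Y X₁) (φ₂ : Hom Y X₂) :
    AddContent ℝ≥0∞ (rectangles X₁ X₂) where
  toFun s := relForm φ₁ φ₂ (Prod.fst '' s) (Prod.snd '' s)
  empty' := by
    rw [relForm_eq _ _ _ (by simp)]
    simp
  sUnion' I hI hd hU := by
    classical
    have hprod : ∀ s ∈ rectangles X₁ X₂, MeasurableSet (Prod.fst '' s) ∧
        MeasurableSet (Prod.snd '' s) ∧ s = (Prod.fst '' s) ×ˢ (Prod.snd '' s) := by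
      rintro _ ⟨_, ⟨a, rfl⟩, _, ⟨b, rfl⟩, rfl⟩
      rcases (cyl a).eq_empty_or_nonempty with ha | ha
      · simp [ha]
      rcases (cyl b).eq_empty_or_nonempty with hb | hb
      · simp [hb]
      rw [fst_image_prod _ hb, snd_image_prod ha]
      exact ⟨measurableSet_cyl a, measurableSet_cyl b, rfl⟩
    have hJ : ∀ J ∈ I.powerset, ∀ᵐ z ∂canonMeasure X₂,
        (J : Set (Set (Canon X₁ × Canon X₂))).PairwiseDisjoint (fun s => Prod.fst '' s) →
        condProb φ₁ (⋃ s ∈ J, Prod.fst '' s) (φ₂.dual z) =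
          ∑ s ∈ J, condProb φ₁ (Prod.fst '' s) (φ₂.dual z) := by
      intro J hJ
      by_cases h : (J : Set (Set (Canon X₁ × Canon X₂))).PairwiseDisjoint
          (fun s => Prod.fst '' s)
      · have := φ₂.measurePreserving_dual.quasiMeasurePreserving.ae
          (condProb_biUnion φ₁ J (fun s => Prod.fst '' s)
            (fun s hs => (hprod s (hI (Finset.mem_powerset.1 hJ hs))).1) h)
        filter_upwards [this] with z hz _ using hz
      · exact Eventually.of_forall fun z hz => absurd hz h
    have hall := (Finset.eventually_all I.powerset).2 hJ
    have hempty : ∀ᵐ z ∂canonMeasure X₂, condProb φ₁ ∅ (φ₂.dual z) = 0 := by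
      have := φ₂.measurePreserving_dual.quasiMeasurePreserving.ae
          (condProb_biUnion φ₁ (∅ : Finset ℕ) (fun _ => ∅) (by simp) (by simp))
      filter_upwards [this] with z hz
      simpa using hz
    obtain ⟨-, hUm, hUe⟩ := hprod _ hU
    rw [relForm_eq _ _ _ hUm, Finset.sum_congr rfl fun s hs =>
      relForm_eq φ₁ φ₂ (Prod.fst '' s) (hprod s (hI hs)).2.1, ← lintegral_finsetSum]
    swap
    · exact fun s hs => (((measurable_condProb φ₁ _).comp φ₂.measurable_dual).indicator
        (hprod s (hI hs)).2.1)
    refine lintegral_congr_ae ?_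
    filter_upwards [hall, hempty] with z hz hz0
    have hmem : ∀ s ∈ I, ∀ x, x ∈ Prod.fst '' s → z ∈ Prod.snd '' s → (x, z) ∈ s := by
      intro s hs x hx hz'
      rw [(hprod s (hI hs)).2.2]
      exact ⟨hx, hz'⟩
    have hz1 := hz (I.filter fun s => z ∈ Prod.snd '' s)
      (Finset.mem_powerset.2 (Finset.filter_subset _ _)) (by
        intro s hs t ht hst
        rw [Finset.mem_coe, Finset.mem_filter] at hs ht
        refine Set.disjoint_left.2 fun x hx hx' => ?_
        exact Set.disjoint_left.1 (hd hs.1 ht.1 hst) (hmem s hs.1 x hx hs.2)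
          (hmem t ht.1 x hx' ht.2))
    have hsum : ∑ s ∈ I, (Prod.snd '' s).indicator
          (fun z => condProb φ₁ (Prod.fst '' s) (φ₂.dual z)) z =
        condProb φ₁ (⋃ s ∈ I.filter fun s => z ∈ Prod.snd '' s, Prod.fst '' s)
          (φ₂.dual z) := by
      rw [hz1, Finset.sum_filter]
      refine Finset.sum_congr rfl fun s _ => ?_
      by_cases h : z ∈ Prod.snd '' s <;> simp only [h, indicator_of_mem, indicator_of_notMem,
        if_true, if_false, not_false_eq_true]
    rw [hsum]
    by_cases hzU : z ∈ Prod.snd '' ⋃₀ (I : Set (Set (Canon X₁ × Canon X₂)))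
    · rw [indicator_of_mem hzU]
      congr 1
      ext x
      simp only [mem_iUnion, Finset.mem_filter, exists_prop]
      constructor
      · intro hx
        have : (x, z) ∈ ⋃₀ (I : Set (Set (Canon X₁ × Canon X₂))) := by
          rw [hUe]; exact ⟨hx, hzU⟩
        obtain ⟨s, hs, hxs⟩ := this
        exact ⟨s, ⟨hs, ⟨_, hxs, rfl⟩⟩, ⟨_, hxs, rfl⟩⟩
      · rintro ⟨s, ⟨hs, -⟩, p, hp, rfl⟩
        exact ⟨p, ⟨s, hs, hp⟩, rfl⟩
    · rw [indicator_of_notMem hzU]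
      have : (⋃ s ∈ I.filter fun s => z ∈ Prod.snd '' s, Prod.fst '' s) = ∅ := by
        rw [Set.eq_empty_iff_forall_notMem]
        intro x hx
        simp only [mem_iUnion, Finset.mem_filter, exists_prop] at hx
        obtain ⟨s, ⟨hs, p, hp, rfl⟩, -⟩ := hx
        exact hzU ⟨p, ⟨s, hs, hp⟩, rfl⟩
      rw [this, hz0]

theorem generateFrom_rectangles :
    (Prod.instMeasurableSpace : MeasurableSpace (Canon X₁ × Canon X₂)) =
      MeasurableSpace.generateFrom (rectangles X₁ X₂) :=
  (generateFrom_eq_prod (C := range (cyl (A := X₁))) (D := range (cyl (A := X₂))) rfl rfl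
    ⟨fun _ => univ, fun _ => ⟨⊤, cyl_top⟩, iUnion_const _⟩
    ⟨fun _ => univ, fun _ => ⟨⊤, cyl_top⟩, iUnion_const _⟩).symm

/-- The relatively independent joining over `Y`: the measure on the product of the canonical
spaces with `cyl a × cyl b ↦ ∫_Y E(1_a | Y) E(1_b | Y)`. -/
noncomputable def relMeasure (φ₁ : Hom Y X₁) (φ₂ : Hom Y X₂) :
    Measure (Canon X₁ × Canon X₂) :=
  (relContent φ₁ φ₂).measure isSetSemiring_rectangles generateFrom_rectangles.le
    (isSigmaSubadditive_of_compact_open isSetSemiring_rectangles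
      (by
        rintro _ ⟨_, ⟨a, rfl⟩, _, ⟨b, rfl⟩, rfl⟩
        exact (isClopen_cyl a).isClosed.isCompact.prod (isClopen_cyl b).isClosed.isCompact)
      (by
        rintro _ ⟨_, ⟨a, rfl⟩, _, ⟨b, rfl⟩, rfl⟩
        exact (isClopen_cyl a).isOpen.prod (isClopen_cyl b).isOpen) _)

theorem relMeasure_prod (φ₁ : Hom Y X₁) (φ₂ : Hom Y X₂) (a : X₁) (b : X₂) :
    relMeasure φ₁ φ₂ (cyl a ×ˢ cyl b) = relForm φ₁ φ₂ (cyl a) (cyl b) := by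
  refine (AddContent.measure_eq (relContent φ₁ φ₂) isSetSemiring_rectangles
    generateFrom_rectangles _
    (mem_image2_of_mem (mem_range_self a) (mem_range_self b))).trans ?_
  change relForm φ₁ φ₂ (Prod.fst '' _) (Prod.snd '' _) = _
  rcases (cyl a).eq_empty_or_nonempty with ha | ha
  · have h0 : ∀ B, relForm φ₁ φ₂ ∅ B = 0 := fun B => by
      have h := condProb_biUnion φ₁ (∅ : Finset ℕ) (fun _ => ∅) (by simp) (by simp)
      rw [relForm]
      refine (lintegral_eq_zero_iff
        ((measurable_condProb φ₁ ∅).mul (measurable_condProb φ₂ B))).2 ?_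
      filter_upwards [h] with y hy
      have hy' : condProb φ₁ ∅ y = 0 := by simpa using hy
      simp [hy']
    simp [ha, h0]
  rcases (cyl b).eq_empty_or_nonempty with hb | hb
  · have h0 : ∀ A, relForm φ₁ φ₂ A ∅ = 0 := fun A => by
      rw [relForm_eq _ _ _ MeasurableSet.empty]
      simp
    simp [hb, h0]
  rw [fst_image_prod _ hb, snd_image_prod ha]

theorem relForm_eq_setLIntegral (φ₁ : Hom Y X₁) (φ₂ : Hom Y X₂) (y : Y)
    (B : Set (Canon X₂)) :
    relForm φ₁ φ₂ (cyl (φ₁.toFun y)) B = canonMeasure X₂ (cyl (φ₂.toFun y) ∩ B) := by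
  rw [relForm, lintegral_condProb_mul φ₁ _ (measurable_condProb φ₂ B), ← φ₁.dual_preimage_cyl,
    φ₁.measurePreserving_dual.setLIntegral_comp_preimage (measurableSet_cyl y)
      (measurable_condProb φ₂ B), ← lintegral_indicator (measurableSet_cyl y)]
  have : ∀ z, (cyl y).indicator (fun z => condProb φ₂ B z) z =
      condProb φ₂ B z * (cyl y).indicator 1 z := fun z => by
    by_cases hz : z ∈ cyl y <;> simp [hz]
  simp_rw [this]
  rw [lintegral_condProb_mul φ₂ B (measurable_one.indicator (measurableSet_cyl y))]
  have h2 : ∀ x, (cyl y).indicator (1 : Canon Y → ℝ≥0∞) (φ₂.dual x) =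
    (cyl (φ₂.toFun y)).indicator 1 x := fun x => rfl
  simp_rw [h2]
  rw [lintegral_indicator_one (measurableSet_cyl _),
    Measure.restrict_apply (measurableSet_cyl _)]

theorem condProb_univ (φ : Hom Y X₁) : condProb φ univ =ᵐ[canonMeasure Y] 1 := by
  rw [condProb, Measure.restrict_univ, φ.measurePreserving_dual.map_eq]
  exact Measure.rnDeriv_self _

theorem relMeasure_fst (φ₁ : Hom Y X₁) (φ₂ : Hom Y X₂) (a : X₁) :
    relMeasure φ₁ φ₂ (cyl a ×ˢ univ) = prob a := by
  rw [← cyl_top (A := X₂), relMeasure_prod, relForm, cyl_top]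
  have : ∫⁻ y, condProb φ₁ (cyl a) y * condProb φ₂ univ y ∂canonMeasure Y =
      ∫⁻ y, condProb φ₁ (cyl a) y * 1 ∂canonMeasure Y := by
    refine lintegral_congr_ae ?_
    filter_upwards [condProb_univ φ₂] with y hy
    rw [hy]; rfl
  rw [this, lintegral_condProb_mul φ₁ _ measurable_const]
  simp [canonMeasure_cyl]

theorem relMeasure_snd (φ₁ : Hom Y X₁) (φ₂ : Hom Y X₂) (b : X₂) :
    relMeasure φ₁ φ₂ (univ ×ˢ cyl b) = prob b := by
  rw [← cyl_top (A := X₁), relMeasure_prod, relForm, cyl_top]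
  have : ∫⁻ y, condProb φ₁ univ y * condProb φ₂ (cyl b) y ∂canonMeasure Y =
      ∫⁻ y, condProb φ₂ (cyl b) y * 1 ∂canonMeasure Y := by
    refine lintegral_congr_ae ?_
    filter_upwards [condProb_univ φ₁] with y hy
    rw [hy, mul_comm]; rfl
  rw [this, lintegral_condProb_mul φ₂ _ measurable_const]
  simp [canonMeasure_cyl]

instance (φ₁ : Hom Y X₁) (φ₂ : Hom Y X₂) : IsProbabilityMeasure (relMeasure φ₁ φ₂) :=
  ⟨by rw [← univ_prod_univ, ← cyl_top (A := X₁), relMeasure_fst, prob_top]⟩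

variable [System Γ X₁] [System Γ X₂] [System Γ Y]

theorem condProb_smul (f : FactorMap Γ X₁ Y) (γ : Γ) (a : X₁) :
    condProb f.toHom (cyl (γ • a)) =ᵐ[canonMeasure Y]
      fun y => condProb f.toHom (cyl a) ((System.toHom Y γ).dual y) := by
  have hcomm : ∀ x, (System.toHom Y γ).dual (f.toHom.dual x) =
      f.toHom.dual ((System.toHom X₁ γ).dual x) := fun x => by
    ext y
    exact congrArg x.toFun (f.map_smul γ y)
  have hinv : ∀ y, (System.toHom Y γ⁻¹).dual ((System.toHom Y γ).dual y) = y := fun y => by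
    ext a
    exact congrArg y.toFun (smul_inv_smul γ a)
  refine ae_eq_of_forall_setLIntegral_eq_of_sigmaFinite (measurable_condProb _ _)
    ((measurable_condProb _ _).comp (System.toHom Y γ).measurable_dual) fun s hs _ => ?_
  have key : ∀ (B : Set (Canon X₁)) {s : Set (Canon Y)}, MeasurableSet s →
      ∫⁻ y in s, condProb f.toHom B y ∂canonMeasure Y =
      ∫⁻ x in B, s.indicator 1 (f.toHom.dual x) ∂canonMeasure X₁ := by
    intro B s hs
    rw [← lintegral_condProb_mul f.toHom B (measurable_one.indicator hs),
      ← lintegral_indicator hs]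
    refine lintegral_congr fun y => ?_
    by_cases hy : y ∈ s <;> simp [hy]
  let s' : Set (Canon Y) := (System.toHom Y γ⁻¹).dual ⁻¹' s
  have hs' : MeasurableSet s' := (System.toHom Y γ⁻¹).measurable_dual hs
  have hss : (System.toHom Y γ).dual ⁻¹' s' = s := by
    ext y
    simp only [s', mem_preimage, hinv]
  calc ∫⁻ y in s, condProb f.toHom (cyl (γ • a)) y ∂canonMeasure Y
      = ∫⁻ x in (System.toHom X₁ γ).dual ⁻¹' cyl a,
          s.indicator 1 (f.toHom.dual x) ∂canonMeasure X₁ := key _ hs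
    _ = ∫⁻ x in (System.toHom X₁ γ).dual ⁻¹' cyl a,
          s'.indicator 1 (f.toHom.dual ((System.toHom X₁ γ).dual x)) ∂canonMeasure X₁ := by
        refine lintegral_congr fun x => ?_
        rw [← hcomm]
        have : f.toHom.dual x ∈ s ↔ (System.toHom Y γ).dual (f.toHom.dual x) ∈ s' := by
          rw [← hss]; rfl
        by_cases h : f.toHom.dual x ∈ s
        · rw [indicator_of_mem h, indicator_of_mem (this.1 h)]; rfl
        · rw [indicator_of_notMem h, indicator_of_notMem (fun h' => h (this.2 h'))]
    _ = ∫⁻ x in cyl a, s'.indicator 1 (f.toHom.dual x) ∂canonMeasure X₁ :=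
        (System.toHom X₁ γ).measurePreserving_dual.setLIntegral_comp_preimage
          (measurableSet_cyl a)
          ((measurable_one.indicator hs').comp f.toHom.measurable_dual)
    _ = ∫⁻ y in s', condProb f.toHom (cyl a) y ∂canonMeasure Y := (key _ hs').symm
    _ = ∫⁻ y in (System.toHom Y γ).dual ⁻¹' s',
          condProb f.toHom (cyl a) ((System.toHom Y γ).dual y) ∂canonMeasure Y :=
        ((System.toHom Y γ).measurePreserving_dual.setLIntegral_comp_preimage hs'
          (measurable_condProb _ _)).symm
    _ = _ := by rw [hss]

variable (f₁ : FactorMap Γ X₁ Y) (f₂ : FactorMap Γ X₂ Y)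

/-- The diagonal action on the product of the canonical spaces. -/
def prodDual (X₁ : Type u) (X₂ : Type v) [ProbabilityAlgebra X₁] [ProbabilityAlgebra X₂]
    [System Γ X₁] [System Γ X₂] (γ : Γ) : Canon X₁ × Canon X₂ → Canon X₁ × Canon X₂ :=
  Prod.map (System.toHom X₁ γ).dual (System.toHom X₂ γ).dual

theorem measurePreserving_prodDual (γ : Γ) :
    MeasurePreserving (prodDual X₁ X₂ γ) (relMeasure f₁.toHom f₂.toHom)
      (relMeasure f₁.toHom f₂.toHom) := by
  have hm : Measurable (prodDual X₁ X₂ γ) :=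
    (System.toHom X₁ γ).measurable_dual.prodMap (System.toHom X₂ γ).measurable_dual
  refine ⟨hm, ?_⟩
  have : IsProbabilityMeasure ((relMeasure f₁.toHom f₂.toHom).map (prodDual X₁ X₂ γ)) :=
    Measure.isProbabilityMeasure_map hm.aemeasurable
  refine ext_of_generate_finite _ (generateFrom_rectangles (X₁ := X₁) (X₂ := X₂)) ?_ ?_ ?_
  · exact fun s hs t ht _ => isSetSemiring_rectangles.inter_mem s hs t ht
  · rintro _ ⟨_, ⟨a, rfl⟩, _, ⟨b, rfl⟩, rfl⟩
    rw [Measure.map_apply hm ((measurableSet_cyl a).prod (measurableSet_cyl b))]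
    have : prodDual X₁ X₂ γ ⁻¹' (cyl a ×ˢ cyl b) = cyl (γ • a) ×ˢ cyl (γ • b) := rfl
    rw [this, relMeasure_prod, relMeasure_prod, relForm, relForm]
    refine Eq.trans ?_ ((System.toHom Y γ).measurePreserving_dual.lintegral_comp
      ((measurable_condProb f₁.toHom (cyl a)).mul (measurable_condProb f₂.toHom (cyl b))))
    refine lintegral_congr_ae ?_
    filter_upwards [condProb_smul f₁ γ a, condProb_smul f₂ γ b] with y h1 h2
    rw [h1, h2]
  · simp

/-- The relatively independent product `X₁ ×_Y X₂`: the measure algebra of the relatively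
independent joining. -/
def RelProd : Type (max u v) := MeasureAlgebra (relMeasure f₁.toHom f₂.toHom)

namespace RelProd

noncomputable instance : ProbabilityAlgebra (RelProd f₁ f₂) :=
  inferInstanceAs (ProbabilityAlgebra (MeasureAlgebra (relMeasure f₁.toHom f₂.toHom)))

/-- The class of a measurable set. -/
noncomputable def mk (s : Set (Canon X₁ × Canon X₂)) (hs : MeasurableSet s) : RelProd f₁ f₂ :=
  MeasureAlgebra.mk _ s hs

/-- The diagonal action of the group. -/
noncomputable instance : System Γ (RelProd f₁ f₂) where
  smul γ := MeasureAlgebra.preimage (measurePreserving_prodDual f₁ f₂ γ)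
  one_smul := MeasureAlgebra.ind fun s hs => by
    refine MeasureAlgebra.mk_eq_iff.2 ?_
    have : prodDual X₁ X₂ (1 : Γ) = id := by
      funext p
      refine Prod.ext ?_ ?_
      · ext a; exact congrArg p.1.toFun (one_smul Γ a)
      · ext a; exact congrArg p.2.toFun (one_smul Γ a)
    rw [this]; exact ae_eq_refl _
  mul_smul γ δ := MeasureAlgebra.ind fun s hs => by
    refine MeasureAlgebra.mk_eq_iff.2 ?_
    have : prodDual X₁ X₂ (γ * δ) = prodDual X₁ X₂ δ ∘ prodDual X₁ X₂ γ := by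
      funext p
      refine Prod.ext ?_ ?_
      · ext a; exact congrArg p.1.toFun (mul_smul γ δ a)
      · ext a; exact congrArg p.2.toFun (mul_smul γ δ a)
    rw [this]; exact ae_eq_refl _
  smul_inf γ := MeasureAlgebra.ind fun s hs => MeasureAlgebra.ind fun t ht => rfl
  smul_compl γ := MeasureAlgebra.ind fun s hs => rfl
  prob_smul γ := MeasureAlgebra.ind fun s hs =>
    (measurePreserving_prodDual f₁ f₂ γ).measure_preimage hs.nullMeasurableSet

/-- The canonical factor map `X₁ ×_Y X₂ → X₁`. -/
noncomputable def fst : FactorMap Γ (RelProd f₁ f₂) X₁ where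
  toFun a := mk f₁ f₂ (cyl a ×ˢ univ) ((measurableSet_cyl a).prod .univ)
  map_sup' a b := MeasureAlgebra.mk_eq_iff.2 (by rw [cyl_sup, union_prod]; exact ae_eq_refl _)
  map_inf' a b := MeasureAlgebra.mk_eq_iff.2 (by rw [cyl_inf, inter_prod]; exact ae_eq_refl _)
  map_top' := MeasureAlgebra.mk_eq_iff.2 (by rw [cyl_top, univ_prod_univ]; exact ae_eq_refl _)
  map_bot' := MeasureAlgebra.mk_eq_iff.2 (by rw [cyl_bot, empty_prod]; exact ae_eq_refl _)
  prob_map a := relMeasure_fst _ _ a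
  map_smul _ _ := rfl

/-- The canonical factor map `X₁ ×_Y X₂ → X₂`. -/
noncomputable def snd : FactorMap Γ (RelProd f₁ f₂) X₂ where
  toFun b := mk f₁ f₂ (univ ×ˢ cyl b) (MeasurableSet.univ.prod (measurableSet_cyl b))
  map_sup' a b := MeasureAlgebra.mk_eq_iff.2 (by rw [cyl_sup, prod_union]; exact ae_eq_refl _)
  map_inf' a b := MeasureAlgebra.mk_eq_iff.2 (by rw [cyl_inf, prod_inter]; exact ae_eq_refl _)
  map_top' := MeasureAlgebra.mk_eq_iff.2 (by rw [cyl_top, univ_prod_univ]; exact ae_eq_refl _)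
  map_bot' := MeasureAlgebra.mk_eq_iff.2 (by rw [cyl_bot, prod_empty]; exact ae_eq_refl _)
  prob_map b := relMeasure_snd _ _ b
  map_smul _ _ := rfl

/-- The canonical factor map `X₁ ×_Y X₂ → Y`, through `X₁`. -/
noncomputable def base : FactorMap Γ (RelProd f₁ f₂) Y where
  toFun y := (fst f₁ f₂).toFun (f₁.toFun y)
  map_sup' a b := (congrArg (fst f₁ f₂).toFun (f₁.map_sup' a b)).trans ((fst f₁ f₂).map_sup' _ _)
  map_inf' a b := (congrArg (fst f₁ f₂).toFun (f₁.map_inf' a b)).trans ((fst f₁ f₂).map_inf' _ _)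
  map_top' := (congrArg (fst f₁ f₂).toFun f₁.map_top').trans (fst f₁ f₂).map_top'
  map_bot' := (congrArg (fst f₁ f₂).toFun f₁.map_bot').trans (fst f₁ f₂).map_bot'
  prob_map y := ((fst f₁ f₂).prob_map _).trans (f₁.prob_map y)
  map_smul γ y :=
    (congrArg (fst f₁ f₂).toFun (f₁.map_smul γ y)).trans ((fst f₁ f₂).map_smul γ _)

/-- The factor map to `Y` through `X₂` is the same. -/
theorem base_eq (y : Y) :
    (base f₁ f₂).toFun y = (snd f₁ f₂).toFun (f₂.toFun y) := by
  refine MeasureAlgebra.mk_eq_iff.2 ?_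
  have h1 : relMeasure f₁.toHom f₂.toHom (cyl (f₁.toFun y) ×ˢ cyl (f₂.toFun y)ᶜ) = 0 := by
    rw [relMeasure_prod, relForm_eq_setLIntegral _ _ _ _, cyl_compl]
    simp
  have h2 : relMeasure f₁.toHom f₂.toHom (cyl (f₁.toFun yᶜ) ×ˢ cyl (f₂.toFun y)) = 0 := by
    rw [relMeasure_prod, relForm_eq_setLIntegral]
    have : f₂.toFun yᶜ = (f₂.toFun y)ᶜ := map_compl' f₂.toBoundedLatticeHom y
    rw [this, cyl_compl]; simp
  have h3 : f₁.toFun yᶜ = (f₁.toFun y)ᶜ := map_compl' f₁.toBoundedLatticeHom y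
  rw [h3] at h2
  rw [cyl_compl] at h1 h2
  have h1' := measure_eq_zero_iff_ae_notMem.1 h1
  have h2' := measure_eq_zero_iff_ae_notMem.1 h2
  rw [Filter.eventuallyEq_set]
  filter_upwards [h1', h2'] with p hp hq
  simp only [mem_prod, mem_compl_iff, mem_univ, and_true, true_and, not_and] at *
  tauto

end RelProd

end RelProd

/-- An isomorphism of probability algebra dynamical systems, given as an equivariant
measure-preserving isomorphism of Boolean algebras. -/
structure SystemIso (Γ : Type w) [Group Γ] (A : Type u) (B : Type v) [ProbabilityAlgebra A]
    [ProbabilityAlgebra B] [System Γ A] [System Γ B] extends A ≃o B where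
  prob_map : ∀ a, prob (toFun a) = prob a
  map_smul : ∀ (γ : Γ) (a : A), toFun (γ • a) = γ • toFun a

end Systems

end ProbabilityAlgebra

open ProbabilityAlgebra

/-! Put `R = X₁ ×_Y X₂`. The task is to show that the almost periodic elements of `L²(R)` come from
`Z₁ ×_Y Z₂`. The converse is soft: almost periodicity lifts from a factor, bounded almost periodic
functions form an algebra, and the almost periodic elements form a closed subspace of `L²`.

For the hard direction let `D` be almost periodic on `R` and orthogonal to all products of bounded
functions on `Z₁` and `Z₂`. Split `u₁ = E(u₁|Z₁) + v₁`, where `v₁` is orthogonal to every bounded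
almost periodic function on `X₁`, and treat `u₂` likewise. If `D` is orthogonal to `v₁ ⊗ u₂` and to
`E(u₁|Z₁) ⊗ v₂`, then it is orthogonal to all products, hence `D = 0`
(`RelIndep.eq_zero_of_almostPeriodic`). This is applied to `D = 1_c - E(1_c | Z₁ ×_Y Z₂)` for `c` in
`Z`.

Orthogonality to `ω = v₁ ⊗ u₂` is a clash of compactness and mixing (`RelIndep.inner_eq_zero`). The
function `v₁` is weakly mixing relative to `Y`: along some filter on `Γ`, `E(ḡ · γv₁ | Y)` tends to
`0` in `L²` for every bounded `g`. Integrating out `X₂` only produces a bounded coefficient from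
`Y`, so `γω` becomes orthogonal to `y · η`, uniformly in `‖y‖ ≤ 1`, for each `η` in `L²(R)`. But
`⟪D, ω⟫ = ⟪γD, γω⟫`, and `γD` stays near combinations of finitely many fixed generators with bounded
coefficients from `Y`.

Weak mixing is proved by contradiction (`exists_norm_cond_le`). If it fails for a finite set of
functions `g`, then on `X ×_Y X` the orbit of the kernel `Σ g ⊗ ḡ` pairs with `u ⊗ ū` to at least
`ε²`. A fixed point in the closed convex hull of that orbit is a bounded invariant kernel with the
same lower bound. Convolving it with `u` gives an almost periodic function
(`almostPeriodic_convolution`) that is not orthogonal to `u`.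

Existence of maximal compact extensions: the elements with almost periodic indicator form an
invariant `σ`-subalgebra. By Weierstrass approximation, the sets `{Re x > 0}` of a bounded almost
periodic `x` belong to it, so `x` is measurable over it.

Filters, minimal-norm vectors and the canonical models, where measurable sets agree with elements of
the algebra up to null sets, make countability assumptions unnecessary. -/

namespace ProbabilityAlgebra

open scoped InnerProductSpace
open ProbabilityAlgebra.LInf (toL2)

/-! ### The algebra `L^∞(A)` and its action on `L²(A)` -/

section LInfAlgebra

variable {A : Type u} [ProbabilityAlgebra A]

noncomputable instance : Mul (LInf A) := ⟨fun x y => (x • y : Lp ℂ ∞ (canonMeasure A))⟩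

theorem LInf.coeFn_mul (x y : LInf A) : ⇑(x * y) =ᵐ[canonMeasure A] fun ω => x ω * y ω :=
  Lp.coeFn_lpSMul x y

theorem LInf.norm_mul_le (x y : LInf A) : ‖x * y‖ ≤ ‖x‖ * ‖y‖ := Lp.norm_smul_le x y

theorem LInf.coeFn_toL2 (x : LInf A) : ⇑(toL2 x) =ᵐ[canonMeasure A] x := MemLp.coeFn_toLp _

/-- Multiplication of an `L²` function by an `L^∞` function, as a bilinear map. -/
noncomputable def mulL2 : LInf A →L[ℂ] L2 A →L[ℂ] L2 A :=
  LinearMap.mkContinuous₂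
    (LinearMap.mk₂ ℂ (fun (x : LInf A) (ξ : L2 A) => (x • ξ : Lp ℂ 2 (canonMeasure A)))
      (fun x y ξ => Lp.smul_add x y ξ) (fun c x ξ => Lp.smul_assoc c x ξ)
      (fun x ξ η => Lp.add_smul x ξ η) (fun c x ξ => (Lp.smul_comm c x ξ).symm)) 1
    (fun x ξ => by rw [one_mul]; exact Lp.norm_smul_le x ξ)

theorem coeFn_mulL2 (x : LInf A) (ξ : L2 A) :
    ⇑(mulL2 x ξ) =ᵐ[canonMeasure A] fun ω => x ω * ξ ω := Lp.coeFn_lpSMul x ξ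

theorem norm_mulL2_le (x : LInf A) (ξ : L2 A) : ‖mulL2 x ξ‖ ≤ ‖x‖ * ‖ξ‖ := Lp.norm_smul_le x ξ

theorem mulL2_mul (x y : LInf A) (ξ : L2 A) : mulL2 (x * y) ξ = mulL2 x (mulL2 y ξ) := by
  refine Lp.ext ?_
  filter_upwards [coeFn_mulL2 (x * y) ξ, coeFn_mulL2 x (mulL2 y ξ), coeFn_mulL2 y ξ,
    LInf.coeFn_mul x y] with ω h1 h2 h3 h4
  rw [h1, h2, h3, h4, mul_assoc]

theorem LInf.mul_comm (x y : LInf A) : x * y = y * x := by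
  refine Lp.ext ?_
  filter_upwards [LInf.coeFn_mul x y, LInf.coeFn_mul y x] with ω h1 h2
  rw [h1, h2, _root_.mul_comm]

theorem mulL2_comm (x y : LInf A) (ξ : L2 A) :
    mulL2 x (mulL2 y ξ) = mulL2 y (mulL2 x ξ) := by
  rw [← mulL2_mul, LInf.mul_comm, mulL2_mul]

theorem toL2_mul (x y : LInf A) : (toL2 (x * y)) = mulL2 x (toL2 y) := by
  refine Lp.ext ?_
  filter_upwards [LInf.coeFn_mul x y, LInf.coeFn_toL2 (x * y), LInf.coeFn_toL2 y,
    coeFn_mulL2 x (toL2 y)] with ω h1 h2 h3 h4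
  rw [h2, h1, h4, h3]

theorem mulL2_toL2_comm (x y : LInf A) : mulL2 x (toL2 y) = mulL2 y (toL2 x) := by
  rw [← toL2_mul, LInf.mul_comm, toL2_mul]

theorem coeFn_star (x : LInf A) : ⇑(star x) =ᵐ[canonMeasure A] fun ω => star (x ω) :=
  Lp.coeFn_star x

theorem norm_star_LInf (x : LInf A) : ‖star x‖ = ‖x‖ := by
  rw [Lp.norm_def, Lp.norm_def]
  congr 1
  refine eLpNorm_congr_norm_ae ?_
  filter_upwards [coeFn_star x] with ω h
  rw [h, norm_star]

theorem norm_star_L2 (x : L2 A) : ‖star x‖ = ‖x‖ := by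
  rw [Lp.norm_def, Lp.norm_def]
  congr 1
  refine eLpNorm_congr_norm_ae ?_
  filter_upwards [Lp.coeFn_star x] with ω h
  rw [h, Pi.star_apply, norm_star]

theorem star_mulL2 (x : LInf A) (ξ : L2 A) : star (mulL2 x ξ) = mulL2 (star x) (star ξ) := by
  refine Lp.ext ?_
  filter_upwards [coeFn_mulL2 x ξ, coeFn_mulL2 (star x) (star ξ), coeFn_star x, Lp.coeFn_star ξ,
    Lp.coeFn_star (mulL2 x ξ)] with ω h1 h2 h3 h4 h5
  rw [h5, Pi.star_apply, h1, h2, h3, h4, Pi.star_apply, star_mul, _root_.mul_comm]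

theorem star_sub_L2 (ξ η : L2 A) : star (ξ - η) = star ξ - star η := by
  refine Lp.ext ?_
  filter_upwards [Lp.coeFn_sub ξ η, Lp.coeFn_sub (star ξ) (star η), Lp.coeFn_star ξ,
    Lp.coeFn_star η, Lp.coeFn_star (ξ - η)] with ω h1 h2 h3 h4 h5
  simp only [h5, Pi.star_apply, h1, Pi.sub_apply, h2, h3, h4, star_sub]

theorem star_sum_L2 {ι : Type*} (s : Finset ι) (ξ : ι → L2 A) :
    star (∑ i ∈ s, ξ i) = ∑ i ∈ s, star (ξ i) := by
  classical
  have h0 : star (0 : L2 A) = 0 := by simpa using star_sub_L2 (0 : L2 A) 0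
  have hneg : ∀ ξ : L2 A, star (-ξ) = -star ξ := fun ξ => by
    simpa [h0] using star_sub_L2 0 ξ
  induction s using Finset.induction_on with
  | empty => simpa using h0
  | insert a s ha ih =>
    rw [Finset.sum_insert ha, Finset.sum_insert ha, ← ih, ← sub_neg_eq_add, star_sub_L2, hneg,
      sub_neg_eq_add]

theorem star_toL2 (x : LInf A) : star (toL2 x) = (toL2 (star x)) := by
  refine Lp.ext ?_
  filter_upwards [LInf.coeFn_toL2 x, LInf.coeFn_toL2 (star x), coeFn_star x,
    Lp.coeFn_star (toL2 x)] with ω h1 h2 h3 h4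
  rw [h4, Pi.star_apply, h1, h2, h3]

theorem toL2_injective : Function.Injective (LInf.toL2 (A := A)) := by
  intro x y h
  refine Lp.ext ?_
  filter_upwards [LInf.coeFn_toL2 x, LInf.coeFn_toL2 y] with ω h1 h2
  rw [← h1, ← h2, h]

/-- The inclusion `L^∞ ⊆ L²`, as a linear map. -/
noncomputable def toL2ₗ : LInf A →ₗ[ℂ] L2 A where
  toFun := LInf.toL2
  map_add' x y := by
    refine Lp.ext ?_
    filter_upwards [LInf.coeFn_toL2 x, LInf.coeFn_toL2 y, LInf.coeFn_toL2 (x + y),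
      Lp.coeFn_add x y, Lp.coeFn_add (toL2 x) (toL2 y)] with ω h1 h2 h3 h4 h5
    simp only [h3, h4, h5, Pi.add_apply, h1, h2]
  map_smul' c x := by
    refine Lp.ext ?_
    filter_upwards [LInf.coeFn_toL2 x, LInf.coeFn_toL2 (c • x),
      Lp.coeFn_smul c x, Lp.coeFn_smul c (toL2 x)] with ω h1 h3 h4 h5
    simp only [RingHom.id_apply, h3, h4, h5, Pi.smul_apply, h1]

theorem toL2_add (x y : LInf A) : (toL2 (x + y)) = (toL2 x) + (toL2 y) := map_add toL2ₗ x y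
theorem toL2_sub (x y : LInf A) : (toL2 (x - y)) = (toL2 x) - (toL2 y) := map_sub toL2ₗ x y
theorem toL2_smul (c : ℂ) (x : LInf A) : (toL2 (c • x)) = c • (toL2 x) := map_smul toL2ₗ c x
theorem toL2_sum {ι : Type*} (s : Finset ι) (x : ι → LInf A) :
    (toL2 (∑ i ∈ s, x i)) = ∑ i ∈ s, (toL2 (x i)) := map_sum toL2ₗ x s
theorem toL2_zero : (toL2 (0 : LInf A)) = 0 := map_zero toL2ₗ

theorem inner_mulL2_left (x : LInf A) (ξ η : L2 A) :
    ⟪mulL2 x ξ, η⟫_ℂ = ⟪ξ, mulL2 (star x) η⟫_ℂ := by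
  rw [L2.inner_def, L2.inner_def]
  refine integral_congr_ae ?_
  filter_upwards [coeFn_mulL2 x ξ, coeFn_mulL2 (star x) η, coeFn_star x] with ω h1 h2 h3
  rw [h1, h2, h3]
  simp only [RCLike.inner_apply, map_mul, RCLike.star_def]
  ring

theorem inner_mulL2_right (x : LInf A) (ξ η : L2 A) :
    ⟪ξ, mulL2 x η⟫_ℂ = ⟪mulL2 (star x) ξ, η⟫_ℂ := by
  rw [inner_mulL2_left, star_star]

theorem norm_toL2_le (x : LInf A) : ‖toL2 x‖ ≤ ‖x‖ := by
  rw [Lp.norm_def, Lp.norm_def]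
  refine ENNReal.toReal_mono (Lp.eLpNorm_ne_top x) ?_
  rw [eLpNorm_congr_ae (LInf.coeFn_toL2 x)]
  exact eLpNorm_le_eLpNorm_of_exponent_le le_top (Lp.aestronglyMeasurable x)

theorem LInf.ae_norm_le (x : LInf A) : ∀ᵐ ω ∂canonMeasure A, ‖x ω‖ ≤ ‖x‖ := by
  have h := ae_le_eLpNormEssSup (f := x) (μ := canonMeasure A)
  filter_upwards [h] with ω hω
  rw [Lp.norm_def, eLpNorm_exponent_top, ← toReal_enorm]
  refine ENNReal.toReal_mono ?_ hω
  rw [← eLpNorm_exponent_top]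
  exact Lp.eLpNorm_ne_top x

theorem LInf.norm_le {x : LInf A} {C : ℝ} (hC : 0 ≤ C)
    (h : ∀ᵐ ω ∂canonMeasure A, ‖x ω‖ ≤ C) : ‖x‖ ≤ C := by
  have := Lp.norm_le_of_ae_bound (f := x) hC h
  simpa using this

/-- The class of a bounded measurable function. -/
noncomputable def ofFun (g : Canon A → ℂ) (hg : AEStronglyMeasurable g (canonMeasure A)) (C : ℝ)
    (h : ∀ᵐ ω ∂canonMeasure A, ‖g ω‖ ≤ C) : LInf A := (memLp_top_of_bound hg C h).toLp g

theorem coeFn_ofFun {g : Canon A → ℂ} (hg : AEStronglyMeasurable g (canonMeasure A)) {C : ℝ}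
    (h : ∀ᵐ ω ∂canonMeasure A, ‖g ω‖ ≤ C) : ⇑(ofFun g hg C h) =ᵐ[canonMeasure A] g :=
  MemLp.coeFn_toLp _

/-- The indicator function of a measurable set. -/
noncomputable def indSet (s : Set (Canon A)) (hs : MeasurableSet s) : LInf A :=
  indicatorConstLp ∞ hs (measure_ne_top _ _) 1

theorem coeFn_indSet (s : Set (Canon A)) (hs : MeasurableSet s) :
    ⇑(indSet s hs) =ᵐ[canonMeasure A] s.indicator fun _ => 1 := indicatorConstLp_coeFn

theorem toL2_indSet {s : Set (Canon A)} (hs : MeasurableSet s) :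
    (toL2 (indSet s hs)) = indicatorConstLp 2 hs (measure_ne_top _ _) 1 := by
  refine Lp.ext ?_
  filter_upwards [LInf.coeFn_toL2 (indSet s hs), coeFn_indSet s hs,
    indicatorConstLp_coeFn (p := 2) (hs := hs) (hμs := measure_ne_top (canonMeasure A) s)
      (c := (1 : ℂ))] with ω h1 h2 h3
  rw [h1, h2, h3]

theorem indSet_congr {s t : Set (Canon A)} (hs : MeasurableSet s) (ht : MeasurableSet t)
    (h : s =ᵐ[canonMeasure A] t) : indSet s hs = indSet t ht := by
  refine Lp.ext ?_
  filter_upwards [coeFn_indSet s hs, coeFn_indSet t ht, indicator_ae_eq_of_ae_eq_set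
    (f := fun _ => (1 : ℂ)) h] with ω h1 h2 h3
  rw [h1, h2, h3]

theorem ae_eq_of_indSet_eq {s t : Set (Canon A)} (hs : MeasurableSet s) (ht : MeasurableSet t)
    (h : indSet s hs = indSet t ht) : s =ᵐ[canonMeasure A] t := by
  have h1 := coeFn_indSet s hs
  rw [h] at h1
  refine eventuallyEq_set.2 ?_
  filter_upwards [h1, coeFn_indSet t ht] with ω h1 h2
  rw [h2] at h1
  by_cases hs : ω ∈ s <;> by_cases ht : ω ∈ t <;> simp_all

/-- The indicator function of an element of the algebra. -/
noncomputable def ind (a : A) : LInf A := indSet (cyl a) (measurableSet_cyl a)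

theorem coeFn_ind (a : A) :
    ⇑(ind a) =ᵐ[canonMeasure A] (cyl a).indicator fun _ => 1 := coeFn_indSet _ _

theorem cyl_ae_inj {a b : A} (h : cyl a =ᵐ[canonMeasure A] cyl b) : a = b := by
  have key : ∀ a b : A, cyl a =ᵐ[canonMeasure A] cyl b → a ≤ b := fun a b h => by
    have h0 : canonMeasure A (cyl (a \ b)) = 0 := by
      rw [cyl_sdiff]
      exact ae_le_set.1 h.le
    rw [canonMeasure_cyl, prob_eq_zero_iff] at h0
    exact sdiff_eq_bot_iff.1 h0
  exact le_antisymm (key a b h) (key b a h.symm)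

theorem ind_injective : Function.Injective (ind (A := A)) := fun _ _ h =>
  cyl_ae_inj (ae_eq_of_indSet_eq _ _ h)

theorem ind_inf (a b : A) : ind (a ⊓ b) = ind a * ind b := by
  refine Lp.ext ?_
  filter_upwards [coeFn_ind a, coeFn_ind b, coeFn_ind (a ⊓ b), LInf.coeFn_mul (ind a) (ind b)]
    with ω h1 h2 h3 h4
  rw [h3, h4, h1, h2, cyl_inf]
  by_cases ha : ω ∈ cyl a <;> by_cases hb : ω ∈ cyl b <;> simp [ha, hb]

theorem ind_compl (a : A) : ind aᶜ = ind ⊤ - ind a := by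
  refine Lp.ext ?_
  filter_upwards [coeFn_ind a, coeFn_ind ⊤, coeFn_ind aᶜ, Lp.coeFn_sub (ind ⊤) (ind a)]
    with ω h1 h2 h3 h4
  rw [h3, h4, Pi.sub_apply, h1, h2, cyl_compl, cyl_top]
  by_cases ha : ω ∈ cyl a <;> simp [ha]

theorem mulL2_ind_top (ξ : L2 A) : mulL2 (ind ⊤) ξ = ξ := by
  refine Lp.ext ?_
  filter_upwards [coeFn_mulL2 (ind ⊤) ξ, coeFn_ind (⊤ : A)] with ω h1 h2
  rw [h1, h2, cyl_top, indicator_univ, one_mul]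

theorem mulL2_toL2_ind_top (x : LInf A) : mulL2 x (toL2 (ind ⊤)) = toL2 x := by
  rw [mulL2_toL2_comm, mulL2_ind_top]

/-- An `L²` function that is dominated as a multiplication operator is bounded. -/
theorem exists_toL2_eq_of_forall {ξ : L2 A} {C : ℝ} (hC : 0 ≤ C)
    (h : ∀ x : LInf A, ‖mulL2 x ξ‖ ≤ C * ‖toL2 x‖) : ∃ u : LInf A, toL2 u = ξ ∧ ‖u‖ ≤ C := by
  have hb : ∀ᵐ ω ∂canonMeasure A, ‖ξ ω‖ ≤ C := by
    have hn : ∀ n : ℕ, ∀ᵐ ω ∂canonMeasure A, ‖ξ ω‖ ≤ C + 1 / ((n : ℝ) + 1) := by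
      intro n
      -- Testing the hypothesis on the indicator of `{‖ξ‖ > D}` gives `D‖1_s‖ ≤ ‖ξ 1_s‖ ≤ C‖1_s‖`.
      -- Since `D > C`, the set is null.
      set D := C + 1 / ((n : ℝ) + 1) with hD
      have hCD : C < D := by rw [hD]; have : 0 < 1 / ((n : ℝ) + 1) := by positivity
                             linarith
      have hm : StronglyMeasurable ξ := Lp.stronglyMeasurable ξ
      let s : Set (Canon A) := {ω | D < ‖ξ ω‖}
      have hs : MeasurableSet s := measurableSet_lt measurable_const hm.norm.measurable
      have h1 := h (indSet s hs)
      have h2 : ‖(D : ℂ) • (toL2 (indSet s hs))‖ ≤ ‖mulL2 (indSet s hs) ξ‖ := by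
        refine Lp.norm_le_norm_of_ae_le ?_
        filter_upwards [Lp.coeFn_smul (D : ℂ) (toL2 (indSet s hs)), LInf.coeFn_toL2 (indSet s hs),
          coeFn_indSet s hs, coeFn_mulL2 (indSet s hs) ξ] with ω k1 k2 k3 k4
        rw [k1, k4, Pi.smul_apply, k2, k3]
        by_cases hω : ω ∈ s
        · have : D < ‖ξ ω‖ := hω
          simp only [hω, indicator_of_mem, smul_eq_mul, mul_one, one_mul, Complex.norm_real,
            Real.norm_eq_abs, abs_of_nonneg (hC.trans hCD.le)]
          exact this.le
        · simp [hω]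
      rw [norm_smul, Complex.norm_real, Real.norm_eq_abs, abs_of_nonneg (hC.trans hCD.le)] at h2
      have h3 : ‖(toL2 (indSet s hs))‖ = 0 := by
        by_contra hne
        have : 0 < ‖(toL2 (indSet s hs))‖ := lt_of_le_of_ne (norm_nonneg _) (Ne.symm hne)
        nlinarith
      have h4 : indSet s hs = 0 := toL2_injective (by rw [norm_eq_zero.1 h3, toL2_zero])
      have h5 := coeFn_indSet s hs
      rw [h4] at h5
      filter_upwards [h5, Lp.coeFn_zero ℂ ∞ (canonMeasure A)] with ω k1 k2
      rw [k2] at k1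
      by_contra hω
      have : ω ∈ s := not_le.1 hω
      simp [this] at k1
    filter_upwards [ae_all_iff.2 hn] with ω hω
    refine le_of_forall_pos_le_add fun ε hε => ?_
    obtain ⟨n, hn⟩ := exists_nat_one_div_lt hε
    exact (hω n).trans (by linarith)
  refine ⟨ofFun ξ (Lp.aestronglyMeasurable ξ) C hb, Lp.ext ?_, LInf.norm_le hC ?_⟩
  · exact (LInf.coeFn_toL2 _).trans (coeFn_ofFun _ _)
  · filter_upwards [hb, coeFn_ofFun (Lp.aestronglyMeasurable ξ) hb] with ω h1 h2
    rwa [h2]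

/-- The union of cylinders can be a proper subset of `cyl c`. Countable additivity of `prob` along
the disjointed sequence shows that the difference has measure zero. -/
theorem iUnion_cyl_ae_eq {a : ℕ → A} {c : A} (hc : IsLUB (range a) c) :
    (⋃ n, cyl (a n)) =ᵐ[canonMeasure A] cyl c := by
  let b : ℕ → A := disjointed a
  have hbc : IsLUB (range b) c := by
    refine ⟨?_, fun d hd => ?_⟩
    · rintro _ ⟨n, rfl⟩
      exact (disjointed_le a n).trans (hc.1 ⟨n, rfl⟩)
    · refine hc.2 ?_
      rintro _ ⟨n, rfl⟩
      have : partialSups a n ≤ d := by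
        rw [← partialSups_disjointed]
        exact partialSups_le _ _ _ fun k _ => hd ⟨k, rfl⟩
      exact (le_partialSups a n).trans this
  have hsub : (⋃ n, cyl (a n)) ⊆ cyl c := by
    refine iUnion_subset fun n => ?_
    have : a n ⊓ c = a n := inf_eq_left.2 (hc.1 ⟨n, rfl⟩)
    rw [← this, cyl_inf]
    exact inter_subset_right
  refine ae_eq_of_subset_of_measure_ge hsub ?_
    (MeasurableSet.iUnion fun n => measurableSet_cyl _).nullMeasurableSet (measure_ne_top _ _)
  rw [canonMeasure_cyl, prob_eq_tsum b c (disjoint_disjointed a) hbc]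
  have hdis : Pairwise (Function.onFun Disjoint fun n => cyl (b n)) := fun m n hmn => by
    rw [Function.onFun, Set.disjoint_iff_inter_eq_empty, ← cyl_inf,
      disjoint_iff.1 (disjoint_disjointed a hmn), cyl_bot]
  simp_rw [← canonMeasure_cyl]
  rw [← measure_iUnion hdis fun n => measurableSet_cyl _]
  refine measure_mono (iUnion_mono fun n => ?_)
  have : b n ⊓ a n = b n := inf_eq_left.2 (disjointed_le a n)
  rw [← this, cyl_inf]
  exact inter_subset_right

/-- Every measurable set is given by an element of the algebra, up to a null set. -/
theorem exists_cyl_ae_eq {s : Set (Canon A)} (hs : MeasurableSet s) :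
    ∃ a : A, s =ᵐ[canonMeasure A] cyl a := by
  induction s, hs using MeasurableSpace.generateFrom_induction with
  | hC t ht _ => obtain ⟨a, rfl⟩ := ht; exact ⟨a, ae_eq_refl _⟩
  | empty => exact ⟨⊥, by rw [cyl_bot]; exact ae_eq_refl _⟩
  | compl t ht ih =>
    obtain ⟨a, ha⟩ := ih
    exact ⟨aᶜ, by rw [cyl_compl]; exact ha.compl⟩
  | iUnion t ht ih =>
    choose a ha using ih
    obtain ⟨c, hc⟩ := exists_isLUB_range a
    exact ⟨c, (Filter.EventuallyEq.countable_iUnion ha).trans (iUnion_cyl_ae_eq hc)⟩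

theorem exists_indSet_eq {s : Set (Canon A)} (hs : MeasurableSet s) :
    ∃ a : A, indSet s hs = ind a := by
  obtain ⟨a, ha⟩ := exists_cyl_ae_eq hs
  exact ⟨a, indSet_congr _ _ ha⟩

/-- The indicator functions of elements span a dense subspace of `L²`. -/
theorem eq_top_of_ind_mem {V : Submodule ℂ (L2 A)} (hV : IsClosed (V : Set (L2 A)))
    (h : ∀ a : A, (toL2 (ind a)) ∈ V) (ξ : L2 A) : ξ ∈ V := by
  refine Lp.induction (by norm_num) (motive := fun ξ => ξ ∈ V) ?_ ?_ hV ξ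
  · intro c s hs hμ
    obtain ⟨a, ha⟩ := exists_indSet_eq hs
    have h1 : (Lp.simpleFunc.indicatorConst 2 hs hμ.ne c : L2 A) = c • (toL2 (ind a)) := by
      rw [← ha, toL2_indSet, Lp.simpleFunc.coe_indicatorConst]
      refine Lp.ext ?_
      filter_upwards [Lp.coeFn_smul c (indicatorConstLp 2 hs (measure_ne_top (canonMeasure A) s)
        (1 : ℂ)), indicatorConstLp_coeFn (p := 2) (hs := hs)
          (hμs := measure_ne_top (canonMeasure A) s) (c := (1 : ℂ)),
        indicatorConstLp_coeFn (p := 2) (hs := hs)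
          (hμs := measure_ne_top (canonMeasure A) s) (c := c)] with ω h1 h2 h3
      rw [h1, Pi.smul_apply, h2, h3]
      by_cases hω : ω ∈ s <;> simp [hω]
    exact h1 ▸ V.smul_mem c (h a)
  · intro f g hf hg _ h1 h2
    exact V.add_mem h1 h2

theorem denseRange_toL2 : DenseRange (LInf.toL2 (A := A)) := by
  intro ξ
  have := eq_top_of_ind_mem (V := (LinearMap.range (toL2ₗ (A := A))).topologicalClosure)
    (Submodule.isClosed_topologicalClosure _)
    (fun a => Submodule.le_topologicalClosure _ ⟨ind a, rfl⟩) ξ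
  exact this

theorem exists_toL2_near (ξ : L2 A) {ε : ℝ} (hε : 0 < ε) : ∃ x : LInf A, ‖ξ - (toL2 x)‖ < ε := by
  obtain ⟨x, hx⟩ := Metric.denseRange_iff.1 (denseRange_toL2 (A := A)) ξ ε hε
  exact ⟨x, by rwa [← dist_eq_norm]⟩

/-- Bounded almost everywhere convergence implies `L²` convergence. -/
theorem toL2_mem_of_ae_tendsto {V : Set (L2 A)} (hV : IsClosed V) {u : ℕ → LInf A}
    {x : LInf A} {C : ℝ} (hu : ∀ n, toL2 (u n) ∈ V) (hC : ∀ n, ‖u n‖ ≤ C)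
    (h : ∀ᵐ ω ∂canonMeasure A, Tendsto (fun n => u n ω) atTop (nhds (x ω))) : toL2 x ∈ V := by
  refine hV.mem_of_tendsto (f := fun n => toL2 (u n)) (b := atTop) ?_ (Eventually.of_forall hu)
  rw [tendsto_iff_norm_sub_tendsto_zero]
  have hd : ∀ n, ⇑(toL2 (u n) - toL2 x) =ᵐ[canonMeasure A] fun ω => u n ω - x ω := fun n => by
    filter_upwards [Lp.coeFn_sub (toL2 (u n)) (toL2 x), LInf.coeFn_toL2 (u n),
      LInf.coeFn_toL2 x] with ω h1 h2 h3
    rw [h1, Pi.sub_apply, h2, h3]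
  -- Dominated convergence for the squared distance. The integrand is complex so that it can be
  -- matched with `L2.inner_def`.
  have hint : Tendsto (fun n => ∫ ω, ((‖u n ω - x ω‖ ^ 2 : ℝ) : ℂ) ∂canonMeasure A) atTop
      (nhds (∫ _, (0 : ℂ) ∂canonMeasure A)) := by
    refine tendsto_integral_of_dominated_convergence (fun _ => (C + ‖x‖) ^ 2) (fun n => ?_)
      (integrable_const _) (fun n => ?_) ?_
    · exact (Complex.continuous_ofReal.measurable.comp
        (((Lp.stronglyMeasurable (u n)).sub (Lp.stronglyMeasurable x)).norm.pow
          2).measurable).aestronglyMeasurable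
    · filter_upwards [LInf.ae_norm_le (u n), LInf.ae_norm_le x] with ω h1 h2
      rw [Complex.norm_real, Real.norm_of_nonneg (by positivity)]
      refine pow_le_pow_left₀ (norm_nonneg _) ((norm_sub_le _ _).trans ?_) 2
      exact add_le_add (h1.trans (hC n)) h2
    · filter_upwards [h] with ω hω
      have h1 : Tendsto (fun n => ((‖u n ω - x ω‖ ^ 2 : ℝ) : ℂ)) atTop
          (nhds ((‖x ω - x ω‖ ^ 2 : ℝ) : ℂ)) :=
        (Complex.continuous_ofReal.tendsto _).comp (((hω.sub_const _).norm).pow 2)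
      simpa using h1
  have hsq : ∀ n, ∫ ω, ((‖u n ω - x ω‖ ^ 2 : ℝ) : ℂ) ∂canonMeasure A =
      ((‖toL2 (u n) - toL2 x‖ ^ 2 : ℝ) : ℂ) := fun n => by
    have := inner_self_eq_norm_sq_to_K (𝕜 := ℂ) (toL2 (u n) - toL2 x)
    rw [L2.inner_def] at this
    push_cast
    refine Eq.trans (integral_congr_ae ?_) this
    filter_upwards [hd n] with ω hω
    rw [hω, inner_self_eq_norm_sq_to_K]
    simp
  simp_rw [hsq] at hint
  rw [integral_zero] at hint
  have h2 : Tendsto (fun n => ‖toL2 (u n) - toL2 x‖ ^ 2) atTop (nhds 0) := by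
    have := (Complex.continuous_re.tendsto _).comp hint
    simpa [Function.comp_def, ← Complex.ofReal_pow] using this
  have h3 := (Real.continuous_sqrt.tendsto 0).comp h2
  simpa [Function.comp_def, Real.sqrt_sq (norm_nonneg _)] using h3

/-- A function whose integral over its set of positivity vanishes is nowhere positive. -/
theorem ae_re_nonpos_of_inner_eq_zero {x : LInf A} (hs : MeasurableSet {ω | 0 < (x ω).re})
    (h : ⟪toL2 (indSet _ hs), toL2 x⟫_ℂ = 0) : ∀ᵐ ω ∂canonMeasure A, (x ω).re ≤ 0 := by
  rw [toL2_indSet, L2.inner_indicatorConstLp_one] at h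
  have hx : Integrable x (canonMeasure A) :=
    ((Lp.memLp x).mono_exponent le_top : MemLp x 1 (canonMeasure A)).integrable le_rfl
  rw [setIntegral_congr_ae (g := x) hs
    ((LInf.coeFn_toL2 x).mono fun ω hω _ => hω)] at h
  have h1 : ∫ ω in {ω | 0 < (x ω).re}, (x ω).re ∂canonMeasure A = 0 := by
    have := integral_re (𝕜 := ℂ) hx.integrableOn (μ := (canonMeasure A).restrict {ω | 0 < (x ω).re})
    simp only [RCLike.re_to_complex] at this
    rw [this, h, Complex.zero_re]
  have h2 := (setIntegral_eq_zero_iff_of_nonneg_ae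
    ((ae_restrict_mem hs).mono fun ω hω => (le_of_lt hω : (0 : ℝ) ≤ (x ω).re))
    hx.re.integrableOn).1 h1
  rw [Filter.EventuallyEq, ae_restrict_iff' hs] at h2
  filter_upwards [h2] with ω hω
  by_contra hpos
  have := hω (not_le.1 hpos)
  simp only [Pi.zero_apply] at this
  exact hpos this.le

theorem norm_ind_le (a : A) : ‖ind a‖ ≤ 1 := by
  refine LInf.norm_le zero_le_one ?_
  filter_upwards [coeFn_ind a] with ω h
  rw [h]
  by_cases ha : ω ∈ cyl a <;> simp [ha]

/-- At almost every point the indicators of the partial suprema are eventually constant with value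
the indicator of `b`. This passes from finite to countable suprema inside a closed set. -/
theorem toL2_ind_mem_of_isLUB {V : Set (L2 A)} (hV : IsClosed V) {s : ℕ → A} {b : A}
    (hs : ∀ n, toL2 (ind (partialSups s n)) ∈ V) (hb : IsLUB (range s) b) :
    toL2 (ind b) ∈ V := by
  refine toL2_mem_of_ae_tendsto hV hs (fun n => norm_ind_le _) ?_
  filter_upwards [coeFn_ind b, ae_all_iff.2 fun n => coeFn_ind (partialSups s n),
    eventuallyEq_set.1 (iUnion_cyl_ae_eq hb)] with ω h1 h2 h3
  simp_rw [h1, h2]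
  refine tendsto_const_nhds.congr' ?_
  have hle : ∀ {a c : A}, a ≤ c → ω ∈ cyl a → ω ∈ cyl c := fun {a c} hac ha => by
    rw [← inf_eq_left.2 hac, cyl_inf] at ha
    exact ha.2
  by_cases hω : ω ∈ cyl b
  · obtain ⟨n, hn⟩ := mem_iUnion.1 (h3.2 hω)
    filter_upwards [eventually_ge_atTop n] with k hk
    have := hle (le_partialSups_of_le s hk) hn
    simp [hω, this]
  · refine Eventually.of_forall fun n => ?_
    have : ω ∉ cyl (partialSups s n) := fun h =>
      hω (hle (partialSups_le _ _ _ fun k _ => hb.1 ⟨k, rfl⟩) h)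
    simp [hω, this]

theorem ind_sup_of_disjoint {a b : A} (h : Disjoint a b) : ind (a ⊔ b) = ind a + ind b := by
  refine Lp.ext ?_
  filter_upwards [coeFn_ind a, coeFn_ind b, coeFn_ind (a ⊔ b), Lp.coeFn_add (ind a) (ind b)]
    with ω h1 h2 h3 h4
  rw [h3, h4, Pi.add_apply, h1, h2, cyl_sup]
  have h5 : ¬ (ω ∈ cyl a ∧ ω ∈ cyl b) := by
    rw [← mem_inter_iff, ← cyl_inf, disjoint_iff.1 h, cyl_bot]
    exact notMem_empty ω
  by_cases ha : ω ∈ cyl a <;> by_cases hb : ω ∈ cyl b <;> simp_all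

theorem inner_ind_ind (a b : A) :
    ⟪toL2 (ind a), toL2 (ind b)⟫_ℂ = ((prob (a ⊓ b)).toReal : ℂ) := by
  rw [ind, ind, toL2_indSet, toL2_indSet, L2.inner_indicatorConstLp_one_indicatorConstLp_one,
    ← cyl_inf, measureReal_def, canonMeasure_cyl]
  rfl

/-- Indicators are total in `L²`, so `ξ - η` is orthogonal to itself. -/
theorem ext_inner_ind {ξ η : L2 A}
    (h : ∀ a : A, ⟪toL2 (ind a), ξ⟫_ℂ = ⟪toL2 (ind a), η⟫_ℂ) : ξ = η := by
  have h1 : ξ - η ∈ (ℂ ∙ (ξ - η))ᗮ := by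
    refine eq_top_of_ind_mem (Submodule.isClosed_orthogonal _) (fun a => ?_) _
    rw [Submodule.mem_orthogonal_singleton_iff_inner_left, inner_sub_right, h a, sub_self]
  rw [Submodule.mem_orthogonal_singleton_iff_inner_left] at h1
  exact sub_eq_zero.1 (inner_self_eq_zero.1 h1)

end LInfAlgebra

/-! ### Maps of function spaces induced by homomorphisms -/

section HomMaps

variable {A : Type u} {B : Type v} {C : Type w} [ProbabilityAlgebra A] [ProbabilityAlgebra B]
  [ProbabilityAlgebra C]

/-- `Hom.mapL2` as a linear isometry. -/
noncomputable def Hom.isom (φ : Hom A B) : L2 A →ₗᵢ[ℂ] L2 B :=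
  Lp.compMeasurePreservingₗᵢ ℂ φ.dual φ.measurePreserving_dual

/-- `Hom.mapLInf` as a linear isometry. -/
noncomputable def Hom.isomInf (φ : Hom A B) : LInf A →ₗᵢ[ℂ] LInf B :=
  Lp.compMeasurePreservingₗᵢ ℂ φ.dual φ.measurePreserving_dual

theorem Hom.mapLInf_eq (φ : Hom A B) (x : LInf A) : φ.mapLInf x = φ.isomInf x := rfl

theorem Hom.act_eq (φ : Hom A B) (ξ : L2 B) (x : LInf A) :
    φ.act ξ x = mulL2 (φ.isomInf x) ξ := rfl

theorem Hom.coeFn_isom (φ : Hom A B) (ξ : L2 A) :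
    ⇑(φ.isom ξ) =ᵐ[canonMeasure B] fun ω => ξ (φ.dual ω) :=
  Lp.coeFn_compMeasurePreserving ξ φ.measurePreserving_dual

theorem Hom.coeFn_isomInf (φ : Hom A B) (x : LInf A) :
    ⇑(φ.isomInf x) =ᵐ[canonMeasure B] fun ω => x (φ.dual ω) :=
  Lp.coeFn_compMeasurePreserving x φ.measurePreserving_dual

theorem Hom.ae_dual (φ : Hom A B) {p : Canon A → Prop} (h : ∀ᵐ ω ∂canonMeasure A, p ω) :
    ∀ᵐ ω ∂canonMeasure B, p (φ.dual ω) :=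
  φ.measurePreserving_dual.quasiMeasurePreserving.ae h

theorem Hom.isom_mulL2 (φ : Hom A B) (x : LInf A) (ξ : L2 A) :
    φ.isom (mulL2 x ξ) = mulL2 (φ.isomInf x) (φ.isom ξ) := by
  refine Lp.ext ?_
  filter_upwards [φ.coeFn_isom (mulL2 x ξ), φ.ae_dual (coeFn_mulL2 x ξ), φ.coeFn_isom ξ,
    φ.coeFn_isomInf x, coeFn_mulL2 (φ.isomInf x) (φ.isom ξ)] with ω h1 h2 h3 h4 h5
  rw [h1, h2, h5, h3, h4]

theorem Hom.isom_toL2 (φ : Hom A B) (x : LInf A) : φ.isom (toL2 x) = toL2 (φ.isomInf x) := by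
  refine Lp.ext ?_
  filter_upwards [φ.coeFn_isom (toL2 x), φ.ae_dual (LInf.coeFn_toL2 x),
    φ.coeFn_isomInf x, LInf.coeFn_toL2 (φ.isomInf x)] with ω h1 h2 h3 h4
  rw [h1, h2, h4, h3]

theorem Hom.isomInf_mul (φ : Hom A B) (x y : LInf A) :
    φ.isomInf (x * y) = φ.isomInf x * φ.isomInf y :=
  toL2_injective (by
    rw [toL2_mul, ← φ.isom_toL2, toL2_mul, φ.isom_mulL2, φ.isom_toL2])

theorem Hom.isomInf_star (φ : Hom A B) (x : LInf A) :
    φ.isomInf (star x) = star (φ.isomInf x) := by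
  refine Lp.ext ?_
  filter_upwards [φ.coeFn_isomInf (star x), φ.ae_dual (coeFn_star x), φ.coeFn_isomInf x,
    coeFn_star (φ.isomInf x)] with ω h1 h2 h3 h4
  rw [h1, h2, h4, h3]

theorem Hom.isom_star (φ : Hom A B) (ξ : L2 A) : φ.isom (star ξ) = star (φ.isom ξ) := by
  refine Lp.ext ?_
  filter_upwards [φ.coeFn_isom (star ξ), φ.ae_dual (Lp.coeFn_star ξ), φ.coeFn_isom ξ,
    Lp.coeFn_star (φ.isom ξ)] with ω h1 h2 h3 h4
  rw [h1, h2, h4, Pi.star_apply, Pi.star_apply, h3]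

theorem Hom.isomInf_indSet (φ : Hom A B) {s : Set (Canon A)} (hs : MeasurableSet s) :
    φ.isomInf (indSet s hs) = indSet (φ.dual ⁻¹' s) (φ.measurable_dual hs) := by
  refine Lp.ext ?_
  filter_upwards [φ.coeFn_isomInf (indSet s hs), φ.ae_dual (coeFn_indSet s hs),
    coeFn_indSet _ (φ.measurable_dual hs)] with ω h1 h2 h3
  rw [h1, h2, h3]
  rfl

theorem Hom.isomInf_ind (φ : Hom A B) (a : A) : φ.isomInf (ind a) = ind (φ.toFun a) :=
  φ.isomInf_indSet _

theorem Hom.isom_ind (φ : Hom A B) (a : A) : φ.isom (toL2 (ind a)) = toL2 (ind (φ.toFun a)) := by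
  rw [φ.isom_toL2, φ.isomInf_ind]

theorem Hom.isom_comp {φ : Hom A B} {ψ : Hom B C} {χ : Hom A C}
    (h : ∀ a, χ.toFun a = ψ.toFun (φ.toFun a)) (ξ : L2 A) : ψ.isom (φ.isom ξ) = χ.isom ξ := by
  have hd : ∀ ω, χ.dual ω = φ.dual (ψ.dual ω) := fun ω => by
    ext a; exact congrArg ω.toFun (h a)
  refine Lp.ext ?_
  filter_upwards [ψ.coeFn_isom (φ.isom ξ), ψ.ae_dual (φ.coeFn_isom ξ), χ.coeFn_isom ξ]
    with ω h1 h2 h3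
  rw [h1, h2, h3, hd]

theorem Hom.isomInf_comp {φ : Hom A B} {ψ : Hom B C} {χ : Hom A C}
    (h : ∀ a, χ.toFun a = ψ.toFun (φ.toFun a)) (x : LInf A) :
    ψ.isomInf (φ.isomInf x) = χ.isomInf x :=
  toL2_injective (by rw [← ψ.isom_toL2, ← φ.isom_toL2, ← χ.isom_toL2, Hom.isom_comp h])

/-- The conditional expectation `L²(B) → L²(A)` along a homomorphism `A → B`. -/
noncomputable def Hom.cond (φ : Hom A B) : L2 B →L[ℂ] L2 A :=
  ContinuousLinearMap.adjoint φ.isom.toContinuousLinearMap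

theorem Hom.inner_cond_right (φ : Hom A B) (ξ : L2 A) (η : L2 B) :
    ⟪ξ, φ.cond η⟫_ℂ = ⟪φ.isom ξ, η⟫_ℂ :=
  ContinuousLinearMap.adjoint_inner_right _ _ _

theorem Hom.inner_cond_left (φ : Hom A B) (ξ : L2 A) (η : L2 B) :
    ⟪φ.cond η, ξ⟫_ℂ = ⟪η, φ.isom ξ⟫_ℂ :=
  ContinuousLinearMap.adjoint_inner_left _ _ _

theorem Hom.cond_isom (φ : Hom A B) (ξ : L2 A) : φ.cond (φ.isom ξ) = ξ :=
  ext_inner_left ℂ fun η => by rw [φ.inner_cond_right, φ.isom.inner_map_map]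

theorem Hom.norm_cond_le (φ : Hom A B) (ξ : L2 B) : ‖φ.cond ξ‖ ≤ ‖ξ‖ := by
  have h := φ.inner_cond_right (φ.cond ξ) ξ
  have h2 : ‖φ.cond ξ‖ * ‖φ.cond ξ‖ ≤ ‖φ.cond ξ‖ * ‖ξ‖ := by
    calc ‖φ.cond ξ‖ * ‖φ.cond ξ‖ = ‖⟪φ.cond ξ, φ.cond ξ⟫_ℂ‖ := by
          rw [inner_self_eq_norm_sq_to_K (𝕜 := ℂ)]; simp [sq]
      _ ≤ ‖φ.isom (φ.cond ξ)‖ * ‖ξ‖ := by rw [h]; exact norm_inner_le_norm _ _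
      _ = _ := by rw [φ.isom.norm_map]
  rcases (norm_nonneg (φ.cond ξ)).eq_or_lt with h0 | h0
  · rw [← h0]; exact norm_nonneg _
  · exact le_of_mul_le_mul_left h2 h0

theorem Hom.cond_mulL2 (φ : Hom A B) (x : LInf A) (ξ : L2 B) :
    φ.cond (mulL2 (φ.isomInf x) ξ) = mulL2 x (φ.cond ξ) :=
  ext_inner_left ℂ fun η => by
    rw [φ.inner_cond_right, inner_mulL2_right, inner_mulL2_right, φ.inner_cond_right,
      φ.isom_mulL2, φ.isomInf_star]

/-- The conditional expectation is an `L²` contraction that commutes with multiplication by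
`L^∞(A)`. Hence multiplication by `φ.cond u` is bounded by `‖u‖`, and the multiplier criterion
`exists_toL2_eq_of_forall` applies. -/
theorem Hom.exists_toL2_eq_cond (φ : Hom A B) (u : LInf B) :
    ∃ e : LInf A, toL2 e = φ.cond (toL2 u) ∧ ‖e‖ ≤ ‖u‖ := by
  refine exists_toL2_eq_of_forall (norm_nonneg u) fun x => ?_
  calc ‖mulL2 x (φ.cond (toL2 u))‖ ≤ ‖mulL2 (φ.isomInf x) (toL2 u)‖ := by
        rw [← φ.cond_mulL2]; exact φ.norm_cond_le _
    _ ≤ ‖u‖ * ‖toL2 (φ.isomInf x)‖ := by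
        rw [mulL2_toL2_comm]; exact norm_mulL2_le _ _
    _ = ‖u‖ * ‖toL2 x‖ := by rw [← φ.isom_toL2, φ.isom.norm_map]

/-- The conditional expectation `L^∞(B) → L^∞(A)`. -/
noncomputable def Hom.condInf (φ : Hom A B) (u : LInf B) : LInf A :=
  (φ.exists_toL2_eq_cond u).choose

theorem Hom.toL2_condInf (φ : Hom A B) (u : LInf B) : toL2 (φ.condInf u) = φ.cond (toL2 u) :=
  (φ.exists_toL2_eq_cond u).choose_spec.1

theorem Hom.norm_condInf_le (φ : Hom A B) (u : LInf B) : ‖φ.condInf u‖ ≤ ‖u‖ :=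
  (φ.exists_toL2_eq_cond u).choose_spec.2

/-- The `L²` preimage of `x` is its conditional expectation, which is bounded because `x` is. -/
theorem Hom.exists_isomInf_eq (φ : Hom A B) {x : LInf B} (h : toL2 x ∈ range φ.isom) :
    ∃ z : LInf A, φ.isomInf z = x := by
  obtain ⟨ζ, hζ⟩ := h
  refine ⟨φ.condInf x, toL2_injective ?_⟩
  rw [← φ.isom_toL2, φ.toL2_condInf, ← hζ, φ.cond_isom]

/-- Descends from functions to elements: the level set `{z = 1}` is given by some `a` up to a null
set, and its preimage agrees with `cyl c` almost everywhere. -/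
theorem Hom.exists_eq_of_isomInf_eq_ind (φ : Hom A B) {c : B} {z : LInf A}
    (hz : φ.isomInf z = ind c) : ∃ a, φ.toFun a = c := by
  have hm : StronglyMeasurable z := Lp.stronglyMeasurable z
  let s : Set (Canon A) := {ω | z ω = 1}
  have hs : MeasurableSet s := hm.measurable (measurableSet_singleton 1)
  obtain ⟨a, ha⟩ := exists_indSet_eq hs
  refine ⟨a, ind_injective ?_⟩
  rw [← φ.isomInf_ind, ← ha, φ.isomInf_indSet]
  have h1 := φ.coeFn_isomInf z
  rw [hz] at h1
  refine Lp.ext ?_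
  filter_upwards [h1, coeFn_ind c, coeFn_indSet _ (φ.measurable_dual hs)] with ω k1 k2 k3
  rw [k3, k2]
  rw [k2] at k1
  by_cases hc : ω ∈ cyl c
  · have h' : z (φ.dual ω) = 1 := by simpa [hc] using k1.symm
    have : ω ∈ φ.dual ⁻¹' s := h'
    simp [hc, this]
  · have : ω ∉ φ.dual ⁻¹' s := by
      intro h
      have h' : z (φ.dual ω) = 1 := h
      simp [hc, h'] at k1
    simp [hc, this]

theorem Hom.exists_eq_of_ind_mem (φ : Hom A B) {c : B} (h : toL2 (ind c) ∈ range φ.isom) :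
    ∃ a, φ.toFun a = c := by
  obtain ⟨z, hz⟩ := φ.exists_isomInf_eq h
  exact φ.exists_eq_of_isomInf_eq_ind hz

end HomMaps

/-! ### The induced actions of the group on `L²` and `L^∞`. -/

section GroupAction

variable {Γ : Type w} [Group Γ] {X : Type u} {Y : Type v} [ProbabilityAlgebra X]
  [ProbabilityAlgebra Y] [System Γ X] [System Γ Y]

variable (X) in
/-- The unitary representation on `L²(X)`. -/
noncomputable def rep (γ : Γ) : L2 X →ₗᵢ[ℂ] L2 X := (System.toHom X γ).isom

variable (X) in
/-- The action on `L^∞(X)`. -/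
noncomputable def repInf (γ : Γ) : LInf X →ₗᵢ[ℂ] LInf X := (System.toHom X γ).isomInf

theorem rep_mul (γ δ : Γ) (ξ : L2 X) : rep X (γ * δ) ξ = rep X γ (rep X δ ξ) :=
  (Hom.isom_comp (fun a => mul_smul γ δ a) ξ).symm

theorem rep_one (ξ : L2 X) : rep X (1 : Γ) ξ = ξ := by
  refine Lp.ext ?_
  have : ∀ ω, (System.toHom X (1 : Γ)).dual ω = ω := fun ω => by
    ext a; exact congrArg ω.toFun (one_smul Γ a)
  filter_upwards [(System.toHom X (1 : Γ)).coeFn_isom ξ] with ω h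
  rw [this] at h
  exact h

theorem rep_rep_inv (γ : Γ) (ξ : L2 X) : rep X γ (rep X γ⁻¹ ξ) = ξ := by
  rw [← rep_mul, mul_inv_cancel, rep_one]

theorem inner_rep_left (γ : Γ) (ξ η : L2 X) : ⟪rep X γ ξ, η⟫_ℂ = ⟪ξ, rep X γ⁻¹ η⟫_ℂ := by
  rw [← (rep X γ).inner_map_map ξ, rep_rep_inv]

theorem rep_toL2 (γ : Γ) (x : LInf X) : rep X γ (toL2 x) = toL2 (repInf X γ x) :=
  Hom.isom_toL2 _ x

theorem rep_mulL2 (γ : Γ) (x : LInf X) (ξ : L2 X) :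
    rep X γ (mulL2 x ξ) = mulL2 (repInf X γ x) (rep X γ ξ) := Hom.isom_mulL2 _ x ξ

theorem norm_repInf (γ : Γ) (x : LInf X) : ‖repInf X γ x‖ = ‖x‖ := (repInf X γ).norm_map x

theorem rep_isom (f : FactorMap Γ X Y) (γ : Γ) (η : L2 Y) :
    rep X γ (f.isom η) = f.isom (rep Y γ η) := by
  have h1 := Hom.isom_comp (φ := f.toHom) (ψ := System.toHom X γ)
    (χ := ⟨((System.toHom X γ).toBoundedLatticeHom.comp f.toBoundedLatticeHom),
      fun a => ((System.toHom X γ).prob_map _).trans (f.prob_map a)⟩) (fun a => rfl) η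
  have h2 := Hom.isom_comp (φ := System.toHom Y γ) (ψ := f.toHom)
    (χ := ⟨((System.toHom X γ).toBoundedLatticeHom.comp f.toBoundedLatticeHom),
      fun a => ((System.toHom X γ).prob_map _).trans (f.prob_map a)⟩)
      (fun a => (f.map_smul γ a).symm) η
  exact h1.trans h2.symm

theorem repInf_isomInf (f : FactorMap Γ X Y) (γ : Γ) (y : LInf Y) :
    repInf X γ (f.isomInf y) = f.isomInf (repInf Y γ y) :=
  toL2_injective (by rw [← rep_toL2, ← f.isom_toL2, rep_isom, rep_toL2, f.isom_toL2])

theorem rep_cond (f : FactorMap Γ X Y) (γ : Γ) (ξ : L2 X) :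
    rep Y γ (f.cond ξ) = f.cond (rep X γ ξ) :=
  ext_inner_right ℂ fun η => by
    rw [inner_rep_left, f.inner_cond_left, f.inner_cond_left, inner_rep_left, rep_isom]

end GroupAction

/-! ### Families that are uniformly approximable by finitely generated modules -/

section Approx

variable {X : Type u} {Y : Type v} [ProbabilityAlgebra X] [ProbabilityAlgebra Y] {ι : Type w}

/-- The members of the family `k` are, up to arbitrarily small errors, combinations of finitely
many bounded functions with uniformly bounded coefficients from `L^∞(Y)`. -/
def ApproxByModule (φ : Hom Y X) (k : ι → L2 X) : Prop :=
  ∀ ε : ℝ, 0 < ε → ∃ (m : Type) (_ : Fintype m) (g : m → LInf X) (C : ℝ), ∀ i,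
    ∃ y : m → LInf Y, (∀ j, ‖y j‖ ≤ C) ∧
      ‖k i - ∑ j, mulL2 (φ.isomInf (y j)) (toL2 (g j))‖ ≤ ε

theorem norm_mulL2_isomInf_le (φ : Hom Y X) {y : LInf Y} {C : ℝ} (h : ‖y‖ ≤ C) (ξ : L2 X) :
    ‖mulL2 (φ.isomInf y) ξ‖ ≤ C * ‖ξ‖ :=
  (norm_mulL2_le _ _).trans
    (mul_le_mul_of_nonneg_right (by rwa [φ.isomInf.norm_map]) (norm_nonneg _))

/-- Density of `L^∞` in `L²` allows bounded generators. Boundedness is what later makes products of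
generators meaningful. -/
theorem ApproxByModule.of_condPrecompact {φ : Hom Y X} {k : ι → L2 X}
    (h : CondPrecompact φ (range k)) : ApproxByModule φ k := by
  intro ε hε
  -- From `ε/4 < ε/2` comes the strict inequality needed to pick an actual point of the zonotope.
  -- The other `ε/2` pays for moving each of the `F.card` generators by less than `ε / (2 (F.card +
  -- 1))`, their coefficients having norm at most one.
  obtain ⟨F, hF⟩ := h (ε / 4) (by positivity)
  have hδ : 0 < ε / (2 * ((F.card : ℝ) + 1)) := by positivity
  let f : Fin F.card → L2 X := fun j => (F.equivFin.symm j).1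
  choose g hg using fun j => exists_toL2_near (f j) hδ
  refine ⟨Fin F.card, inferInstance, g, 1, fun i => ?_⟩
  have hne : (zonotope φ F).Nonempty :=
    ⟨∑ f ∈ F, φ.act f 0, fun _ => 0, fun _ _ => by simp, rfl⟩
  obtain ⟨_, ⟨x, hx, rfl⟩, hlt⟩ :=
    (Metric.infDist_lt_iff hne).1 ((hF (k i) ⟨i, rfl⟩).trans_lt (by linarith : ε / 4 < ε / 2))
  refine ⟨fun j => x (f j), fun j => hx _ (F.equivFin.symm j).2, ?_⟩
  have hsum : ∑ f ∈ F, φ.act f (x f) = ∑ j, mulL2 (φ.isomInf (x (f j))) (f j) := by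
    rw [← Finset.sum_coe_sort F, ← F.equivFin.symm.sum_comp]
    rfl
  have hd : ‖∑ j, mulL2 (φ.isomInf (x (f j))) (f j) -
      ∑ j, mulL2 (φ.isomInf (x (f j))) (toL2 (g j))‖ ≤ ε / 2 := by
    rw [← Finset.sum_sub_distrib]
    calc _ ≤ ∑ j : Fin F.card, ε / (2 * ((F.card : ℝ) + 1)) := by
          refine (norm_sum_le _ _).trans (Finset.sum_le_sum fun j _ => ?_)
          rw [← map_sub]
          refine (norm_mulL2_isomInf_le φ (hx _ (F.equivFin.symm j).2) _).trans ?_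
          rw [one_mul]
          exact (hg j).le
      _ = F.card * (ε / (2 * ((F.card : ℝ) + 1))) := by simp
      _ ≤ ε / 2 := by
          rw [mul_div_assoc', div_le_div_iff₀ (by positivity) (by positivity)]
          nlinarith
  rw [dist_eq_norm, hsum] at hlt
  calc _ = ‖(k i - ∑ j, mulL2 (φ.isomInf (x (f j))) (f j)) +
        (∑ j, mulL2 (φ.isomInf (x (f j))) (f j) -
          ∑ j, mulL2 (φ.isomInf (x (f j))) (toL2 (g j)))‖ := by rw [sub_add_sub_cancel]
    _ ≤ ε / 2 + ε / 2 := (norm_add_le _ _).trans (add_le_add hlt.le hd)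
    _ = ε := by ring

theorem ApproxByModule.condPrecompact {φ : Hom Y X} {k : ι → L2 X}
    (h : ApproxByModule φ k) : CondPrecompact φ (range k) := by
  classical
  intro ε hε
  obtain ⟨m, _, g, C, hC⟩ := h ε hε
  -- Rescaling the generators by `N` shrinks the coefficients into the unit ball. The factor
  -- `Fintype.card m` is there because a zonotope is indexed by a set of vectors: coefficients of
  -- coinciding generators are added up.
  let N : ℝ := Fintype.card m * |C| + 1
  have hN : 0 < N := by positivity
  have hN' : (N : ℂ) ≠ 0 := by exact_mod_cast hN.ne'
  let f : m → L2 X := fun j => (N : ℂ) • toL2 (g j)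
  refine ⟨Finset.univ.image f, ?_⟩
  rintro _ ⟨i, rfl⟩
  obtain ⟨y, hy, hk⟩ := hC i
  let x : L2 X → LInf Y := fun ζ => ∑ j with f j = ζ, (N : ℂ)⁻¹ • y j
  have hmem : ∑ j, mulL2 (φ.isomInf (y j)) (toL2 (g j)) ∈ zonotope φ (Finset.univ.image f) := by
    refine ⟨x, fun ζ _ => ?_, ?_⟩
    · calc ‖x ζ‖ ≤ ∑ j with f j = ζ, ‖(N : ℂ)⁻¹ • y j‖ := norm_sum_le _ _
        _ ≤ ∑ j, ‖(N : ℂ)⁻¹ • y j‖ :=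
          Finset.sum_le_sum_of_subset_of_nonneg (Finset.filter_subset _ _)
            fun _ _ _ => norm_nonneg _
        _ ≤ ∑ _j : m, N⁻¹ * |C| := Finset.sum_le_sum fun j _ => by
          rw [norm_smul, norm_inv, Complex.norm_real, Real.norm_of_nonneg hN.le]
          exact mul_le_mul_of_nonneg_left ((hy j).trans (le_abs_self C)) (by positivity)
        _ = (Fintype.card m * |C|) / N := by simp; ring
        _ ≤ 1 := by rw [div_le_one hN]; simp only [N]; linarith
    · rw [← Finset.sum_fiberwise_of_maps_to (t := Finset.univ.image f) (g := f)
        (fun j hj => Finset.mem_image_of_mem f hj)]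
      refine Finset.sum_congr rfl fun ζ _ => ?_
      rw [φ.act_eq]
      simp only [x, map_sum, _root_.sum_apply]
      refine Finset.sum_congr rfl fun j hj => ?_
      rw [← (Finset.mem_filter.1 hj).2]
      simp only [f, map_smul, _root_.smul_apply, smul_smul]
      rw [mul_inv_cancel₀ hN', one_smul]
  refine (Metric.infDist_le_dist_of_mem hmem).trans ?_
  rwa [dist_eq_norm]

theorem condPrecompact_range_iff {φ : Hom Y X} {k : ι → L2 X} :
    CondPrecompact φ (range k) ↔ ApproxByModule φ k :=
  ⟨.of_condPrecompact, ApproxByModule.condPrecompact⟩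

namespace ApproxByModule

variable {φ : Hom Y X} {k l : ι → L2 X}

/-- Closure under limits that are uniform in the index; the product and closedness lemmas below rest
on it. -/
theorem of_near (h : ∀ ε : ℝ, 0 < ε → ∃ k', ApproxByModule φ k' ∧ ∀ i : ι, ‖k i - k' i‖ ≤ ε) :
    ApproxByModule φ k := by
  intro ε hε
  obtain ⟨k', hk', hn⟩ := h (ε / 2) (by positivity)
  obtain ⟨m, _, g, C, hC⟩ := hk' (ε / 2) (by positivity)
  refine ⟨m, ‹_›, g, C, fun i => ?_⟩
  obtain ⟨y, hy, hyk⟩ := hC i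
  refine ⟨y, hy, ?_⟩
  rw [← sub_add_sub_cancel _ (k' i)]
  exact (norm_add_le _ _).trans (by linarith [hn i])

theorem zero : ApproxByModule φ fun _ : ι => 0 := fun ε hε =>
  ⟨Fin 0, inferInstance, fun _ => 0, 0, fun _ => ⟨fun _ => 0, fun j => j.elim0, by simpa using hε.le⟩⟩

theorem add (hk : ApproxByModule φ k) (hl : ApproxByModule φ l) :
    ApproxByModule φ fun i => k i + l i := by
  intro ε hε
  obtain ⟨m, _, g, C, hC⟩ := hk (ε / 2) (by positivity)
  obtain ⟨n, _, g', C', hC'⟩ := hl (ε / 2) (by positivity)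
  refine ⟨m ⊕ n, inferInstance, Sum.elim g g', max C C', fun i => ?_⟩
  obtain ⟨y, hy, hyk⟩ := hC i
  obtain ⟨z, hz, hzl⟩ := hC' i
  refine ⟨Sum.elim y z, ?_, ?_⟩
  · rintro (j | j)
    · exact (hy j).trans (le_max_left _ _)
    · exact (hz j).trans (le_max_right _ _)
  · rw [Fintype.sum_sum_type]
    simp only [Sum.elim_inl, Sum.elim_inr]
    rw [add_sub_add_comm]
    exact (norm_add_le _ _).trans (by linarith)

/-- Multiplication by a fixed bounded function and by uniformly bounded functions from the base. -/
theorem mul_left (hl : ApproxByModule φ l) (g : LInf X) {y : ι → LInf Y} {C : ℝ}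
    (hy : ∀ i, ‖y i‖ ≤ C) :
    ApproxByModule φ fun i => mulL2 (φ.isomInf (y i)) (mulL2 g (l i)) := by
  intro ε hε
  have hN : 0 < |C| * ‖g‖ + 1 := by positivity
  obtain ⟨m, _, g', C', hC'⟩ := hl (ε / (|C| * ‖g‖ + 1)) (by positivity)
  refine ⟨m, ‹_›, fun j => g * g' j, |C| * |C'|, fun i => ?_⟩
  obtain ⟨z, hz, hzl⟩ := hC' i
  refine ⟨fun j => y i * z j, fun j => ?_, ?_⟩
  · exact (LInf.norm_mul_le _ _).trans (mul_le_mul ((hy i).trans (le_abs_self C))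
      ((hz j).trans (le_abs_self C')) (norm_nonneg _) (abs_nonneg _))
  · have : ∀ j, mulL2 (φ.isomInf (y i * z j)) (toL2 (g * g' j)) =
        mulL2 (φ.isomInf (y i)) (mulL2 g (mulL2 (φ.isomInf (z j)) (toL2 (g' j)))) := fun j => by
      rw [φ.isomInf_mul, mulL2_mul, toL2_mul, mulL2_comm _ g]
    simp_rw [this]
    rw [← map_sum, ← map_sum, ← map_sub, ← map_sub]
    calc _ ≤ |C| * ‖mulL2 g (l i - ∑ j, mulL2 (φ.isomInf (z j)) (toL2 (g' j)))‖ :=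
          norm_mulL2_isomInf_le φ ((hy i).trans (le_abs_self C)) _
      _ ≤ |C| * (‖g‖ * (ε / (|C| * ‖g‖ + 1))) := by
          refine mul_le_mul_of_nonneg_left ((norm_mulL2_le _ _).trans ?_) (abs_nonneg _)
          exact mul_le_mul_of_nonneg_left hzl (norm_nonneg _)
      _ = (|C| * ‖g‖) * ε / (|C| * ‖g‖ + 1) := by ring
      _ ≤ ε := by rw [div_le_iff₀ hN]; nlinarith

theorem base_mul (g : LInf X) {y : ι → LInf Y} {C : ℝ} (hy : ∀ i, ‖y i‖ ≤ C) :
    ApproxByModule φ fun i => mulL2 (φ.isomInf (y i)) (toL2 g) := fun ε hε =>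
  ⟨Fin 1, inferInstance, fun _ => g, C, fun i =>
    ⟨fun _ => y i, fun _ => hy i, by simpa using hε.le⟩⟩

theorem sum {κ : Type*} {k : κ → ι → L2 X} (s : Finset κ)
    (h : ∀ j ∈ s, ApproxByModule φ (k j)) : ApproxByModule φ fun i => ∑ j ∈ s, k j i := by
  classical
  induction s using Finset.induction_on with
  | empty => simpa using zero
  | insert a s ha ih =>
    simp_rw [Finset.sum_insert ha]
    exact (h a (Finset.mem_insert_self _ _)).add
      (ih fun j hj => h j (Finset.mem_insert_of_mem hj))

theorem smul (c : ℂ) (hk : ApproxByModule φ k) : ApproxByModule φ fun i => c • k i := by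
  intro ε hε
  obtain ⟨m, _, g, C, hC⟩ := hk (ε / (‖c‖ + 1)) (by positivity)
  refine ⟨m, ‹_›, fun j => c • g j, C, fun i => ?_⟩
  obtain ⟨y, hy, hyk⟩ := hC i
  refine ⟨y, hy, ?_⟩
  simp_rw [toL2_smul, map_smul]
  rw [← Finset.smul_sum, ← smul_sub, norm_smul]
  calc _ ≤ ‖c‖ * (ε / (‖c‖ + 1)) := mul_le_mul_of_nonneg_left hyk (norm_nonneg _)
    _ ≤ ε := by rw [mul_div_assoc', div_le_iff₀ (by positivity)]; nlinarith

theorem star (hk : ApproxByModule φ k) : ApproxByModule φ fun i => star (k i) := by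
  intro ε hε
  obtain ⟨m, _, g, C, hC⟩ := hk ε hε
  refine ⟨m, ‹_›, fun j => Star.star (g j), C, fun i => ?_⟩
  obtain ⟨y, hy, hyk⟩ := hC i
  refine ⟨fun j => Star.star (y j), fun j => by rw [norm_star_LInf]; exact hy j, ?_⟩
  have : ∀ j, mulL2 (φ.isomInf (Star.star (y j))) (toL2 (Star.star (g j))) =
      Star.star (mulL2 (φ.isomInf (y j)) (toL2 (g j))) := fun j => by
    rw [star_mulL2, star_toL2, φ.isomInf_star]
  simp_rw [this]
  rw [← star_sum_L2, ← star_sub_L2, norm_star_L2]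
  exact hyk

theorem comp {κ : Type*} (hk : ApproxByModule φ k) (σ : κ → ι) :
    ApproxByModule φ fun i => k (σ i) := fun ε hε => by
  obtain ⟨m, hm, g, C, hC⟩ := hk ε hε
  refine ⟨m, hm, g, C, fun i => ?_⟩
  obtain ⟨y, hy, hyk⟩ := hC (σ i)
  exact ⟨y, hy, hyk⟩

/-- Products of uniformly bounded families. -/
theorem mul {k l : ι → LInf X} {M : ℝ} (hM : ∀ i, ‖l i‖ ≤ M)
    (hk : ApproxByModule φ fun i => toL2 (k i)) (hl : ApproxByModule φ fun i => toL2 (l i)) :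
    ApproxByModule φ fun i => toL2 (k i * l i) := by
  refine of_near fun ε hε => ?_
  obtain ⟨m, _, g, C, hC⟩ := hk (ε / (|M| + 1)) (by positivity)
  choose y hy hyk using hC
  -- Only `k` is replaced by its module combination, with `l i` kept exact; the uniform bound on `l`
  -- controls the error. The remaining products of `l` with the fixed bounded `g j` are covered by
  -- `mul_left`.
  refine ⟨_, sum (k := fun j i => mulL2 (φ.isomInf (y i j)) (mulL2 (g j) (toL2 (l i))))
    Finset.univ (fun j _ => hl.mul_left (g j) fun i => hy i j), fun i => ?_⟩
  have h1 : ∀ j, mulL2 (φ.isomInf (y i j)) (mulL2 (g j) (toL2 (l i))) =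
      mulL2 (l i) (mulL2 (φ.isomInf (y i j)) (toL2 (g j))) := fun j => by
    rw [mulL2_toL2_comm, mulL2_comm]
  simp_rw [h1]
  rw [toL2_mul, mulL2_toL2_comm, ← map_sum, ← map_sub]
  calc _ ≤ |M| * (ε / (|M| + 1)) := (norm_mulL2_le _ _).trans
        (mul_le_mul ((hM i).trans (le_abs_self M)) (hyk i) (norm_nonneg _) (abs_nonneg _))
    _ ≤ ε := by rw [mul_div_assoc', div_le_iff₀ (by positivity)]; nlinarith

variable {H : Type*} [NormedAddCommGroup H] [NormedSpace ℂ H]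

/-- The vectors whose images under a family of linear maps are approximable. -/
def submodule (φ : Hom Y X) (T : ι → H →ₗ[ℂ] L2 X) : Submodule ℂ H where
  carrier := {ξ | ApproxByModule φ fun i => T i ξ}
  zero_mem' := by simpa using zero
  add_mem' h h' := by simpa using h.add h'
  smul_mem' c _ h := by simpa using h.smul c

theorem mem_submodule {T : ι → H →ₗ[ℂ] L2 X} {ξ : H} :
    ξ ∈ submodule φ T ↔ ApproxByModule φ fun i => T i ξ := Iff.rfl

/-- Equiboundedness of the maps turns norm approximation of `ξ` into approximation uniform in `i`.
Thus it is enough to test approximability on a total set of vectors. -/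
theorem isClosed_submodule {T : ι → H →ₗ[ℂ] L2 X} {C : ℝ} (hT : ∀ i ξ, ‖T i ξ‖ ≤ C * ‖ξ‖) :
    IsClosed (submodule φ T : Set H) := by
  refine isClosed_of_closure_subset fun ξ hξ => of_near fun ε hε => ?_
  obtain ⟨η, hη, hd⟩ := Metric.mem_closure_iff.1 hξ (ε / (|C| + 1)) (by positivity)
  refine ⟨_, hη, fun i => ?_⟩
  rw [dist_eq_norm] at hd
  rw [← map_sub]
  calc _ ≤ |C| * (ε / (|C| + 1)) := (hT i _).trans
        (mul_le_mul (le_abs_self C) hd.le (norm_nonneg _) (abs_nonneg _))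
    _ ≤ ε := by rw [mul_div_assoc', div_le_iff₀ (by positivity)]; nlinarith

end ApproxByModule

end Approx

/-! ### The algebra of almost periodic functions -/

section AlmostPeriodicAlgebra

variable {Γ : Type w} [Group Γ] {X : Type u} {Y : Type v} [ProbabilityAlgebra X]
  [ProbabilityAlgebra Y] [System Γ X] [System Γ Y] {f : FactorMap Γ X Y}

theorem almostPeriodic_iff {ξ : L2 X} :
    AlmostPeriodic f ξ ↔ ApproxByModule f.toHom fun γ : Γ => rep X γ ξ :=
  condPrecompact_range_iff

variable (f) in
/-- The space of almost periodic elements of `L²(X)`. -/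
noncomputable def apSubmodule : Submodule ℂ (L2 X) :=
  ApproxByModule.submodule f.toHom fun γ : Γ => (rep X γ).toLinearMap

theorem mem_apSubmodule {ξ : L2 X} : ξ ∈ apSubmodule f ↔ AlmostPeriodic f ξ :=
  almostPeriodic_iff.symm

variable (f) in
theorem isClosed_apSubmodule : IsClosed (apSubmodule f : Set (L2 X)) :=
  ApproxByModule.isClosed_submodule (C := 1) fun γ ξ => by
    rw [one_mul]; exact ((rep X γ).norm_map ξ).le

theorem AlmostPeriodic.mul {x y : LInf X} (hx : AlmostPeriodic f (toL2 x))
    (hy : AlmostPeriodic f (toL2 y)) : AlmostPeriodic f (toL2 (x * y)) := by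
  rw [almostPeriodic_iff] at *
  simp_rw [rep_toL2] at *
  have : ∀ γ : Γ, repInf X γ (x * y) = repInf X γ x * repInf X γ y := fun γ =>
    Hom.isomInf_mul _ x y
  simp_rw [this]
  exact ApproxByModule.mul (fun γ => (norm_repInf γ y).le) hx hy

theorem AlmostPeriodic.star {ξ : L2 X} (hξ : AlmostPeriodic f ξ) :
    AlmostPeriodic f (star ξ) := by
  rw [almostPeriodic_iff] at *
  have : ∀ γ : Γ, rep X γ (Star.star ξ) = Star.star (rep X γ ξ) := fun γ => Hom.isom_star _ ξ
  simp_rw [this]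
  exact ApproxByModule.star hξ

theorem AlmostPeriodic.rep {ξ : L2 X} (hξ : AlmostPeriodic f ξ) (δ : Γ) :
    AlmostPeriodic f (rep X δ ξ) := by
  rw [almostPeriodic_iff] at *
  simp_rw [← rep_mul]
  -- The orbit of `δξ` is the orbit of `ξ`, reparametrised by right translation.
  exact hξ.comp fun γ => γ * δ

theorem AlmostPeriodic.add {ξ η : L2 X} (hξ : AlmostPeriodic f ξ) (hη : AlmostPeriodic f η) :
    AlmostPeriodic f (ξ + η) :=
  mem_apSubmodule.1 (add_mem (mem_apSubmodule.2 hξ) (mem_apSubmodule.2 hη))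

theorem AlmostPeriodic.sub {ξ η : L2 X} (hξ : AlmostPeriodic f ξ) (hη : AlmostPeriodic f η) :
    AlmostPeriodic f (ξ - η) :=
  mem_apSubmodule.1 (sub_mem (mem_apSubmodule.2 hξ) (mem_apSubmodule.2 hη))

theorem AlmostPeriodic.smul {ξ : L2 X} (c : ℂ) (hξ : AlmostPeriodic f ξ) :
    AlmostPeriodic f (c • ξ) :=
  mem_apSubmodule.1 ((apSubmodule f).smul_mem c (mem_apSubmodule.2 hξ))

variable (f) in
theorem almostPeriodic_base (y : LInf Y) : AlmostPeriodic f (toL2 (f.isomInf y)) := by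
  rw [almostPeriodic_iff]
  simp_rw [rep_toL2, repInf_isomInf]
  -- The whole orbit lies in the module with the constant function one as single generator.
  simp_rw [← mulL2_toL2_ind_top (f.isomInf _)]
  exact ApproxByModule.base_mul _ fun γ => (norm_repInf γ y).le

variable (f) in
theorem almostPeriodic_ind_base (y : Y) : AlmostPeriodic f (toL2 (ind (f.toFun y))) := by
  rw [← f.toHom.isomInf_ind]
  exact almostPeriodic_base f _

variable (f) in
theorem almostPeriodic_ind_top : AlmostPeriodic f (toL2 (ind (⊤ : X))) := by
  have : f.toFun ⊤ = ⊤ := f.map_top'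
  rw [← this]
  exact almostPeriodic_ind_base f ⊤

theorem AlmostPeriodic.ind_inf {a b : X} (ha : AlmostPeriodic f (toL2 (ind a)))
    (hb : AlmostPeriodic f (toL2 (ind b))) : AlmostPeriodic f (toL2 (ind (a ⊓ b))) := by
  rw [ProbabilityAlgebra.ind_inf]
  exact ha.mul hb

theorem AlmostPeriodic.ind_compl {a : X} (ha : AlmostPeriodic f (toL2 (ind a))) :
    AlmostPeriodic f (toL2 (ind aᶜ)) := by
  rw [ProbabilityAlgebra.ind_compl, toL2_sub]
  exact (almostPeriodic_ind_top f).sub ha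

theorem AlmostPeriodic.ind_sup {a b : X} (ha : AlmostPeriodic f (toL2 (ind a)))
    (hb : AlmostPeriodic f (toL2 (ind b))) : AlmostPeriodic f (toL2 (ind (a ⊔ b))) := by
  rw [← compl_compl (a ⊔ b), compl_sup]
  exact (ha.ind_compl.ind_inf hb.ind_compl).ind_compl

theorem almostPeriodic_ind_of_isLUB {s : ℕ → X} {b : X}
    (hs : ∀ n, AlmostPeriodic f (toL2 (ind (s n)))) (hb : IsLUB (range s) b) :
    AlmostPeriodic f (toL2 (ind b)) := by
  have hp : ∀ n, AlmostPeriodic f (toL2 (ind (partialSups s n))) := fun n => by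
    induction n with
    | zero => rw [partialSups_zero]; exact hs 0
    | succ n ih => rw [partialSups_add_one]; exact ih.ind_sup (hs (n + 1))
  exact mem_apSubmodule.1 (toL2_ind_mem_of_isLUB (isClosed_apSubmodule f)
    (fun n => mem_apSubmodule.2 (hp n)) hb)

/-- Bounded almost periodic functions form a `*`-algebra with unit, so they contain the real part
`(x + x*)/2` and its polynomials. This begins a functional calculus that ends with level sets. -/
theorem AlmostPeriodic.polynomial {x : LInf X} (hx : AlmostPeriodic f (toL2 x))
    (p : Polynomial ℝ) : ∃ u : LInf X, AlmostPeriodic f (toL2 u) ∧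
      ⇑u =ᵐ[canonMeasure X] fun ω => ((p.eval (x ω).re : ℝ) : ℂ) := by
  induction p using Polynomial.induction_on' with
  | add p q hp hq =>
    obtain ⟨u, hu, hu'⟩ := hp
    obtain ⟨v, hv, hv'⟩ := hq
    refine ⟨u + v, by rw [toL2_add]; exact hu.add hv, ?_⟩
    filter_upwards [hu', hv', Lp.coeFn_add u v] with ω h1 h2 h3
    rw [h3, Pi.add_apply, h1, h2, Polynomial.eval_add, Complex.ofReal_add]
  | monomial n a =>
    have hr : AlmostPeriodic f (toL2 ((1 / 2 : ℂ) • (x + Star.star x))) := by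
      rw [toL2_smul, toL2_add, ← star_toL2]
      exact (hx.add hx.star).smul _
    have hr' : ⇑((1 / 2 : ℂ) • (x + Star.star x)) =ᵐ[canonMeasure X]
        fun ω => (((x ω).re : ℝ) : ℂ) := by
      filter_upwards [Lp.coeFn_smul (1 / 2 : ℂ) (x + Star.star x), Lp.coeFn_add x (Star.star x),
        coeFn_star x] with ω h1 h2 h3
      rw [h1, Pi.smul_apply, h2, Pi.add_apply, h3, Complex.re_eq_add_conj]
      simp only [smul_eq_mul, RCLike.star_def]
      ring
    have hpow : ∀ n : ℕ, ∃ u : LInf X, AlmostPeriodic f (toL2 u) ∧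
        ⇑u =ᵐ[canonMeasure X] fun ω => (((x ω).re ^ n : ℝ) : ℂ) := fun n => by
      induction n with
      | zero =>
        refine ⟨ind ⊤, almostPeriodic_ind_top f, ?_⟩
        filter_upwards [coeFn_ind (⊤ : X)] with ω h
        rw [h, cyl_top]; simp
      | succ n ih =>
        obtain ⟨u, hu, hu'⟩ := ih
        refine ⟨_, hu.mul hr, ?_⟩
        filter_upwards [hu', hr', LInf.coeFn_mul u ((1 / 2 : ℂ) • (x + Star.star x))]
          with ω h1 h2 h3
        rw [h3, h1, h2, pow_succ, Complex.ofReal_mul]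
    obtain ⟨u, hu, hu'⟩ := hpow n
    refine ⟨(a : ℂ) • u, by rw [toL2_smul]; exact hu.smul _, ?_⟩
    filter_upwards [hu', Lp.coeFn_smul (a : ℂ) u] with ω h1 h2
    rw [h2, Pi.smul_apply, h1, Polynomial.eval_monomial, Complex.ofReal_mul, smul_eq_mul]

/-- Weierstrass approximation of `g` on `[-‖x‖, ‖x‖]`, where the real part of `x` takes almost all
its values, together with closedness of the almost periodic elements. -/
theorem AlmostPeriodic.continuous_comp {x : LInf X} (hx : AlmostPeriodic f (toL2 x))
    {g : ℝ → ℝ} (hg : Continuous g) : ∃ u : LInf X, AlmostPeriodic f (toL2 u) ∧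
      ⇑u =ᵐ[canonMeasure X] fun ω => ((g (x ω).re : ℝ) : ℂ) := by
  have hIcc : ∀ᵐ ω ∂canonMeasure X, (x ω).re ∈ Icc (-‖x‖) ‖x‖ := by
    filter_upwards [LInf.ae_norm_le x] with ω h
    exact abs_le.1 ((Complex.abs_re_le_norm _).trans h)
  obtain ⟨C, hC⟩ := (isCompact_Icc (a := -‖x‖) (b := ‖x‖)).exists_bound_of_continuousOn
    hg.continuousOn
  have hb : ∀ᵐ ω ∂canonMeasure X, ‖((g (x ω).re : ℝ) : ℂ)‖ ≤ C := by
    filter_upwards [hIcc] with ω h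
    rw [Complex.norm_real]
    exact hC _ h
  have hm : AEStronglyMeasurable (fun ω => ((g (x ω).re : ℝ) : ℂ)) (canonMeasure X) :=
    (Complex.continuous_ofReal.comp (hg.comp Complex.continuous_re)).comp_aestronglyMeasurable
      (Lp.aestronglyMeasurable x)
  refine ⟨ofFun _ hm C hb, ?_, coeFn_ofFun hm hb⟩
  have hδ : ∀ n : ℕ, (0 : ℝ) < 1 / (n + 1) := fun n => by positivity
  choose p hp using fun n : ℕ =>
    exists_polynomial_near_of_continuousOn (-‖x‖) ‖x‖ g hg.continuousOn _ (hδ n)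
  choose u hu hu' using fun n => hx.polynomial (p n)
  have hd : ∀ n, ∀ᵐ ω ∂canonMeasure X, ‖u n ω - ((g (x ω).re : ℝ) : ℂ)‖ ≤ 1 / (n + 1) := by
    intro n
    filter_upwards [hu' n, hIcc] with ω h1 h2
    rw [h1, ← Complex.ofReal_sub, Complex.norm_real]
    exact (hp n _ h2).le
  have hC0 : 0 ≤ C := (norm_nonneg _).trans (hC 0 (by simp))
  refine mem_apSubmodule.1 (toL2_mem_of_ae_tendsto (isClosed_apSubmodule f) (C := C + 1)
    (fun n => mem_apSubmodule.2 (hu n)) (fun n => LInf.norm_le (by positivity) ?_) ?_)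
  · filter_upwards [hd n, hb] with ω h1 h2
    have h3 : (1 : ℝ) / (n + 1) ≤ 1 := by
      rw [div_le_one (by positivity)]
      linarith [(Nat.cast_nonneg n : (0 : ℝ) ≤ n)]
    calc ‖u n ω‖ = ‖((g (x ω).re : ℝ) : ℂ) + (u n ω - ((g (x ω).re : ℝ) : ℂ))‖ := by
          rw [add_sub_cancel]
      _ ≤ C + 1 := (norm_add_le _ _).trans (add_le_add h2 (h1.trans h3))
  · filter_upwards [ae_all_iff.2 hd, coeFn_ofFun hm hb] with ω h1 h2
    rw [h2, tendsto_iff_norm_sub_tendsto_zero]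
    exact squeeze_zero (fun n => norm_nonneg _) h1 tendsto_one_div_add_atTop_nhds_zero_nat

/-- The continuous functions `min 1 (max 0 (n t))` converge pointwise and boundedly to the indicator
of `t > 0`. -/
theorem AlmostPeriodic.indSet_pos {x : LInf X} (hx : AlmostPeriodic f (toL2 x))
    (hs : MeasurableSet {ω | 0 < (x ω).re}) : AlmostPeriodic f (toL2 (indSet _ hs)) := by
  let g : ℕ → ℝ → ℝ := fun n t => min 1 (max 0 (n * t))
  have hg : ∀ n, Continuous (g n) := fun n => by fun_prop
  choose u hu hu' using fun n => hx.continuous_comp (hg n)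
  refine mem_apSubmodule.1 (toL2_mem_of_ae_tendsto (isClosed_apSubmodule f) (C := 1)
    (fun n => mem_apSubmodule.2 (hu n)) (fun n => LInf.norm_le zero_le_one ?_) ?_)
  · filter_upwards [hu' n] with ω h
    rw [h, Complex.norm_real, Real.norm_of_nonneg (le_min zero_le_one (le_max_left _ _))]
    exact min_le_left _ _
  · filter_upwards [ae_all_iff.2 hu', coeFn_indSet _ hs] with ω h1 h2
    simp_rw [h1, h2]
    refine tendsto_const_nhds.congr' ?_
    by_cases hω : 0 < (x ω).re
    · obtain ⟨n, hn⟩ := exists_nat_gt (1 / (x ω).re)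
      filter_upwards [eventually_ge_atTop n] with k hk
      have h3 : 1 ≤ (k : ℝ) * (x ω).re := by
        have : (n : ℝ) ≤ k := by exact_mod_cast hk
        rw [div_lt_iff₀ hω] at hn
        nlinarith
      have h4 : g k (x ω).re = 1 := min_eq_left (h3.trans (le_max_right _ _))
      rw [h4, indicator_of_mem (by exact hω)]
      simp
    · refine Eventually.of_forall fun n => ?_
      have h3 : (n : ℝ) * (x ω).re ≤ 0 :=
        mul_nonpos_of_nonneg_of_nonpos (Nat.cast_nonneg n) (not_lt.1 hω)
      have h4 : g n (x ω).re = 0 := by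
        change min 1 (max 0 _) = _
        rw [max_eq_left h3, min_eq_right zero_le_one]
      simp only [h4]
      rw [indicator_of_notMem (by exact hω), Complex.ofReal_zero]

/-! ### Existence of the maximal compact extension -/

variable (f) in
/-- The factor of the elements whose indicator functions are almost periodic. -/
def apFactor : IntermediateFactor f where
  carrier := {a | AlmostPeriodic f (toL2 (ind a))}
  supClosed' _ ha _ hb := ha.ind_sup hb
  infClosed' _ ha _ hb := ha.ind_inf hb
  compl_mem' ha := ha.ind_compl
  bot_mem' := by
    rw [← compl_top]
    exact (almostPeriodic_ind_top f).ind_compl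
  isLUB_mem _ _ hs hb := almostPeriodic_ind_of_isLUB hs hb
  smul_mem γ a ha := by
    have := ha.rep γ
    rw [ProbabilityAlgebra.rep, Hom.isom_ind] at this
    exact this
  map_mem y := almostPeriodic_ind_base f y

namespace IntermediateFactor

variable {Z : IntermediateFactor f}

/-- A member of an intermediate factor, as an element of the factor. -/
def lift (a : X) (ha : a ∈ Z.carrier) : Z.Elem := ⟨a, ha⟩

theorem fromTop_lift {a : X} (ha : a ∈ Z.carrier) : Z.fromTop.toFun (lift a ha) = a := rfl

theorem almostPeriodic_isom (hZ : ∀ a ∈ Z.carrier, AlmostPeriodic f (toL2 (ind a)))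
    (ζ : L2 Z.Elem) : AlmostPeriodic f (Z.fromTop.isom ζ) := by
  refine mem_apSubmodule.1 (eq_top_of_ind_mem
    (V := (apSubmodule f).comap Z.fromTop.isom.toLinearMap) ?_ (fun a => ?_) ζ)
  · exact (isClosed_apSubmodule f).preimage Z.fromTop.isom.continuous
  · refine mem_apSubmodule.2 ?_
    change AlmostPeriodic f (Z.fromTop.isom (toL2 (ind a)))
    rw [Hom.isom_ind]
    exact hZ _ (Subtype.property a)

/-- The remainder `d = x - E(x|Z)` is almost periodic and has zero expectation over `Z`. Each set
`{Re(c d) > 0}` belongs to `Z`, so `Re(c d)` integrates to zero over it and the set is null. The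
choices `c = ±1, ±i` force `d = 0`. -/
theorem mem_range_of_almostPeriodic
    (hZ : ∀ a, AlmostPeriodic f (toL2 (ind a)) ↔ a ∈ Z.carrier) {x : LInf X}
    (hx : AlmostPeriodic f (toL2 x)) : Z.fromTop.isomInf (Z.fromTop.condInf x) = x := by
  set d := x - Z.fromTop.isomInf (Z.fromTop.condInf x) with hd
  have hdap : AlmostPeriodic f (toL2 d) := by
    rw [hd, toL2_sub, ← Z.fromTop.isom_toL2]
    exact hx.sub (almostPeriodic_isom (fun a ha => (hZ a).2 ha) _)
  have hcond : Z.fromTop.cond (toL2 d) = 0 := by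
    rw [hd, toL2_sub, map_sub, ← Z.fromTop.isom_toL2, Hom.cond_isom, Z.fromTop.toL2_condInf,
      sub_self]
  have key : ∀ c : ℂ, ∀ᵐ ω ∂canonMeasure X, (c * d ω).re ≤ 0 := fun c => by
    have hm : StronglyMeasurable (c • d : LInf X) := Lp.stronglyMeasurable _
    have hs : MeasurableSet {ω | 0 < ((c • d : LInf X) ω).re} :=
      measurableSet_lt measurable_const (Complex.measurable_re.comp hm.measurable)
    have hap : AlmostPeriodic f (toL2 (c • d)) := by rw [toL2_smul]; exact hdap.smul c
    have h1 := hap.indSet_pos hs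
    obtain ⟨a, ha⟩ := exists_indSet_eq hs
    have haZ : a ∈ Z.carrier := (hZ a).1 (ha ▸ h1)
    have h2 : ⟪toL2 (indSet _ hs), toL2 (c • d)⟫_ℂ = 0 := by
      have h3 : toL2 (ind a) = Z.fromTop.isom (toL2 (ind (lift a haZ))) := by
        rw [Hom.isom_ind, fromTop_lift]
      rw [ha, h3, ← Hom.inner_cond_right, toL2_smul, map_smul, hcond, smul_zero, inner_zero_right]
    filter_upwards [ae_re_nonpos_of_inner_eq_zero hs h2, Lp.coeFn_smul c d] with ω h3 h4
    rwa [h4] at h3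
  have hd0 : d = 0 := by
    refine Lp.ext ?_
    filter_upwards [key 1, key (-1), key Complex.I, key (-Complex.I),
      Lp.coeFn_zero ℂ ∞ (canonMeasure X)] with ω h1 h2 h3 h4 h5
    rw [h5]
    simp only [Complex.mul_re, Complex.one_re, Complex.one_im, Complex.neg_re, Complex.neg_im,
      Complex.I_re, Complex.I_im] at h1 h2 h3 h4
    refine Complex.ext ?_ ?_
    · simp only [Pi.zero_apply, Complex.zero_re]; linarith
    · simp only [Pi.zero_apply, Complex.zero_im]; linarith
  rw [hd] at hd0
  exact (sub_eq_zero.1 hd0).symm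

theorem isMaximalCompact_of_forall
    (hZ : ∀ a, AlmostPeriodic f (toL2 (ind a)) ↔ a ∈ Z.carrier) : Z.IsMaximalCompact := by
  refine Set.Subset.antisymm ?_ fun x hx => ⟨_, mem_range_of_almostPeriodic hZ hx⟩
  rintro _ ⟨z, rfl⟩
  change AlmostPeriodic f (toL2 (Z.fromTop.isomInf z))
  rw [← Z.fromTop.isom_toL2]
  exact almostPeriodic_isom (fun a ha => (hZ a).2 ha) _

/-- A maximal compact extension is therefore determined by its defining property, and the final
statement can be proved for arbitrary given ones. -/
theorem IsMaximalCompact.almostPeriodic_ind_iff (h : Z.IsMaximalCompact) (a : X) :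
    AlmostPeriodic f (toL2 (ind a)) ↔ a ∈ Z.carrier := by
  constructor
  · intro ha
    have : ind a ∈ range Z.fromTop.toHom.mapLInf := by rw [h]; exact ha
    obtain ⟨z, hz⟩ := this
    obtain ⟨b, rfl⟩ := Z.fromTop.toHom.exists_eq_of_isomInf_eq_ind hz
    exact Subtype.property b
  · intro ha
    have : Z.fromTop.toHom.mapLInf (ind (lift a ha)) ∈
        {x : LInf X | AlmostPeriodic f (LInf.toL2 x)} := by rw [← h]; exact ⟨_, rfl⟩
    rw [Hom.mapLInf_eq, Hom.isomInf_ind, fromTop_lift] at this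
    exact this

end IntermediateFactor

variable (f) in
theorem exists_isMaximalCompact : ∃ Z : IntermediateFactor f, Z.IsMaximalCompact :=
  ⟨apFactor f, IntermediateFactor.isMaximalCompact_of_forall fun _ => Iff.rfl⟩

end AlmostPeriodicAlgebra

/-! ### Relatively independent joinings -/

section RelIndependence

variable {X₁ : Type u} {X₂ : Type v} {Y : Type w'} {R : Type w} [ProbabilityAlgebra X₁]
  [ProbabilityAlgebra X₂] [ProbabilityAlgebra Y] [ProbabilityAlgebra R]

/-- `R` is generated by `X₁` and `X₂`, which are relatively independent over `Y`. -/
structure RelIndep (p₁ : Hom X₁ R) (p₂ : Hom X₂ R) (φ₁ : Hom Y X₁) (φ₂ : Hom Y X₂) : Prop where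
  comm : ∀ y, p₁.toFun (φ₁.toFun y) = p₂.toFun (φ₂.toFun y)
  cond_isom : ∀ ξ : L2 X₂, p₁.cond (p₂.isom ξ) = φ₁.isom (φ₂.cond ξ)
  dense : ∀ V : Submodule ℂ (L2 R), IsClosed (V : Set (L2 R)) →
    (∀ a b, toL2 (ind (p₁.toFun a ⊓ p₂.toFun b)) ∈ V) → ∀ ξ, ξ ∈ V

/-- Exchanging the two factors in `cond_isom` amounts to taking adjoints. -/
theorem RelIndep.symm {p₁ : Hom X₁ R} {p₂ : Hom X₂ R} {φ₁ : Hom Y X₁} {φ₂ : Hom Y X₂}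
    (h : RelIndep p₁ p₂ φ₁ φ₂) : RelIndep p₂ p₁ φ₂ φ₁ where
  comm y := (h.comm y).symm
  cond_isom ξ := ext_inner_left ℂ fun η => by
    rw [p₂.inner_cond_right, ← p₁.inner_cond_left, h.cond_isom, ← φ₂.inner_cond_left,
      φ₁.inner_cond_right]
  dense V hV hab := h.dense V hV fun a b => by rw [inf_comm]; exact hab b a

/-- Products of bounded functions on the two factors are total. -/
theorem RelIndep.dense_products {p₁ : Hom X₁ R} {p₂ : Hom X₂ R} {φ₁ : Hom Y X₁} {φ₂ : Hom Y X₂}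
    (h : RelIndep p₁ p₂ φ₁ φ₂) {V : Submodule ℂ (L2 R)} (hV : IsClosed (V : Set (L2 R)))
    (hab : ∀ (a : LInf X₁) (b : LInf X₂), toL2 (p₁.isomInf a * p₂.isomInf b) ∈ V) (ξ : L2 R) :
    ξ ∈ V :=
  h.dense V hV (fun a b => by
    rw [ind_inf, ← p₁.isomInf_ind, ← p₂.isomInf_ind]; exact hab _ _) ξ

theorem condProb_cyl_le_one (φ : Hom Y X₁) (a : X₁) :
    ∀ᵐ y ∂canonMeasure Y, condProb φ (cyl a) y ≤ 1 := by
  refine Measure.rnDeriv_le_one_of_le ?_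
  rw [← φ.measurePreserving_dual.map_eq]
  exact Measure.map_mono Measure.restrict_le_self φ.measurable_dual

theorem norm_condProb_le (φ : Hom Y X₁) (a : X₁) :
    ∀ᵐ y ∂canonMeasure Y, ‖(((condProb φ (cyl a) y).toReal : ℝ) : ℂ)‖ ≤ 1 := by
  filter_upwards [condProb_cyl_le_one φ a] with y hy
  rw [Complex.norm_real, Real.norm_of_nonneg ENNReal.toReal_nonneg]
  exact ENNReal.toReal_le_of_le_ofReal zero_le_one (by simpa using hy)

theorem aestronglyMeasurable_condProb (φ : Hom Y X₁) (a : X₁) :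
    AEStronglyMeasurable (fun y => (((condProb φ (cyl a) y).toReal : ℝ) : ℂ)) (canonMeasure Y) :=
  (Complex.measurable_ofReal.comp (measurable_condProb φ _).ennreal_toReal).aestronglyMeasurable

/-- `condProb` as an element of `L^∞(Y)`. -/
noncomputable def condProbInf (φ : Hom Y X₁) (a : X₁) : LInf Y :=
  ofFun _ (aestronglyMeasurable_condProb φ a) 1 (norm_condProb_le φ a)

theorem coeFn_condProbInf (φ : Hom Y X₁) (a : X₁) :
    ⇑(toL2 (condProbInf φ a)) =ᵐ[canonMeasure Y]
      fun y => (((condProb φ (cyl a) y).toReal : ℝ) : ℂ) :=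
  (LInf.coeFn_toL2 _).trans (coeFn_ofFun _ _)

/-- Links the Radon–Nikodym derivative `condProb`, which defines the joining, with the Hilbert space
adjoint `Hom.cond`: both integrate over `cyl y` to the mass of `a ⊓ φ y`. -/
theorem cond_ind (φ : Hom Y X₁) (a : X₁) :
    φ.cond (toL2 (ind a)) = toL2 (condProbInf φ a) := by
  refine ext_inner_ind fun y => ?_
  rw [φ.inner_cond_right, φ.isom_ind, inner_ind_ind, ind, toL2_indSet,
    L2.inner_indicatorConstLp_one, setIntegral_congr_ae (measurableSet_cyl y)
      ((coeFn_condProbInf φ a).mono fun ω hω _ => hω), integral_complex_ofReal]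
  congr 1
  rw [integral_toReal (measurable_condProb φ _).aemeasurable
    (ae_restrict_of_ae ((condProb_cyl_le_one φ a).mono fun ω h => h.trans_lt (by simp)))]
  congr 1
  have key : ∫⁻ z, condProb φ (cyl a) z * (cyl y).indicator 1 z ∂canonMeasure Y =
      ∫⁻ z in cyl y, condProb φ (cyl a) z ∂canonMeasure Y := by
    rw [← lintegral_indicator (measurableSet_cyl y)]
    refine lintegral_congr fun z => ?_
    by_cases hz : z ∈ cyl y <;> simp [hz]
  rw [← key, lintegral_condProb_mul φ _ (measurable_one.indicator (measurableSet_cyl y))]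
  have h2 : ∀ x, (cyl y).indicator (1 : Canon Y → ℝ≥0∞) (φ.dual x) =
    (cyl (φ.toFun y)).indicator 1 x := fun x => rfl
  simp_rw [h2]
  rw [lintegral_indicator_one (measurableSet_cyl _), Measure.restrict_apply (measurableSet_cyl _),
    ← cyl_inf, canonMeasure_cyl]

theorem inner_cond_ind (φ₁ : Hom Y X₁) (φ₂ : Hom Y X₂) (a : X₁) (b : X₂) :
    ⟪φ₁.cond (toL2 (ind a)), φ₂.cond (toL2 (ind b))⟫_ℂ =
      ((relForm φ₁ φ₂ (cyl a) (cyl b)).toReal : ℂ) := by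
  rw [cond_ind, cond_ind, L2.inner_def]
  have : ∀ᵐ y ∂canonMeasure Y, ⟪toL2 (condProbInf φ₁ a) y, toL2 (condProbInf φ₂ b) y⟫_ℂ =
      (((condProb φ₁ (cyl a) y * condProb φ₂ (cyl b) y).toReal : ℝ) : ℂ) := by
    filter_upwards [coeFn_condProbInf φ₁ a, coeFn_condProbInf φ₂ b] with y h1 h2
    rw [h1, h2, ENNReal.toReal_mul]
    simp [mul_comm]
  rw [integral_congr_ae this, integral_complex_ofReal, integral_toReal]
  · rfl
  · exact ((measurable_condProb φ₁ _).mul (measurable_condProb φ₂ _)).aemeasurable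
  · filter_upwards [condProb_cyl_le_one φ₁ a, condProb_cyl_le_one φ₂ b] with y h1 h2
    exact ENNReal.mul_lt_top (h1.trans_lt (by simp)) (h2.trans_lt (by simp))

/-- Relative independence on indicator functions suffices. -/
theorem cond_isom_of_ind {p₁ : Hom X₁ R} {p₂ : Hom X₂ R} {φ₁ : Hom Y X₁} {φ₂ : Hom Y X₂}
    (h : ∀ a b, prob (p₁.toFun a ⊓ p₂.toFun b) = relForm φ₁ φ₂ (cyl a) (cyl b)) (ξ : L2 X₂) :
    p₁.cond (p₂.isom ξ) = φ₁.isom (φ₂.cond ξ) := by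
  refine eq_top_of_ind_mem (V := LinearMap.eqLocus
    (p₁.cond.toLinearMap ∘ₗ p₂.isom.toLinearMap) (φ₁.isom.toLinearMap ∘ₗ φ₂.cond.toLinearMap))
    ?_ (fun b => ?_) ξ
  · exact isClosed_eq (p₁.cond.continuous.comp p₂.isom.continuous)
      (φ₁.isom.continuous.comp φ₂.cond.continuous)
  · refine ext_inner_ind fun a => ?_
    change ⟪toL2 (ind a), p₁.cond (p₂.isom (toL2 (ind b)))⟫_ℂ =
      ⟪toL2 (ind a), φ₁.isom (φ₂.cond (toL2 (ind b)))⟫_ℂ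
    rw [p₁.inner_cond_right, p₁.isom_ind, p₂.isom_ind, inner_ind_ind, h, ← inner_cond_ind,
      φ₁.inner_cond_left]

end RelIndependence

/-! ### The two factors of the relatively independent product are relatively independent. -/

namespace RelProd

variable {Γ : Type w} [Group Γ] {X₁ : Type u} {X₂ : Type v} {Y : Type w'} [ProbabilityAlgebra X₁]
  [ProbabilityAlgebra X₂] [ProbabilityAlgebra Y] [System Γ X₁] [System Γ X₂] [System Γ Y]
  (f₁ : FactorMap Γ X₁ Y) (f₂ : FactorMap Γ X₂ Y)

theorem fst_inf_snd (a : X₁) (b : X₂) : (fst f₁ f₂).toFun a ⊓ (snd f₁ f₂).toFun b =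
    mk f₁ f₂ (cyl a ×ˢ cyl b) ((measurableSet_cyl a).prod (measurableSet_cyl b)) :=
  MeasureAlgebra.mk_eq_iff.2 (by
    rw [prod_inter_prod, inter_univ, univ_inter]; exact ae_eq_refl _)

theorem mk_surjective (r : RelProd f₁ f₂) : ∃ s hs, mk f₁ f₂ s hs = r :=
  MeasureAlgebra.ind (p := fun r : RelProd f₁ f₂ => ∃ s hs, mk f₁ f₂ s hs = r)
    (fun s hs => ⟨s, hs, rfl⟩) r

/-- Relative independence is the defining value of the joining on rectangles. Totality is a `π`-`λ`
argument: the sets whose indicator lies in `V` contain the rectangles and are stable under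
complements and countable disjoint unions. -/
theorem relIndep :
    RelIndep (fst f₁ f₂).toHom (snd f₁ f₂).toHom f₁.toHom f₂.toHom where
  comm y := base_eq f₁ f₂ y
  cond_isom := cond_isom_of_ind fun a b => by
    rw [fst_inf_snd]
    exact relMeasure_prod _ _ a b
  dense V hV hab := by
    refine eq_top_of_ind_mem hV fun r => ?_
    obtain ⟨s, hs, rfl⟩ := mk_surjective f₁ f₂ r
    have htop : toL2 (ind (⊤ : RelProd f₁ f₂)) ∈ V := by
      have := hab ⊤ ⊤
      have h1 : (fst f₁ f₂).toFun ⊤ = ⊤ := (fst f₁ f₂).map_top'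
      have h2 : (snd f₁ f₂).toFun ⊤ = ⊤ := (snd f₁ f₂).map_top'
      rwa [h1, h2, inf_top_eq] at this
    have hcompl : ∀ r : RelProd f₁ f₂, toL2 (ind r) ∈ V → toL2 (ind rᶜ) ∈ V := fun r hr => by
      rw [ind_compl, toL2_sub]
      exact V.sub_mem htop hr
    have hbot : toL2 (ind (⊥ : RelProd f₁ f₂)) ∈ V := by
      rw [← compl_top]; exact hcompl _ htop
    refine MeasurableSpace.induction_on_inter
      (C := fun s hs => toL2 (ind (mk f₁ f₂ s hs)) ∈ V)
      (generateFrom_rectangles (X₁ := X₁) (X₂ := X₂))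
      (fun s hs t ht _ => isSetSemiring_rectangles.inter_mem s hs t ht) hbot ?_
      (fun t ht h => hcompl _ h) ?_ s hs
    · rintro _ ⟨_, ⟨a, rfl⟩, _, ⟨b, rfl⟩, rfl⟩
      have := hab a b
      rwa [fst_inf_snd] at this
    · intro t hd ht hV'
      let m : ℕ → RelProd f₁ f₂ := fun n => mk f₁ f₂ (t n) (ht n)
      have hdm : Pairwise (Function.onFun Disjoint m) := fun i j hij => by
        refine disjoint_iff.2 (MeasureAlgebra.mk_eq_iff.2 ?_)
        rw [(hd hij).inter_eq]
        exact ae_eq_refl _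
      refine toL2_ind_mem_of_isLUB hV (s := m) (fun n => ?_) (MeasureAlgebra.isLUB_mk t ht)
      induction n with
      | zero => rw [partialSups_zero]; exact hV' 0
      | succ n ih =>
        rw [partialSups_add_one, ind_sup_of_disjoint
          (partialSups_disjoint_of_disjoint m hdm (lt_add_one n)), toL2_add]
        exact V.add_mem ih (hV' (n + 1))

end RelProd

/-! ### Functions orthogonal to the almost periodic ones are weakly mixing -/

section WeakMixing

/-- The Alaoglu–Birkhoff ergodic theorem: every orbit of a unitary representation has a fixed point
in its closed convex hull. -/
theorem exists_fixed_mem_closedConvexHull {H Γ : Type*} [NormedAddCommGroup H]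
    [InnerProductSpace ℂ H] [CompleteSpace H] [Group Γ] (U : Γ → H →ₗᵢ[ℂ] H)
    (hU : ∀ γ δ x, U γ (U δ x) = U (γ * δ) x) (k₀ : H) :
    ∃ k, (∀ γ, U γ k = k) ∧ ∀ S : Set H, IsClosed S → (∀ γ, U γ k₀ ∈ S) →
      (∀ x ∈ S, ∀ y ∈ S, ∀ s t : ℝ, 0 ≤ s → 0 ≤ t → s + t = 1 →
        (s : ℂ) • x + (t : ℂ) • y ∈ S) → k ∈ S := by
  let : InnerProductSpace ℝ H := InnerProductSpace.rclikeToReal ℂ H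
  have hsmul : ∀ (r : ℝ) (x : H), r • x = (r : ℂ) • x := fun r x => rfl
  let K : Set H := closedConvexHull ℝ (range fun γ => U γ k₀)
  have hKconv : Convex ℝ K := convex_closedConvexHull
  have hKcl : IsClosed K := isClosed_closedConvexHull
  have hsub : (range fun γ => U γ k₀) ⊆ K := subset_closedConvexHull
  have hKne : K.Nonempty := ⟨_, hsub ⟨1, rfl⟩⟩
  -- The vector of minimal norm in the hull. Each isometry maps the hull into itself and preserves
  -- norms, so uniqueness makes the vector fixed.
  obtain ⟨v, hvK, hv⟩ := exists_norm_eq_iInf_of_complete_convex hKne hKcl.isComplete hKconv 0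
  have huniq : ∀ v' ∈ K, ‖(0 : H) - v'‖ = ⨅ w : K, ‖(0 : H) - w‖ → v' = v := by
    intro v' hv'K hv'
    have h1 := (norm_eq_iInf_iff_real_inner_le_zero hKconv hvK).1 hv v' hv'K
    have h2 := (norm_eq_iInf_iff_real_inner_le_zero hKconv hv'K).1 hv' v hvK
    -- Adding the variational inequalities of the two minimisers gives `‖v' - v‖² ≤ 0`.
    have h3 : inner ℝ (v' - v) (v' - v) ≤ (0 : ℝ) := by
      have h4 : inner ℝ (v' - v) (v' - v) =
          inner ℝ (0 - v) (v' - v) + inner ℝ (0 - v') (v - v') := by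
        rw [← neg_sub v' v, inner_neg_right, ← sub_eq_add_neg, ← inner_sub_left]
        congr 1
        abel
      linarith
    exact sub_eq_zero.1 (real_inner_self_nonpos.1 h3)
  refine ⟨v, fun γ => huniq _ ?_ ?_, fun S hS hmem hconv => ?_⟩
  · have hpre : K ⊆ U γ ⁻¹' K := by
      refine closedConvexHull_min ?_ ?_ (hKcl.preimage (U γ).continuous)
      · rintro _ ⟨δ, rfl⟩
        exact hsub ⟨γ * δ, (hU γ δ k₀).symm⟩
      · intro x hx y hy s t hs ht hst
        have := hKconv hx hy hs ht hst
        rw [hsmul, hsmul] at *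
        change U γ _ ∈ K
        rwa [map_add, map_smul, map_smul]
    exact hpre hvK
  · rw [← hv, zero_sub, zero_sub, norm_neg, norm_neg, (U γ).norm_map]
  · refine closedConvexHull_min ?_ ?_ hS hvK
    · rintro _ ⟨γ, rfl⟩
      exact hmem γ
    · intro x hx y hy s t hs ht hst
      rw [hsmul, hsmul]
      exact hconv x hx y hy s t hs ht hst

variable {Γ : Type w} [Group Γ] {X : Type u} {Y : Type v} [ProbabilityAlgebra X]
  [ProbabilityAlgebra Y] [System Γ X] [System Γ Y]

/-- Convolution with an invariant kernel on `X ×_Y X` yields almost periodic functions. -/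
theorem almostPeriodic_convolution (f : FactorMap Γ X Y) {k : LInf (RelProd f f)}
    (hk : ∀ γ : Γ, rep (RelProd f f) γ (toL2 k) = toL2 k) (u : LInf X) :
    AlmostPeriodic f
      ((RelProd.fst f f).cond (mulL2 ((RelProd.snd f f).isomInf u) (toL2 k))) := by
  have hR := RelProd.relIndep f f
  let T : Γ → L2 (RelProd f f) →ₗ[ℂ] L2 X := fun γ => (RelProd.fst f f).cond.toLinearMap ∘ₗ
    (mulL2 ((RelProd.snd f f).isomInf (repInf X γ u))).toLinearMap
  have hT : ∀ γ K, T γ K = (RelProd.fst f f).cond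
    (mulL2 ((RelProd.snd f f).isomInf (repInf X γ u)) K) := fun _ _ => rfl
  rw [almostPeriodic_iff]
  -- Since the kernel is invariant, translating the convolution only translates `u`.
  have h1 : ∀ γ : Γ, rep X γ ((RelProd.fst f f).cond
      (mulL2 ((RelProd.snd f f).isomInf u) (toL2 k))) = T γ (toL2 k) := fun γ => by
    rw [rep_cond, rep_mulL2, hk, repInf_isomInf, hT]
  simp_rw [h1]
  -- The kernel may be replaced by a product `a ⊗ b`: the maps `T γ` are equibounded, as `‖γu‖∞ =
  -- ‖u‖∞`. For a product, `T γ` gives `E(γu · b | Y) · a`, a bounded multiple of the single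
  -- generator `a`.
  refine ApproxByModule.mem_submodule.1 (hR.dense_products
    (ApproxByModule.isClosed_submodule (C := ‖u‖) fun γ K => ?_) (fun a b => ?_) (toL2 k))
  · rw [hT]
    refine (Hom.norm_cond_le _ _).trans ((norm_mulL2_le _ _).trans_eq ?_)
    rw [LinearIsometry.norm_map, norm_repInf]
  · rw [ApproxByModule.mem_submodule]
    have h2 : ∀ γ : Γ, T γ (toL2 ((RelProd.fst f f).isomInf a * (RelProd.snd f f).isomInf b)) =
        mulL2 (f.isomInf (f.condInf (repInf X γ u * b))) (toL2 a) := fun γ => by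
      rw [hT, toL2_mul, mulL2_comm, Hom.cond_mulL2, ← toL2_mul, ← Hom.isomInf_mul,
        ← Hom.isom_toL2, hR.cond_isom, ← f.toL2_condInf, f.isom_toL2, mulL2_toL2_comm]
    simp_rw [h2]
    refine ApproxByModule.base_mul (C := ‖u‖ * ‖b‖) a fun γ => ?_
    refine (f.norm_condInf_le _).trans ((LInf.norm_mul_le _ _).trans_eq ?_)
    rw [norm_repInf]

/-- Pairings of conditional expectations on `Y` become ordinary inner products on `X ×_Y X`, which
makes the ergodic theorem there applicable to them. -/
theorem inner_relProd_self (f : FactorMap Γ X Y) (ξ η : L2 X) :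
    ⟪(RelProd.snd f f).isom ξ, (RelProd.fst f f).isom η⟫_ℂ = ⟪f.cond ξ, f.cond η⟫_ℂ := by
  rw [← Hom.inner_cond_left, (RelProd.relIndep f f).cond_isom, ← f.inner_cond_right]

/-- With `k₀ = Σ g ⊗ ḡ` and `ω = u ⊗ ū`, the inner product `⟪k₀, γω⟫` equals `Σ ‖E(ḡ · γu | Y)‖²`.
If no `γ` makes all the terms small, averaging the orbit of `k₀` yields an invariant kernel `K` with
`Re ⟪K, ω⟫ ≥ ε²`. But `⟪K, ω⟫` pairs an almost periodic convolution with `u`, hence vanishes. -/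
theorem exists_norm_cond_le (f : FactorMap Γ X Y) {u : LInf X}
    (hu : ∀ a : LInf X, AlmostPeriodic f (toL2 a) → ⟪toL2 a, toL2 u⟫_ℂ = 0)
    (m : Finset (LInf X)) {ε : ℝ} (hε : 0 < ε) :
    ∃ γ : Γ, ∀ g ∈ m, ‖f.cond (mulL2 (star g) (rep X γ (toL2 u)))‖ ≤ ε := by
  by_contra! hcon
  set p₁ := RelProd.fst f f with hp₁
  set p₂ := RelProd.snd f f with hp₂
  let k₀ : LInf (RelProd f f) := ∑ g ∈ m, p₁.isomInf g * p₂.isomInf (star g)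
  let ω : L2 (RelProd f f) := mulL2 (star (p₂.isomInf u)) (p₁.isom (toL2 u))
  have hrep : ∀ γ : Γ, rep (RelProd f f) γ ω =
      mulL2 (star (p₂.isomInf (repInf X γ u))) (p₁.isom (rep X γ (toL2 u))) := fun γ => by
    have h1 : repInf (RelProd f f) γ (star (p₂.isomInf u)) =
        star (repInf (RelProd f f) γ (p₂.isomInf u)) := Hom.isomInf_star _ _
    rw [rep_mulL2, h1, repInf_isomInf, rep_isom]
  have hterm : ∀ (γ : Γ) (g : LInf X),
      ⟪toL2 (p₁.isomInf g * p₂.isomInf (star g)), rep (RelProd f f) γ ω⟫_ℂ =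
        ((‖f.cond (mulL2 (star g) (rep X γ (toL2 u)))‖ ^ 2 : ℝ) : ℂ) := fun γ g => by
    have h1 : ((‖f.cond (mulL2 (star g) (rep X γ (toL2 u)))‖ ^ 2 : ℝ) : ℂ) =
        ⟪f.cond (mulL2 (star g) (rep X γ (toL2 u))),
          f.cond (mulL2 (star g) (rep X γ (toL2 u)))⟫_ℂ := by
      rw [inner_self_eq_norm_sq_to_K]; push_cast; rfl
    rw [h1, ← inner_relProd_self, hrep, inner_mulL2_right, star_star, toL2_mul, Hom.isom_mulL2,
      Hom.isom_mulL2, inner_mulL2_right, ← Hom.isomInf_star, star_star, mulL2_comm,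
      mulL2_toL2_comm, rep_toL2, Hom.isom_toL2, Hom.isom_toL2]
  have hlow : ∀ γ : Γ, ε ^ 2 ≤ (⟪rep (RelProd f f) γ (toL2 k₀), ω⟫_ℂ).re := fun γ => by
    -- The inverse appears because `⟪γk₀, ω⟫ = ⟪k₀, γ⁻¹ω⟫`.
    obtain ⟨g, hg, hlt⟩ := hcon γ⁻¹
    rw [inner_rep_left, toL2_sum, sum_inner]
    simp_rw [hterm]
    rw [← Complex.ofReal_sum, Complex.ofReal_re]
    calc ε ^ 2 ≤ ‖f.cond (mulL2 (star g) (rep X γ⁻¹ (toL2 u)))‖ ^ 2 :=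
          pow_le_pow_left₀ hε.le hlt.le 2
      _ ≤ _ := Finset.single_le_sum
          (f := fun g => ‖f.cond (mulL2 (star g) (rep X γ⁻¹ (toL2 u)))‖ ^ 2)
          (fun g _ => sq_nonneg _) hg
  obtain ⟨K, hKfix, hK⟩ := exists_fixed_mem_closedConvexHull (fun γ : Γ => rep (RelProd f f) γ)
    (fun γ δ x => (rep_mul γ δ x).symm) (toL2 k₀)
  have hKre : ε ^ 2 ≤ (⟪K, ω⟫_ℂ).re := by
    refine hK {K | ε ^ 2 ≤ (⟪K, ω⟫_ℂ).re} ?_ hlow ?_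
    · exact isClosed_le continuous_const
        (Complex.continuous_re.comp (continuous_id.inner continuous_const))
    · intro x hx y hy s t hs ht hst
      simp only [Set.mem_ofPred_eq] at hx hy ⊢
      rw [inner_add_left, inner_smul_left, inner_smul_left, Complex.conj_ofReal,
        Complex.conj_ofReal, Complex.add_re, Complex.re_ofReal_mul, Complex.re_ofReal_mul]
      nlinarith
  -- Boundedness is encoded as a closed convex condition on `L²` vectors, so that it passes from the
  -- orbit of `k₀` to `K`.
  have hKb : ∀ x : LInf (RelProd f f), ‖mulL2 x K‖ ≤ ‖k₀‖ * ‖toL2 x‖ := by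
    refine hK {K | ∀ x : LInf (RelProd f f), ‖mulL2 x K‖ ≤ ‖k₀‖ * ‖toL2 x‖} ?_ ?_ ?_
    · rw [ofPred_forall]
      exact isClosed_iInter fun x => isClosed_le (mulL2 x).continuous.norm continuous_const
    · intro γ x
      rw [rep_toL2, mulL2_toL2_comm, ← norm_repInf γ k₀]
      exact norm_mulL2_le _ _
    · intro x hx y hy s t hs ht hst z
      rw [map_add, map_smul, map_smul]
      refine (norm_add_le _ _).trans ?_
      rw [norm_smul, norm_smul, Complex.norm_real, Complex.norm_real, Real.norm_of_nonneg hs,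
        Real.norm_of_nonneg ht]
      have h1 := mul_le_mul_of_nonneg_left (hx z) hs
      have h2 := mul_le_mul_of_nonneg_left (hy z) ht
      calc _ ≤ s * (‖k₀‖ * ‖toL2 z‖) + t * (‖k₀‖ * ‖toL2 z‖) := add_le_add h1 h2
        _ = _ := by rw [← add_mul, hst, one_mul]
  obtain ⟨k, rfl, -⟩ := exists_toL2_eq_of_forall (norm_nonneg _) hKb
  have hap := almostPeriodic_convolution f hKfix u
  rw [← toL2_mul, ← Hom.toL2_condInf] at hap
  have h0 := hu _ hap
  rw [Hom.toL2_condInf, Hom.inner_cond_left, toL2_mul, inner_mulL2_left] at h0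
  change ⟪toL2 k, ω⟫_ℂ = 0 at h0
  rw [h0, Complex.zero_re] at hKre
  have : 0 < ε ^ 2 := by positivity
  linarith

/-- Bounded functions orthogonal to the almost periodic ones are weakly mixing relative to `Y`. -/
theorem exists_filter_mixing (f : FactorMap Γ X Y) {u : LInf X}
    (hu : ∀ a : LInf X, AlmostPeriodic f (toL2 a) → ⟪toL2 a, toL2 u⟫_ℂ = 0) :
    ∃ F : Filter Γ, F.NeBot ∧ ∀ (g : LInf X) (ε : ℝ), 0 < ε → ∀ᶠ γ in F, ∀ y : LInf Y, ‖y‖ ≤ 1 →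
      ‖⟪rep X γ (toL2 u), mulL2 (f.isomInf y) (toL2 g)⟫_ℂ‖ ≤ ε := by
  classical
  let S : Finset (LInf X) × ℕ → Set Γ := fun p =>
    {γ | ∀ g ∈ p.1, ‖f.cond (mulL2 (star g) (rep X γ (toL2 u)))‖ ≤ 1 / ((p.2 : ℝ) + 1)}
  -- A filter takes the place of a mixing sequence, since there may be uncountably many `g`. The
  -- sets `S p` are directed, and nonempty by `exists_norm_cond_le`.
  refine ⟨⨅ p, 𝓟 (S p), ?_, fun g ε hε => ?_⟩
  · have : Nonempty Γ := ⟨1⟩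
    refine iInf_neBot_of_directed ?_ fun p => principal_neBot_iff.2 ?_
    · rintro ⟨m, n⟩ ⟨m', n'⟩
      refine ⟨(m ∪ m', max n n'), principal_mono.2 fun γ hγ g hg => ?_,
        principal_mono.2 fun γ hγ g hg => ?_⟩
      · refine (hγ g (Finset.mem_union_left _ hg)).trans ?_
        exact one_div_le_one_div_of_le (by positivity) (by simp)
      · refine (hγ g (Finset.mem_union_right _ hg)).trans ?_
        exact one_div_le_one_div_of_le (by positivity) (by simp)
    · exact exists_norm_cond_le f hu p.1 (by positivity)
  · obtain ⟨n, hn⟩ := exists_nat_one_div_lt hε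
    filter_upwards [mem_iInf_of_mem ({g}, n) (mem_principal_self _)] with γ hγ y hy
    -- The inner product is `⟪E(ḡ · γu | Y), y⟫`, which makes the bound uniform in `y`.
    rw [mulL2_toL2_comm, inner_mulL2_right, ← f.isom_toL2, ← f.inner_cond_left]
    calc _ ≤ ‖f.cond (mulL2 (star g) (rep X γ (toL2 u)))‖ * ‖toL2 y‖ := norm_inner_le_norm _ _
      _ ≤ 1 / ((n : ℝ) + 1) * 1 := mul_le_mul (hγ g (Finset.mem_singleton_self g))
          ((norm_toL2_le y).trans hy) (norm_nonneg _) (by positivity)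
      _ ≤ ε := by rw [mul_one]; exact hn.le

end WeakMixing

/-! ### Almost periodic functions on a relatively independent joining -/

section Joining

theorem norm_inner_mulL2_le_of_unit {A : Type u} {B : Type v} [ProbabilityAlgebra A]
    [ProbabilityAlgebra B] (φ : Hom A B) {ξ η : L2 B} {δ N : ℝ} (hN : 0 < N)
    (h : ∀ y : LInf A, ‖y‖ ≤ 1 → ‖⟪ξ, mulL2 (φ.isomInf y) η⟫_ℂ‖ ≤ δ) {y : LInf A}
    (hy : ‖y‖ ≤ N) : ‖⟪ξ, mulL2 (φ.isomInf y) η⟫_ℂ‖ ≤ N * δ := by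
  have hN' : (N : ℂ) ≠ 0 := by exact_mod_cast hN.ne'
  have h1 : y = (N : ℂ) • ((N : ℂ)⁻¹ • y) := by rw [smul_smul, mul_inv_cancel₀ hN', one_smul]
  have h2 : ‖(N : ℂ)⁻¹ • y‖ ≤ 1 := by
    rw [norm_smul, norm_inv, Complex.norm_real, Real.norm_of_nonneg hN.le, ← div_eq_inv_mul]
    exact (div_le_one hN).2 hy
  rw [h1, map_smul, map_smul, _root_.smul_apply, inner_smul_right, norm_mul, Complex.norm_real,
    Real.norm_of_nonneg hN.le]
  exact mul_le_mul_of_nonneg_left (h _ h2) hN.le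

variable {Γ : Type*} [Group Γ] {X₁ X₂ Y R : Type*} [ProbabilityAlgebra X₁]
  [ProbabilityAlgebra X₂] [ProbabilityAlgebra Y] [ProbabilityAlgebra R] [System Γ X₁]
  [System Γ X₂] [System Γ Y] [System Γ R]

/-- The generators are pulled back to `R`; the coefficients from `Y` stay the same. -/
theorem AlmostPeriodic.isom {f₁ : FactorMap Γ X₁ Y} {p₁ : FactorMap Γ R X₁} {f : FactorMap Γ R Y}
    (hf : ∀ y, f.toFun y = p₁.toFun (f₁.toFun y)) {ξ : L2 X₁} (hξ : AlmostPeriodic f₁ ξ) :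
    AlmostPeriodic f (p₁.isom ξ) := by
  rw [almostPeriodic_iff] at *
  intro ε hε
  obtain ⟨m, hm, g, C, hC⟩ := hξ ε hε
  refine ⟨m, hm, fun j => p₁.isomInf (g j), C, fun γ => ?_⟩
  obtain ⟨y, hy, hyk⟩ := hC γ
  refine ⟨y, hy, ?_⟩
  have : ∀ j, mulL2 (f.isomInf (y j)) (toL2 (p₁.isomInf (g j))) =
      p₁.isom (mulL2 (f₁.isomInf (y j)) (toL2 (g j))) := fun j => by
    rw [Hom.isom_mulL2, Hom.isom_toL2, Hom.isomInf_comp hf]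
  simp_rw [this]
  rw [rep_isom, ← map_sum, ← map_sub, LinearIsometry.norm_map]
  exact hyk

/-- An almost periodic function on the joining is orthogonal to the products with one factor
orthogonal to the almost periodic functions. -/
theorem RelIndep.inner_eq_zero {p₁ : FactorMap Γ R X₁} {p₂ : FactorMap Γ R X₂}
    {f₁ : FactorMap Γ X₁ Y} {f₂ : FactorMap Γ X₂ Y} {f : FactorMap Γ R Y}
    (hf : ∀ y, f.toFun y = p₁.toFun (f₁.toFun y))
    (h : RelIndep p₁.toHom p₂.toHom f₁.toHom f₂.toHom) {v : LInf X₁}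
    (hv : ∀ a : LInf X₁, AlmostPeriodic f₁ (toL2 a) → ⟪toL2 a, toL2 v⟫_ℂ = 0) (b : LInf X₂)
    {D : L2 R} (hD : AlmostPeriodic f D) :
    ⟪D, mulL2 (p₁.isomInf v) (toL2 (p₂.isomInf b))⟫_ℂ = 0 := by
  obtain ⟨F, hF, hmix⟩ := exists_filter_mixing f₁ hv
  set ω := mulL2 (p₁.isomInf v) (toL2 (p₂.isomInf b)) with hω
  -- The vectors `η` for which `⟪γω, y η⟫` tends to `0` along `F`, uniformly over the unit ball of
  -- `L^∞(Y)`. It is a closed subspace, so products suffice to show that it is everything.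
  let S : Submodule ℂ (L2 R) :=
    { carrier := {η | ∀ ε : ℝ, 0 < ε → ∀ᶠ γ in F, ∀ y : LInf Y, ‖y‖ ≤ 1 →
        ‖⟪rep R γ ω, mulL2 (f.isomInf y) η⟫_ℂ‖ ≤ ε}
      zero_mem' := fun ε hε => Eventually.of_forall fun γ y _ => by simpa using hε.le
      add_mem' := fun {η η'} hη hη' ε hε => by
        filter_upwards [hη (ε / 2) (by positivity), hη' (ε / 2) (by positivity)] with γ h1 h2 y hy
        rw [map_add, inner_add_right]
        exact (norm_add_le _ _).trans (by linarith [h1 y hy, h2 y hy])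
      smul_mem' := fun c η hη ε hε => by
        filter_upwards [hη (ε / (‖c‖ + 1)) (by positivity)] with γ h1 y hy
        rw [map_smul, inner_smul_right, norm_mul]
        calc _ ≤ ‖c‖ * (ε / (‖c‖ + 1)) := mul_le_mul_of_nonneg_left (h1 y hy) (norm_nonneg _)
          _ ≤ ε := by rw [mul_div_assoc', div_le_iff₀ (by positivity)]; nlinarith }
  have hScl : IsClosed (S : Set (L2 R)) := by
    refine isClosed_of_closure_subset fun η hη ε hε => ?_
    obtain ⟨η', hη', hd⟩ := Metric.mem_closure_iff.1 hη (ε / 2 / (‖ω‖ + 1)) (by positivity)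
    filter_upwards [hη' (ε / 2) (by positivity)] with γ h1 y hy
    rw [dist_eq_norm] at hd
    have h2 : ‖⟪rep R γ ω, mulL2 (f.isomInf y) (η - η')⟫_ℂ‖ ≤ ε / 2 := by
      calc _ ≤ ‖rep R γ ω‖ * ‖mulL2 (f.isomInf y) (η - η')‖ := norm_inner_le_norm _ _
        _ ≤ ‖ω‖ * (ε / 2 / (‖ω‖ + 1)) := by
            rw [LinearIsometry.norm_map]
            refine mul_le_mul_of_nonneg_left ?_ (norm_nonneg _)
            refine (norm_mulL2_isomInf_le _ hy _).trans ?_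
            rw [one_mul]
            exact hd.le
        _ ≤ ε / 2 := by rw [mul_div_assoc', div_le_iff₀ (by positivity)]; nlinarith
    calc _ = ‖⟪rep R γ ω, mulL2 (f.isomInf y) (η - η')⟫_ℂ +
          ⟪rep R γ ω, mulL2 (f.isomInf y) η'⟫_ℂ‖ := by
            rw [← inner_add_right, ← map_add, sub_add_cancel]
      _ ≤ ε := (norm_add_le _ _).trans (by linarith [h1 y hy])
  have hS : ∀ η, η ∈ S := fun η => by
    refine h.dense_products hScl (fun a c ε hε => ?_) η
    have hN : 0 < ‖b‖ * ‖c‖ + 1 := by positivity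
    filter_upwards [hmix a (ε / (‖b‖ * ‖c‖ + 1)) (by positivity)] with γ hγ y hy
    -- By relative independence, the functions on `X₂` enter only through `E((γb)* · c | Y)`. This
    -- coefficient varies with `γ` but is bounded by `‖b‖ ‖c‖`, so the mixing of `v`, uniform in the
    -- coefficient, applies.
    have key : ⟪rep R γ ω, mulL2 (f.isomInf y) (toL2 (p₁.isomInf a * p₂.isomInf c))⟫_ℂ =
        ⟪rep X₁ γ (toL2 v), mulL2 (f₁.isomInf (y * f₂.condInf (star (repInf X₂ γ b) * c)))
          (toL2 a)⟫_ℂ := by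
      have h1 : rep R γ ω =
          mulL2 (p₂.isomInf (repInf X₂ γ b)) (p₁.isom (rep X₁ γ (toL2 v))) := by
        rw [hω, mulL2_toL2_comm, rep_mulL2, repInf_isomInf, ← Hom.isom_toL2, rep_isom]
      rw [h1, inner_mulL2_left, ← Hom.isomInf_star, toL2_mul, ← Hom.isomInf_comp hf,
        mulL2_comm, mulL2_comm (p₂.isomInf _), ← toL2_mul, ← Hom.isomInf_mul,
        ← Hom.inner_cond_right, Hom.cond_mulL2, Hom.cond_mulL2, ← Hom.isom_toL2, h.cond_isom,
        ← f₂.toL2_condInf, f₁.isom_toL2, mulL2_toL2_comm a, Hom.isomInf_mul, mulL2_mul]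
    rw [key]
    refine (norm_inner_mulL2_le_of_unit f₁.toHom hN hγ ?_).trans_eq (by field_simp)
    calc _ ≤ ‖y‖ * ‖f₂.condInf (star (repInf X₂ γ b) * c)‖ := LInf.norm_mul_le _ _
      _ ≤ 1 * (‖b‖ * ‖c‖) := by
          refine mul_le_mul hy ?_ (norm_nonneg _) zero_le_one
          refine (f₂.norm_condInf_le _).trans ((LInf.norm_mul_le _ _).trans_eq ?_)
          rw [norm_star_LInf, norm_repInf]
      _ ≤ _ := by linarith
  rw [almostPeriodic_iff] at hD
  have hle : ∀ ε : ℝ, 0 < ε → ‖⟪D, ω⟫_ℂ‖ ≤ ε * ‖ω‖ + ε := fun ε hε => by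
    obtain ⟨m, _, g, C, hC⟩ := hD ε hε
    have hC1 : 0 < |C| + 1 := by positivity
    set δ := ε / (Fintype.card m + 1) / (|C| + 1) with hδ
    have hδ0 : 0 < δ := by positivity
    -- The finitely many generators are fixed before `γ`, so one `γ` serves them all. The
    -- coefficients `y` are chosen afterwards and depend on `γ`, hence the need for uniformity.
    obtain ⟨γ, hγ⟩ := (eventually_all.2 fun j => hS (toL2 (g j)) δ hδ0).exists
    obtain ⟨y, hy, hyD⟩ := hC γ
    set G := ∑ j, mulL2 (f.isomInf (y j)) (toL2 (g j)) with hG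
    have h1 : ‖⟪rep R γ D - G, rep R γ ω⟫_ℂ‖ ≤ ε * ‖ω‖ := by
      refine (norm_inner_le_norm _ _).trans ?_
      rw [LinearIsometry.norm_map]
      exact mul_le_mul_of_nonneg_right hyD (norm_nonneg _)
    have h2 : ‖⟪G, rep R γ ω⟫_ℂ‖ ≤ ε := by
      rw [norm_inner_symm, hG, inner_sum]
      calc _ ≤ ∑ _j : m, (|C| + 1) * δ := by
            refine (norm_sum_le _ _).trans (Finset.sum_le_sum fun j _ => ?_)
            exact norm_inner_mulL2_le_of_unit f.toHom hC1 (hγ j)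
              ((hy j).trans (by linarith [le_abs_self C]))
        _ = Fintype.card m * (ε / (Fintype.card m + 1)) := by
            rw [Finset.sum_const, Finset.card_univ, nsmul_eq_mul, hδ]
            field_simp
        _ ≤ ε := by rw [mul_div_assoc', div_le_iff₀ (by positivity)]; nlinarith
    calc ‖⟪D, ω⟫_ℂ‖ = ‖⟪rep R γ D - G, rep R γ ω⟫_ℂ + ⟪G, rep R γ ω⟫_ℂ‖ := by
          rw [← inner_add_left, sub_add_cancel, LinearIsometry.inner_map_map]
      _ ≤ _ := (norm_add_le _ _).trans (add_le_add h1 h2)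
  by_contra hne
  have hpos : 0 < ‖⟪D, ω⟫_ℂ‖ := norm_pos_iff.2 hne
  -- With this `ε` the bound `ε ‖ω‖ + ε` is half of `‖⟪D, ω⟫‖`.
  have := hle (‖⟪D, ω⟫_ℂ‖ / (2 * (‖ω‖ + 1))) (by positivity)
  have h3 : ‖⟪D, ω⟫_ℂ‖ / (2 * (‖ω‖ + 1)) * ‖ω‖ + ‖⟪D, ω⟫_ℂ‖ / (2 * (‖ω‖ + 1)) =
      ‖⟪D, ω⟫_ℂ‖ / 2 := by field_simp
  rw [h3] at this
  linarith

/-- The fluctuation of a bounded function over the maximal compact extension is orthogonal to the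
almost periodic functions. -/
theorem IntermediateFactor.IsMaximalCompact.inner_sub_cond {f₁ : FactorMap Γ X₁ Y}
    {Z : IntermediateFactor f₁} (hZ : Z.IsMaximalCompact) (u a : LInf X₁)
    (ha : AlmostPeriodic f₁ (toL2 a)) :
    ⟪toL2 a, toL2 (u - Z.fromTop.isomInf (Z.fromTop.condInf u))⟫_ℂ = 0 := by
  have h1 : Z.fromTop.isomInf (Z.fromTop.condInf a) = a :=
    mem_range_of_almostPeriodic hZ.almostPeriodic_ind_iff ha
  rw [← h1, ← Hom.isom_toL2, ← Hom.inner_cond_right, toL2_sub, map_sub, ← Hom.isom_toL2,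
    Hom.cond_isom, Hom.toL2_condInf _ u, sub_self, inner_zero_right]

/-- Against `D`, the product `u₁ ⊗ u₂` may be replaced by `e₁ ⊗ u₂` and then by `e₁ ⊗ e₂`, where `eᵢ
= E(uᵢ|Zᵢ)`, because the fluctuations contribute nothing. So `D` is orthogonal to a total set. -/
theorem RelIndep.eq_zero_of_almostPeriodic {p₁ : FactorMap Γ R X₁} {p₂ : FactorMap Γ R X₂}
    {f₁ : FactorMap Γ X₁ Y} {f₂ : FactorMap Γ X₂ Y} {f : FactorMap Γ R Y}
    (hf : ∀ y, f.toFun y = p₁.toFun (f₁.toFun y))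
    (h : RelIndep p₁.toHom p₂.toHom f₁.toHom f₂.toHom)
    {Z₁ : IntermediateFactor f₁} {Z₂ : IntermediateFactor f₂} (hZ₁ : Z₁.IsMaximalCompact)
    (hZ₂ : Z₂.IsMaximalCompact) {D : L2 R} (hD : AlmostPeriodic f D)
    (hDZ : ∀ (z₁ : LInf Z₁.Elem) (z₂ : LInf Z₂.Elem),
      ⟪D, toL2 (p₁.isomInf (Z₁.fromTop.isomInf z₁) * p₂.isomInf (Z₂.fromTop.isomInf z₂))⟫_ℂ = 0) :
    D = 0 := by
  have hf' : ∀ y, f.toFun y = p₂.toFun (f₂.toFun y) := fun y => (hf y).trans (h.comm y)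
  have hmem : D ∈ (ℂ ∙ D)ᗮ := by
    refine h.dense_products (Submodule.isClosed_orthogonal _) (fun u₁ u₂ => ?_) D
    rw [Submodule.mem_orthogonal_singleton_iff_inner_right]
    set e₁ := Z₁.fromTop.isomInf (Z₁.fromTop.condInf u₁) with he₁
    set e₂ := Z₂.fromTop.isomInf (Z₂.fromTop.condInf u₂) with he₂
    have h1 := h.inner_eq_zero hf (hZ₁.inner_sub_cond u₁) u₂ hD
    have h2 := h.symm.inner_eq_zero hf' (hZ₂.inner_sub_cond u₂) e₁ hD
    have h3 := hDZ (Z₁.fromTop.condInf u₁) (Z₂.fromTop.condInf u₂)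
    rw [← he₁, map_sub, map_sub, _root_.sub_apply, inner_sub_right, sub_eq_zero] at h1
    rw [← he₂, mulL2_toL2_comm, map_sub, toL2_sub, map_sub, inner_sub_right, sub_eq_zero] at h2
    rw [toL2_mul] at h3 ⊢
    rw [h1, h2, h3]
  rw [Submodule.mem_orthogonal_singleton_iff_inner_right] at hmem
  exact inner_self_eq_zero.1 hmem

end Joining

/-! ### The product of intermediate factors -/

theorem Hom.injective {A : Type u} {B : Type v} [ProbabilityAlgebra A] [ProbabilityAlgebra B]
    (φ : Hom A B) : Function.Injective φ.toFun := fun a b h => by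
  refine ind_injective (φ.isomInf.injective ?_)
  rw [φ.isomInf_ind, φ.isomInf_ind, h]

theorem Hom.le_iff_le {A : Type u} {B : Type v} [ProbabilityAlgebra A] [ProbabilityAlgebra B]
    (φ : Hom A B) {a b : A} : φ.toFun a ≤ φ.toFun b ↔ a ≤ b := by
  have : φ.toFun (a ⊓ b) = φ.toFun a ⊓ φ.toFun b := φ.map_inf' a b
  rw [← inf_eq_left, ← this, φ.injective.eq_iff, inf_eq_left]

section MapMeasureAlgebra

variable {Ω : Type u} {Ω' : Type v} [MeasurableSpace Ω] [MeasurableSpace Ω'] {μ : Measure Ω}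
  {ν : Measure Ω'} [IsProbabilityMeasure μ] [IsProbabilityMeasure ν]

/-- The homomorphism of measure algebras given by preimages under a measure-preserving map. -/
def MeasureAlgebra.comap {T : Ω → Ω'} (hT : MeasurePreserving T μ ν) :
    Hom (MeasureAlgebra ν) (MeasureAlgebra μ) where
  toFun := Quotient.map (sa := aeSetoid ν) (sb := aeSetoid μ)
    (fun s => ⟨T ⁻¹' s.1, hT.measurable s.2⟩)
    (fun _ _ h => hT.quasiMeasurePreserving.preimage_ae_eq h)
  map_sup' := ind fun _ _ => ind fun _ _ => rfl
  map_inf' := ind fun _ _ => ind fun _ _ => rfl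
  map_top' := rfl
  map_bot' := rfl
  prob_map := ind fun _ hs => hT.measure_preimage hs.nullMeasurableSet

end MapMeasureAlgebra

/-! ### The image of `Z₁ ×_Y Z₂` in `X₁ ×_Y X₂`. -/

section ProductOfFactors

variable {Γ : Type*} [Group Γ] {X₁ X₂ Y : Type*} [ProbabilityAlgebra X₁]
  [ProbabilityAlgebra X₂] [ProbabilityAlgebra Y] [System Γ X₁] [System Γ X₂] [System Γ Y]
  {f₁ : FactorMap Γ X₁ Y} {f₂ : FactorMap Γ X₂ Y} (Z₁ : IntermediateFactor f₁)
  (Z₂ : IntermediateFactor f₂)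

/-- Conditional probability over `Y` does not depend on the ambient extension. Hence the joining of
`X₁` and `X₂` pushes forward to that of `Z₁` and `Z₂`. -/
theorem IntermediateFactor.condProb_toBase (a : Z₁.Elem) :
    condProb f₁.toHom (cyl a.val) = condProb Z₁.toBase.toHom (cyl a) := by
  have h1 : f₁.dual = Z₁.toBase.dual ∘ Z₁.fromTop.dual := rfl
  have h2 : cyl a.val = Z₁.fromTop.dual ⁻¹' cyl a := rfl
  rw [condProb, condProb, h1, h2, ← Measure.map_map Z₁.toBase.measurable_dual
    Z₁.fromTop.measurable_dual, ← Measure.restrict_map Z₁.fromTop.measurable_dual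
      (measurableSet_cyl a), Z₁.fromTop.measurePreserving_dual.map_eq]

theorem measurePreserving_prodMap_dual :
    MeasurePreserving (Prod.map Z₁.fromTop.dual Z₂.fromTop.dual)
      (relMeasure f₁.toHom f₂.toHom) (relMeasure Z₁.toBase.toHom Z₂.toBase.toHom) := by
  have hm : Measurable (Prod.map Z₁.fromTop.dual Z₂.fromTop.dual) :=
    Z₁.fromTop.measurable_dual.prodMap Z₂.fromTop.measurable_dual
  refine ⟨hm, ?_⟩
  have : IsProbabilityMeasure ((relMeasure f₁.toHom f₂.toHom).map
    (Prod.map Z₁.fromTop.dual Z₂.fromTop.dual)) :=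
      Measure.isProbabilityMeasure_map hm.aemeasurable
  refine ext_of_generate_finite _ generateFrom_rectangles
    (fun s hs t ht _ => isSetSemiring_rectangles.inter_mem s hs t ht) ?_ (by simp)
  rintro _ ⟨_, ⟨a, rfl⟩, _, ⟨b, rfl⟩, rfl⟩
  rw [Measure.map_apply hm ((measurableSet_cyl a).prod (measurableSet_cyl b))]
  have h1 : Prod.map Z₁.fromTop.dual Z₂.fromTop.dual ⁻¹' (cyl a ×ˢ cyl b) =
    cyl a.val ×ˢ cyl b.val := rfl
  rw [h1, relMeasure_prod, relMeasure_prod, relForm, relForm, Z₁.condProb_toBase,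
    Z₂.condProb_toBase]

/-- The inclusion `Z₁ ×_Y Z₂ ⊆ X₁ ×_Y X₂`. -/
noncomputable def RelProd.inclusion :
    FactorMap Γ (RelProd f₁ f₂) (RelProd Z₁.toBase Z₂.toBase) where
  toHom := MeasureAlgebra.comap (measurePreserving_prodMap_dual Z₁ Z₂)
  map_smul _ := MeasureAlgebra.ind fun _ _ => rfl

variable {Z₁ Z₂}

/-- The easy half: rectangles over `Z₁` and `Z₂` have almost periodic indicators, and these are
total in `L²(Z₁ ×_Y Z₂)`. -/
theorem RelProd.almostPeriodic_inclusion (hZ₁ : Z₁.IsMaximalCompact) (hZ₂ : Z₂.IsMaximalCompact)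
    (ζ : L2 (RelProd Z₁.toBase Z₂.toBase)) :
    AlmostPeriodic (base f₁ f₂) ((inclusion Z₁ Z₂).isom ζ) := by
  refine mem_apSubmodule.1 ((relIndep Z₁.toBase Z₂.toBase).dense
    ((apSubmodule (base f₁ f₂)).comap (inclusion Z₁ Z₂).isom.toLinearMap) ?_ (fun a b => ?_) ζ)
  · exact (isClosed_apSubmodule _).preimage (inclusion Z₁ Z₂).isom.continuous
  · refine mem_apSubmodule.2 ?_
    change AlmostPeriodic _ ((inclusion Z₁ Z₂).isom (toL2 (ind _)))
    have h1 : (inclusion Z₁ Z₂).toFun ((fst Z₁.toBase Z₂.toBase).toFun a ⊓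
        (snd Z₁.toBase Z₂.toBase).toFun b) = (fst f₁ f₂).toFun a.val ⊓ (snd f₁ f₂).toFun b.val :=
      (inclusion Z₁ Z₂).map_inf' _ _
    rw [Hom.isom_ind, h1]
    refine AlmostPeriodic.ind_inf ?_ ?_
    · rw [← Hom.isom_ind]
      exact ((hZ₁.almostPeriodic_ind_iff _).2 (Subtype.property a)).isom fun y => rfl
    · rw [← Hom.isom_ind]
      exact ((hZ₂.almostPeriodic_ind_iff _).2 (Subtype.property b)).isom (base_eq f₁ f₂)

/-- The hard half: `1_c - E(1_c | Z₁ ×_Y Z₂)` is almost periodic by the easy half and orthogonal to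
all products from `Z₁` and `Z₂`, so it vanishes. -/
theorem RelProd.exists_inclusion_eq (hZ₁ : Z₁.IsMaximalCompact) (hZ₂ : Z₂.IsMaximalCompact)
    {c : RelProd f₁ f₂} (hc : AlmostPeriodic (base f₁ f₂) (toL2 (ind c))) :
    ∃ r, (inclusion Z₁ Z₂).toFun r = c := by
  refine (inclusion Z₁ Z₂).exists_eq_of_ind_mem
    ⟨(inclusion Z₁ Z₂).cond (toL2 (ind c)), (sub_eq_zero.1 ?_).symm⟩
  refine (relIndep f₁ f₂).eq_zero_of_almostPeriodic (f := base f₁ f₂) (fun y => rfl) hZ₁ hZ₂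
    (hc.sub (almostPeriodic_inclusion hZ₁ hZ₂ _)) fun z₁ z₂ => ?_
  have h1 : (fst f₁ f₂).isomInf (Z₁.fromTop.isomInf z₁) =
      (inclusion Z₁ Z₂).isomInf ((fst Z₁.toBase Z₂.toBase).isomInf z₁) := by
    rw [Hom.isomInf_comp (χ := ⟨(fst f₁ f₂).toBoundedLatticeHom.comp
      Z₁.fromTop.toBoundedLatticeHom, fun a => (fst f₁ f₂).prob_map _⟩) (fun a => rfl)]
    exact (Hom.isomInf_comp (fun a => rfl) z₁).symm
  have h2 : (snd f₁ f₂).isomInf (Z₂.fromTop.isomInf z₂) =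
      (inclusion Z₁ Z₂).isomInf ((snd Z₁.toBase Z₂.toBase).isomInf z₂) := by
    rw [Hom.isomInf_comp (χ := ⟨(snd f₁ f₂).toBoundedLatticeHom.comp
      Z₂.fromTop.toBoundedLatticeHom, fun a => (snd f₁ f₂).prob_map _⟩) (fun a => rfl)]
    exact (Hom.isomInf_comp (fun a => rfl) z₂).symm
  rw [h1, h2, ← Hom.isomInf_mul, ← Hom.isom_toL2, ← Hom.inner_cond_left, map_sub, Hom.cond_isom,
    sub_self, inner_zero_left]

/-- The product of the maximal compact extensions is the maximal compact extension of the
product. -/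
theorem RelProd.exists_iso {Z : IntermediateFactor (base f₁ f₂)} (hZ₁ : Z₁.IsMaximalCompact)
    (hZ₂ : Z₂.IsMaximalCompact) (hZ : Z.IsMaximalCompact) :
    ∃ e : SystemIso Γ (RelProd Z₁.toBase Z₂.toBase) Z.Elem,
      ∀ r, (e.toFun r).val = (inclusion Z₁ Z₂).toFun r := by
  have hmem : ∀ r, (inclusion Z₁ Z₂).toFun r ∈ Z.carrier := fun r => by
    rw [← hZ.almostPeriodic_ind_iff, ← Hom.isom_ind]
    exact almostPeriodic_inclusion hZ₁ hZ₂ _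
  let g : RelProd Z₁.toBase Z₂.toBase → Z.Elem := fun r =>
    IntermediateFactor.lift ((inclusion Z₁ Z₂).toFun r) (hmem r)
  have hg : Function.Bijective g := by
    refine ⟨fun r s h => (inclusion Z₁ Z₂).injective (congrArg IntermediateFactor.Elem.val h),
      fun c => ?_⟩
    obtain ⟨r, hr⟩ := exists_inclusion_eq hZ₁ hZ₂
      ((hZ.almostPeriodic_ind_iff c.val).2 (Subtype.property c))
    exact ⟨r, Subtype.ext hr⟩
  exact ⟨{
    toEquiv := Equiv.ofBijective g hg
    map_rel_iff' := fun {r s} => (inclusion Z₁ Z₂).le_iff_le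
    prob_map := fun r => (inclusion Z₁ Z₂).prob_map r
    map_smul := fun γ r => Subtype.ext ((inclusion Z₁ Z₂).map_smul γ r) }, fun r => rfl⟩

end ProductOfFactors

end ProbabilityAlgebra

theorem mainTheorem8 {Γ X₁ X₂ Y : Type*} [Group Γ]
    [ProbabilityAlgebra X₁] [ProbabilityAlgebra X₂] [ProbabilityAlgebra Y]
    [System Γ X₁] [System Γ X₂] [System Γ Y]
    (f₁ : FactorMap Γ X₁ Y) (f₂ : FactorMap Γ X₂ Y) :
    (∃ Z₁ : IntermediateFactor f₁, Z₁.IsMaximalCompact) ∧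
    (∃ Z₂ : IntermediateFactor f₂, Z₂.IsMaximalCompact) ∧
    (∃ Z : IntermediateFactor (RelProd.base f₁ f₂), Z.IsMaximalCompact) ∧
    ∀ (Z₁ : IntermediateFactor f₁) (Z₂ : IntermediateFactor f₂)
      (Z : IntermediateFactor (RelProd.base f₁ f₂)),
      Z₁.IsMaximalCompact → Z₂.IsMaximalCompact → Z.IsMaximalCompact →
      ∃ e : SystemIso Γ (RelProd Z₁.toBase Z₂.toBase) Z.Elem,
        (∀ a : Z₁.Elem, (e.toFun ((RelProd.fst Z₁.toBase Z₂.toBase).toFun a)).val =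
          (RelProd.fst f₁ f₂).toFun a.val) ∧
        (∀ b : Z₂.Elem, (e.toFun ((RelProd.snd Z₁.toBase Z₂.toBase).toFun b)).val =
          (RelProd.snd f₁ f₂).toFun b.val) := by
  refine ⟨exists_isMaximalCompact f₁, exists_isMaximalCompact f₂,
    exists_isMaximalCompact (RelProd.base f₁ f₂), fun Z₁ Z₂ Z hZ₁ hZ₂ hZ => ?_⟩
  obtain ⟨e, he⟩ := RelProd.exists_iso hZ₁ hZ₂ hZ
  -- The inclusion takes preimages under a product map, so on the cylinders over `a` and `b` both
  -- compatibilities hold by definition.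
  exact ⟨e, fun a => he _, fun b => he _⟩
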